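/- Let $n\ge 3$ and let $W=I_2(n)$ be the dihedral group of order $2n$, regarded as a Coxeter group with generators $s,t$ and length function $\ell$. Let $A=\mathbb Z[x,x^{-1}]$ and let $\mathcal H$ be the Iwahori–Hecke algebra of $W$ over $A$: it is generated by $T_s,T_t$ subject to $(T_s-x)(T_s+1)=0=(T_t-x)(T_t+1)$ and the braid relation $T_sT_tT_s\cdots=T_tT_sT_t\cdots$ ($n$ factors on each side). Let $k$ be a number field and $K$ a finite Galois extension of $k(x)$ such that the algebras $K\mathcal H=K\otimes_A\mathcal H$ and $K[W]$ are split semisimple. Let $B$ be the integral closure of $A$ in $K$, and let $$\mathcal O=B\left[(1+xP(x))^{-1}\right]_{P\in\mathbb Z[x]}\subset K .$$ Let $\mathfrak n$ be a prime ideal of $B$ with $\mathfrak n\cap A=(x-1)$, and identify the irreducible characters of $K\mathcal H$ with those of $W$ by letting $\chi$ correspond to $\varphi$ if they have the same reduction modulo $\mathfrak n$ under the isomorphism $\mathcal H/(x-1)\cong\mathbb Z[W]$, $T_s\mapsto s$, $T_t\mapsto t$. A block of $\mathcal O\mathcal H=\mathcal O\otimes_A\mathcal H$ is identified with the set of irreducible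 characters (of $K\mathcal H$, hence of $W$) that do not vanish on the corresponding primitive central idempotent. Lusztig's families of $\mathrm{Irr}(W)$ are the sets of characters attached to the two-sided Kazhdan–Lusztig cells $c$ of $W$: the family of $c$ consists of the irreducible characters occurring in $K[W]_{\le c}/K[W]_{<c}$, where $K[W]_{\le c}$ and $K[W]_{<c}$ are spanned by the Kazhdan–Lusztig basis elements (at $x=1$) indexed by the elements of $W$ that are $\le_{LR}c$, respectively $<_{LR}c$. Then the blocks of $\mathcal O\mathcal H$ coincide with Lusztig's families of $\mathrm{Irr}(W)$, and these are exactly the following three sets: $\{1\}$, where $1$ is the trivial character; $\{\varepsilon\}$, where $\varepsilon(w)=(-1)^{\ell(w)}$ is the sign character; and the set of all the other irreducible characters of $W$. -/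

import Mathlib

open scoped LaurentPolynomial Polynomial TensorProduct

noncomputable section

namespace HeckeFamilies

/-- The ring `A = ℤ[x, x⁻¹]`; the indeterminate `x` is `LaurentPolynomial.T 1`. -/
abbrev A : Type := ℤ[T;T⁻¹]

/-- The indeterminate `x` of `A`. -/
def x : A := LaurentPolynomial.T 1

section Hecke

variable {B : Type*} (M : CoxeterMatrix B)

/-- The relations of the Iwahori–Hecke algebra with equal parameter `x`: the quadratic relations
`(T_i - x)(T_i + 1) = 0` and the braid relations `T_i T_j T_i ⋯ = T_j T_i T_j ⋯`
(with `M i j` factors on each side). -/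
inductive HeckeRel : FreeAlgebra A B → FreeAlgebra A B → Prop
  | quadratic (i : B) :
      HeckeRel ((FreeAlgebra.ι A i - algebraMap A (FreeAlgebra A B) x) * (FreeAlgebra.ι A i + 1)) 0
  | braid (i j : B) :
      HeckeRel ((CoxeterSystem.braidWord M i j).map (FreeAlgebra.ι A)).prod
        ((CoxeterSystem.braidWord M j i).map (FreeAlgebra.ι A)).prod

/-- The Iwahori–Hecke algebra `H` over `A = ℤ[x, x⁻¹]` of the Coxeter group of matrix `M`. -/
def HeckeAlgebra : Type _ := RingQuot (HeckeRel M)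

instance : Ring (HeckeAlgebra M) := inferInstanceAs (Ring (RingQuot (HeckeRel M)))

instance : Algebra A (HeckeAlgebra M) := inferInstanceAs (Algebra A (RingQuot (HeckeRel M)))

/-- The quotient map from the free algebra to the Hecke algebra. -/
def heckeMk : FreeAlgebra A B →ₐ[A] HeckeAlgebra M := RingQuot.mkAlgHom A (HeckeRel M)

/-- The generator `T_i` of the Hecke algebra. -/
def heckeGen (i : B) : HeckeAlgebra M := heckeMk M (FreeAlgebra.ι A i)

/-- The product `T_{i₁} ⋯ T_{iᵣ}` attached to a word `i₁ ⋯ iᵣ`. -/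
def heckeWord (ω : List B) : HeckeAlgebra M := (ω.map (heckeGen M)).prod

variable {M} {W : Type*} [Group W] (cs : CoxeterSystem M W)

/-- The standard element `T_w`: the product of the generators along a reduced word of `w`
(by the braid relations it does not depend on the reduced word). -/
def heckeT (w : W) : HeckeAlgebra M := heckeWord M (cs.exists_isReduced w).choose

end Hecke

section Characters

/-- A `K`-algebra is split semisimple if it is a finite product of matrix algebras over `K`. -/
def IsSplitSemisimple (K R : Type*) [Field K] [Ring R] [Algebra K R] : Prop :=
  ∃ (m : ℕ) (d : Fin m → ℕ), Nonempty (R ≃ₐ[K] ∀ i, Matrix (Fin (d i)) (Fin (d i)) K)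

/-- The irreducible characters of a `K`-algebra `R`: the traces of its finite-dimensional
irreducible representations. -/
def irrAlgebra (K R : Type*) [Field K] [Ring R] [Algebra K R] : Set (R →ₗ[K] K) :=
  {χ | ∃ (d : ℕ) (ρ : R →ₐ[K] Module.End K (Fin d → K)), 0 < d ∧
    (∀ U : Submodule K (Fin d → K), (∀ r, ∀ v ∈ U, ρ r v ∈ U) → U = ⊥ ∨ U = ⊤) ∧
    χ = LinearMap.trace K (Fin d → K) ∘ₗ ρ.toLinearMap}

/-- `Irr(W)`: the irreducible characters over `K` of the group `W`. -/
def irrGroup (K W : Type*) [Field K] [Group W] : Set (W → K) :=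
  {φ | ∃ (d : ℕ) (ρ : Representation K W (Fin d → K)), ρ.IsIrreducible ∧
    φ = fun w => LinearMap.trace K (Fin d → K) (ρ w)}

end Characters

section Blocks

/-- `e` is a central idempotent. -/
def IsCentralIdempotent {R : Type*} [Ring R] (e : R) : Prop :=
  e * e = e ∧ ∀ r : R, e * r = r * e

/-- `e` is a block idempotent, i.e. a primitive central idempotent: it is nonzero and the only
central idempotents `f` with `f e = f` are `0` and `e`. -/
def IsBlockIdempotent {R : Type*} [Ring R] (e : R) : Prop :=
  IsCentralIdempotent e ∧ e ≠ 0 ∧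
    ∀ f : R, IsCentralIdempotent f → f * e = f → f = 0 ∨ f = e

variable (K : Type*) [Field K] [Algebra A K]

/-- The ring `𝒪 = B[(1 + x P(x))⁻¹ ; P ∈ ℤ[x]]` where `B` is the integral closure of `A` in `K`. -/
def ringO : Subalgebra A K :=
  integralClosure A K ⊔
    Algebra.adjoin A (Set.range fun P : ℤ[X] =>
      (1 + algebraMap A K x * Polynomial.aeval (algebraMap A K x) P)⁻¹)

variable {K} {B : Type*} {M : CoxeterMatrix B} {W : Type*} [Group W] (cs : CoxeterSystem M W)

/-- The identification of `Irr(K H)` with `Irr(W)` given by a prime `𝔫` of `B` above `(x - 1)`: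
`χ` corresponds to `φ` when they have the same reduction modulo `𝔫` under the isomorphism
`H / (x - 1) ≅ ℤ[W]` sending `T_{i₁} ⋯ T_{iᵣ}` to `s_{i₁} ⋯ s_{iᵣ}`. -/
def Corresponds (𝔫 : Ideal (integralClosure A K))
    (χ : (K ⊗[A] HeckeAlgebra M) →ₗ[K] K) (φ : W → K) : Prop :=
  ∀ ω : List B, ∃ b ∈ 𝔫, (b : K) = χ (1 ⊗ₜ[A] heckeWord M ω) - φ (cs.wordProd ω)

/-- The blocks of `𝒪 H`, as a set of subsets of `Irr(W)`: the block of `e` consists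
of the characters that do not vanish on `e`. -/
def heckeBlocks (𝔫 : Ideal (integralClosure A K)) : Set (Set (W → K)) :=
  {F | ∃ e : ringO K ⊗[A] HeckeAlgebra M, IsBlockIdempotent e ∧
    F = {φ | φ ∈ irrGroup K W ∧ ∃ χ ∈ irrAlgebra K (K ⊗[A] HeckeAlgebra M),
      Corresponds cs 𝔫 χ φ ∧
      χ (Algebra.TensorProduct.map (ringO K).val (AlgHom.id A (HeckeAlgebra M)) e) ≠ 0}}

end Blocks

section Families

variable {B : Type*} {M : CoxeterMatrix B} {W : Type*} [Group W] (cs : CoxeterSystem M W)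

/-- The element `∑_y P_{y,w}(x) T_y` (that is, `x^{ℓ(w)/2} C'_w`), where `P w y` stands for
`P_{y,w}`. -/
def klElement (P : W → W →₀ ℤ[X]) (w : W) : HeckeAlgebra M :=
  (P w).sum fun y p => Polynomial.toLaurent p • heckeT cs y

/-- The family `P` consists of the Kazhdan–Lusztig polynomials: `P_{w,w} = 1`,
`deg P_{y,w} ≤ (ℓ(w) - ℓ(y) - 1) / 2` for `y ≠ w` with `P_{y,w} ≠ 0`, and
`x^{-ℓ(w)/2} ∑_y P_{y,w} T_y` is fixed by the bar involution
`∑_y a_y(x) T_y ↦ ∑_y a_y(x⁻¹) (T_{y⁻¹})⁻¹`. -/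
def IsKazhdanLusztig (P : W → W →₀ ℤ[X]) : Prop :=
  (∀ w, P w w = 1) ∧
  (∀ w y, y ≠ w → P w y ≠ 0 → 2 * (P w y).natDegree + cs.length y < cs.length w) ∧
  ∀ w, ((P w).sum fun y p =>
      LaurentPolynomial.invert (Polynomial.toLaurent p) • Ring.inverse (heckeT cs y⁻¹)) =
    (LaurentPolynomial.T (-(cs.length w : ℤ)) : A) • klElement cs P w

/-- `C_v` appears with a nonzero coefficient in the expansion of `T_i C_u` or of `C_u T_i` on the
Kazhdan–Lusztig basis, for some generator `T_i`. -/
def KLStep (P : W → W →₀ ℤ[X]) (u v : W) : Prop :=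
  ∃ (i : B) (a : W →₀ A),
    (heckeGen M i * klElement cs P u = (a.sum fun y c => c • klElement cs P y) ∨
      klElement cs P u * heckeGen M i = (a.sum fun y c => c • klElement cs P y)) ∧
    a v ≠ 0

/-- The two-sided Kazhdan–Lusztig preorder `v ≤_LR u`. The two-sided cells are the classes of the
associated equivalence relation. -/
def LRLe (P : W → W →₀ ℤ[X]) (v u : W) : Prop := Relation.ReflTransGen (KLStep cs P) u v

variable (K : Type*) [Field K]

/-- The image in `K[W]` of the Kazhdan–Lusztig basis element of `w` under `x ↦ 1`. -/
def klGroupElement (P : W → W →₀ ℤ[X]) (w : W) : MonoidAlgebra K W :=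
  (P w).sum fun y p => MonoidAlgebra.single y ((p.eval 1 : ℤ) : K)

/-- The two-sided ideal `K[W]_{≤ c}`, where `c` is the two-sided cell of `w`. -/
def cellIdeal (P : W → W →₀ ℤ[X]) (w : W) : Submodule K (MonoidAlgebra K W) :=
  Submodule.span K (klGroupElement K P '' {v | LRLe cs P v w})

/-- The two-sided ideal `K[W]_{< c}`, where `c` is the two-sided cell of `w`. -/
def strictCellIdeal (P : W → W →₀ ℤ[X]) (w : W) : Submodule K (MonoidAlgebra K W) :=
  Submodule.span K (klGroupElement K P '' {v | LRLe cs P v w ∧ ¬ LRLe cs P w v})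

/-- The characters attached to the two-sided cell `c` of `w`: those of the irreducible
representations occurring in the left `K[W]`-module `K[W]_{≤ c} / K[W]_{< c}`, i.e. admitting a
nonzero intertwining map from it. -/
def cellFamily (P : W → W →₀ ℤ[X]) (w : W) : Set (W → K) :=
  {φ | ∃ (d : ℕ) (ρ : Representation K W (Fin d → K)), ρ.IsIrreducible ∧
    (φ = fun g => LinearMap.trace K (Fin d → K) (ρ g)) ∧
    ∃ f : cellIdeal cs K P w →ₗ[K] (Fin d → K), f ≠ 0 ∧
      (∀ (g : W) (z z' : cellIdeal cs K P w),
        (z' : MonoidAlgebra K W) = MonoidAlgebra.single g 1 * (z : MonoidAlgebra K W) →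
          f z' = ρ g (f z)) ∧
      ∀ z : cellIdeal cs K P w, (z : MonoidAlgebra K W) ∈ strictCellIdeal cs K P w → f z = 0}

/-- Lusztig's families of irreducible characters of `W`: the sets of characters attached to the
two-sided Kazhdan–Lusztig cells. -/
def lusztigFamilies : Set (Set (W → K)) :=
  {F | ∃ P : W → W →₀ ℤ[X], IsKazhdanLusztig cs P ∧ ∃ w : W, F = cellFamily cs K P w}

end Families

/-- The trivial character. -/
def trivialChar (K W : Type*) [Field K] : W → K := fun _ => 1

/-- The sign character `w ↦ (-1)^{ℓ(w)}`. -/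
def signChar {B : Type*} {M : CoxeterMatrix B} {W : Type*} [Group W] (cs : CoxeterSystem M W)
    (K : Type*) [Field K] : W → K := fun w => (-1) ^ cs.length w

end HeckeFamilies

end

/-! Both sides are computed explicitly and turn out to be the same three sets.

Families. In a dihedral group every shorter element lies below a given one in the Bruhat order, and
all Kazhdan–Lusztig polynomials for such pairs equal 1. The elements `C_w = ∑_{y ≤ w} T_y` obey
`(T_a + 1) C_u = C_{au} + x C_v`, where `u` starts with the letter other than `a` and `v` is `u`
without its first letter, the last term being absent when `u` is a single letter
(`add_one_mul_altKL`). This rule passes through the bar involution, which proves that the `C_w` are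
the Kazhdan–Lusztig elements (`altKL_invGen`); uniqueness is a degree comparison
(`toLaurent_bar_ne`). The same rule yields the preorder (`lrLe_iff`): for `n ≥ 3` the cells are
`{1}`, `{w₀}` and everything else. The corresponding filtration of `K[W]` is `K C_{w₀} ⊂ ker ε ⊂
K[W]`, and its three layers carry the trivial character, all the remaining characters, and `ε`.

Blocks. The Poincaré polynomial `(1 + x)(1 + x + ⋯ + x^{n-1})` has constant term 1, so it is a unit
of `𝒪`. Dividing `C_{w₀}` by it, and doing the same after `T ↦ x - 1 - T`, gives central idempotents
over `𝒪` which cut out the characters `T_i ↦ x` and `T_i ↦ -1`. What remains is to show that the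
complementary idempotent is primitive.

The other irreducible representations are indexed by `n`-th roots of unity `ξ ≠ 1`, up to inversion.
For `ξ ≠ -1` there is a two-dimensional one with parameter `c = ξ + ξ⁻¹` (`classify_irreducible`);
`ξ = -1` stands for the two mixed linear characters, which are the constituents of the degenerate
parameter `c = -2`. A central idempotent over `𝒪` acts on each of them by 0 or 1. If `η` has order a
power of a prime `p`, the parameters of `ξ` and `ξη` differ by `(1 - η)(ξ - (ξη)⁻¹)`. This lies in a
prime above the kernel of reduction modulo `p`, a prime containing no `1 + xP`, so it is not a unit
of `𝒪` (`sub_mul_ne_one`). Modulo it the two representations agree or share constituents, hence the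
values 0 or 1 coincide (`dihRep_eq_dihRep`, `dihRep_eq_baseLift`). Any two nontrivial `n`-th roots
of unity are joined by such multiplications without passing through 1 (`eq_of_invariant`), so the
value is the same everywhere, and separation of elements by irreducible representations finishes the
argument.

The identification with `Irr(W)` is explicit: keep `c` and move the parameter from `1` to `x`; in
degree one replace the value `1` by `x`. -/

noncomputable section

namespace HeckeFamilies

/-! ### Alternating words in two generators and the dihedral Hecke relations -/

section AlternatingProducts

/-- The product `t a * t (a + 1) * t a * ⋯` with `m` factors. -/
def altProd {R : Type*} [Monoid R] (t : Fin 2 → R) : Fin 2 → ℕ → R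
  | _, 0 => 1
  | a, m + 1 => t a * altProd t (a + 1) m

/-- The class of `m` modulo `2`. -/
def parity : ℕ → Fin 2
  | 0 => 0
  | m + 1 => parity m + 1

section Monoid

variable {R S : Type*} [Monoid R] [Monoid S] (t : Fin 2 → R)

@[simp] lemma altProd_zero (a : Fin 2) : altProd t a 0 = 1 := rfl

lemma altProd_succ (a : Fin 2) (m : ℕ) : altProd t a (m + 1) = t a * altProd t (a + 1) m := rfl

@[simp] lemma altProd_one (a : Fin 2) : altProd t a 1 = t a := by simp [altProd_succ]

lemma add_one_add_one (a : Fin 2) : a + 1 + 1 = a := by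
  rw [add_assoc]; simp

/-- Peels off the last letter instead of the first; `parity` records which letter stands there. -/
lemma altProd_succ' (a : Fin 2) (m : ℕ) :
    altProd t a (m + 1) = altProd t a m * t (a + parity m) := by
  induction m generalizing a with
  | zero => simp [parity]
  | succ m ih =>
    rw [altProd_succ, ih, altProd_succ, mul_assoc, parity]
    congr 3
    rw [add_assoc, add_comm 1]

lemma map_altProd {F : Type*} [FunLike F R S] [MonoidHomClass F R S] (f : F) (a : Fin 2) (m : ℕ) :
    f (altProd t a m) = altProd (fun i => f (t i)) a m := by
  induction m generalizing a with
  | zero => simp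
  | succ m ih => simp [altProd_succ, ih]

/-- Reversing an alternating product. -/
lemma altProd_op (a : Fin 2) (m : ℕ) :
    altProd (fun i => MulOpposite.op (t i)) a m = MulOpposite.op (altProd t (a + parity m + 1) m) := by
  induction m generalizing a with
  | zero => simp
  | succ m ih =>
    rw [altProd_succ, ih, altProd_succ', ← MulOpposite.op_mul]
    have h : ∀ a c : Fin 2, a + 1 + c + 1 = a + (c + 1) + 1 ∧ a = a + (c + 1) + 1 + c := by decide
    rw [parity, ← (h a (parity m)).2, (h a (parity m)).1]

end Monoid

section Ring

variable {R S : Type*} [Ring R] [Ring S] (t : Fin 2 → R)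

/-- The sum of the alternating products of length less than `m` starting with `t b`. -/
def altSum (b : Fin 2) (m : ℕ) : R := ∑ k ∈ Finset.range m, altProd t b k

/-- The Kazhdan–Lusztig element `∑_{y ≤ w} T_y`, where `w` is the alternating word of length `m`
starting with `a`. -/
def altKL (a : Fin 2) (m : ℕ) : R := (t a + 1) * altSum t (a + 1) m

@[simp] lemma altSum_zero (b : Fin 2) : altSum t b 0 = 0 := by simp [altSum]

@[simp] lemma altSum_one (b : Fin 2) : altSum t b 1 = 1 := by simp [altSum]

lemma altSum_succ (b : Fin 2) (m : ℕ) : altSum t b (m + 1) = altSum t b m + altProd t b m := by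
  simp [altSum, Finset.sum_range_succ]

lemma altSum_succ' (b : Fin 2) (m : ℕ) : altSum t b (m + 1) = t b * altSum t (b + 1) m + 1 := by
  simp [altSum, Finset.sum_range_succ', altProd_succ, Finset.mul_sum]

@[simp] lemma altKL_zero (a : Fin 2) : altKL t a 0 = 0 := by simp [altKL]

@[simp] lemma altKL_one (a : Fin 2) : altKL t a 1 = t a + 1 := by simp [altKL]

lemma altKL_eq (a : Fin 2) (m : ℕ) :
    altKL t a m = altSum t a (m + 1) - 1 + altSum t (a + 1) m := by
  rw [altKL, altSum_succ']; noncomm_ring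

lemma altKL_two (a : Fin 2) : altKL t a 2 = (t a + 1) * (t (a + 1) + 1) := by
  rw [altKL, altSum_succ', altSum_one, mul_one]

lemma map_altSum {F : Type*} [FunLike F R S] [RingHomClass F R S] (f : F) (a : Fin 2) (m : ℕ) :
    f (altSum t a m) = altSum (fun i => f (t i)) a m := by
  simp [altSum, map_altProd]

lemma map_altKL {F : Type*} [FunLike F R S] [RingHomClass F R S] (f : F) (a : Fin 2) (m : ℕ) :
    f (altKL t a m) = altKL (fun i => f (t i)) a m := by
  simp [altKL, map_altSum]

end Ring

section Algebra

variable {A R : Type*} [CommRing A] [Ring R] [Algebra A R] {q : A} {t : Fin 2 → R}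

/-- The quadratic relation `(t - q)(t + 1) = 0`. -/
def IsQuadratic (q : A) (t : R) : Prop := (t - algebraMap A R q) * (t + 1) = 0

lemma IsQuadratic.mul_add_one {t : R} (h : IsQuadratic q t) : t * (t + 1) = q • (t + 1) := by
  rw [IsQuadratic, sub_mul, sub_eq_zero] at h
  rw [h, Algebra.smul_def]

lemma IsQuadratic.add_one_mul {t : R} (h : IsQuadratic q t) : (t + 1) * t = q • (t + 1) := by
  rw [← h.mul_add_one]; noncomm_ring

lemma IsQuadratic.mul_self {t : R} (h : IsQuadratic q t) : t * t = (q - 1) • t + q • 1 := by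
  have := h.mul_add_one
  rw [mul_add, mul_one, smul_add] at this
  rw [eq_sub_of_add_eq this, sub_smul, one_smul]; abel

lemma isQuadratic_iff {t : R} : IsQuadratic q t ↔ t * t = (q - 1) • t + q • 1 := by
  refine ⟨fun h => h.mul_self, fun h => ?_⟩
  rw [IsQuadratic, sub_mul, mul_add, h, ← Algebra.smul_def]
  simp only [sub_smul, one_smul, mul_one, smul_add]; abel

lemma mul_altKL (h : ∀ i, IsQuadratic q (t i)) (a : Fin 2) (m : ℕ) :
    t a * altKL t a m = q • altKL t a m := by
  rw [altKL, ← mul_assoc, (h a).mul_add_one, smul_mul_assoc]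

/-- Group the words in the factor as those starting with `a + 1`, together with the empty one, and
those starting with `a`. On the first group `t a + 1` gives the next element by definition; on the
second, `(t a + 1) t a = q (t a + 1)` produces the lower term. Only the quadratic relations enter,
so the rule is available before any braid relation is known. -/
lemma add_one_mul_altKL (h : ∀ i, IsQuadratic q (t i)) (a : Fin 2) (m : ℕ) :
    (t a + 1) * altKL t (a + 1) (m + 1) = altKL t a (m + 2) + q • altKL t a m := by
  have e : altKL t (a + 1) (m + 1) = altSum t (a + 1) (m + 2) + t a * altSum t (a + 1) m := by
    rw [altKL_eq, add_one_add_one, altSum_succ' t a m]; abel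
  rw [e, mul_add, ← mul_assoc, (h a).add_one_mul, smul_mul_assoc]
  rfl

/-- The relations of the Hecke algebra of the dihedral group of order `2 n`. -/
structure IsHecke (n : ℕ) (q : A) (t : Fin 2 → R) : Prop where
  quadratic : ∀ i, IsQuadratic q (t i)
  braid : altProd t 0 n = altProd t 1 n

variable {n : ℕ}

lemma IsHecke.altProd_eq' (h : IsHecke n q t) (a b : Fin 2) : altProd t a n = altProd t b n := by
  have := h.braid
  fin_cases a <;> fin_cases b <;> simp_all

lemma altKL_eq_add (t : Fin 2 → R) (a : Fin 2) (n : ℕ) :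
    altKL t a n = altSum t 0 n + altSum t 1 n - 1 + altProd t a n := by
  rw [altKL_eq, altSum_succ]
  fin_cases a
  · simp; abel
  · simp; abel

lemma IsHecke.altKL_eq_altKL (h : IsHecke n q t) (a b : Fin 2) : altKL t a n = altKL t b n := by
  rw [altKL_eq_add, altKL_eq_add, h.altProd_eq' a b]

/-- The two sums share all terms of length less than `n` and differ only in the top word. The braid
relation thus becomes an identity between elements governed by the two-term recursion
`add_one_mul_altKL`. -/
lemma altKL_eq_iff (t : Fin 2 → R) (n : ℕ) :
    altKL t 0 n = altKL t 1 n ↔ altProd t 0 n = altProd t 1 n := by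
  rw [altKL_eq_add, altKL_eq_add, add_right_inj]

lemma IsHecke.mul_longest (h : IsHecke n q t) (a b : Fin 2) :
    t a * altKL t b n = q • altKL t b n := by
  rw [h.altKL_eq_altKL b a, mul_altKL h.quadratic]

lemma IsQuadratic.op {t : R} (h : IsQuadratic q t) : IsQuadratic q (MulOpposite.op t) := by
  rw [isQuadratic_iff] at h ⊢
  rw [← MulOpposite.op_mul, h]; simp

lemma IsHecke.op (h : IsHecke n q t) : IsHecke n q fun i => MulOpposite.op (t i) where
  quadratic i := (h.quadratic i).op
  braid := by rw [altProd_op, altProd_op, h.altProd_eq' (0 + parity n + 1) (1 + parity n + 1)]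

lemma altSum_op (t : Fin 2 → R) (m : ℕ) :
    altSum (fun i => MulOpposite.op (t i)) 0 m + altSum (fun i => MulOpposite.op (t i)) 1 m =
      MulOpposite.op (altSum t 0 m + altSum t 1 m) := by
  rw [altSum, altSum, altSum, altSum, ← Finset.sum_add_distrib, ← Finset.sum_add_distrib,
    Finset.op_sum]
  refine Finset.sum_congr rfl fun k _ => ?_
  rw [altProd_op, altProd_op, ← MulOpposite.op_add]
  have h : ∀ c : Fin 2, (0 + c + 1 = 0 ∧ 1 + c + 1 = 1) ∨ (0 + c + 1 = 1 ∧ 1 + c + 1 = 0) := by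
    decide
  rcases h (parity k) with ⟨h1, h2⟩ | ⟨h1, h2⟩ <;> rw [h1, h2]
  rw [add_comm]

lemma IsHecke.altKL_op (h : IsHecke n q t) (a b : Fin 2) :
    altKL (fun i => MulOpposite.op (t i)) a n = MulOpposite.op (altKL t b n) := by
  rw [altKL_eq_add, altKL_eq_add, altSum_op, altProd_op, h.altProd_eq' _ b]; simp

lemma IsHecke.longest_mul (h : IsHecke n q t) (a b : Fin 2) :
    altKL t b n * t a = q • altKL t b n := by
  have := h.op.mul_longest a b
  rw [h.altKL_op b b] at this
  simpa using congrArg MulOpposite.unop this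

lemma IsHecke.map {S : Type*} [Ring S] [Algebra A S] (h : IsHecke n q t) (f : R →ₐ[A] S) :
    IsHecke n q fun i => f (t i) where
  quadratic i := by
    rw [isQuadratic_iff, ← map_mul, (h.quadratic i).mul_self]; simp
  braid := by rw [← map_altProd, ← map_altProd, h.braid]

lemma IsHecke.of_injective {S : Type*} [Ring S] [Algebra A S] (f : R →ₐ[A] S)
    (hf : Function.Injective f) (h : IsHecke n q fun i => f (t i)) : IsHecke n q t where
  quadratic i := by
    have := (h.quadratic i).mul_self
    rw [isQuadratic_iff]
    apply hf
    simpa using this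
  braid := hf <| by rw [map_altProd, map_altProd, h.braid]

/-- The Hecke relations are stable under `T ↦ q - 1 - T`, i.e. `T ↦ - q T⁻¹`. -/
lemma IsHecke.dual (hq : IsUnit q) (h : IsHecke n q t) :
    IsHecke n q fun i => algebraMap A R (q - 1) - t i := by
  have key : ∀ i, t i * (algebraMap A R (q - 1) - t i) = - algebraMap A R q := fun i => by
    rw [mul_sub, (h.quadratic i).mul_self, ← Algebra.commutes, ← Algebra.smul_def,
      Algebra.algebraMap_eq_smul_one q]; abel
  -- Since `q` is a unit and `(q - 1 - t a) t a = -q`, every `t a` can be cancelled on the left.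
  have cancel : ∀ m a u, altProd t a m * u = 0 → u = 0 := by
    intro m
    induction m with
    | zero => simp
    | succ m ih =>
      intro a u hu
      rw [altProd_succ, mul_assoc] at hu
      apply ih (a + 1)
      have h3 : (algebraMap A R (q - 1) - t a) * t a = - algebraMap A R q := by
        rw [← key a, sub_mul, mul_sub, Algebra.commutes]
      have := congrArg ((algebraMap A R (q - 1) - t a) * ·) hu
      simp only [← mul_assoc, mul_zero, h3] at this
      rw [neg_mul, neg_mul, neg_eq_zero, mul_assoc, ← Algebra.smul_def] at this
      exact (hq.smul_eq_zero).1 this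
  -- A reversed word times the dual word telescopes from the middle to the scalar `(-q) ^ m`.
  have rev : ∀ m a, altProd t (a + parity m + 1) m *
      altProd (fun i => algebraMap A R (q - 1) - t i) a m = algebraMap A R ((-q) ^ m) := by
    intro m
    induction m with
    | zero => simp
    | succ m ih =>
      intro a
      have hh : ∀ a c : Fin 2, a + 1 + c + 1 = a + (c + 1) + 1 ∧ a = a + (c + 1) + 1 + c := by
        decide
      rw [altProd_succ', altProd_succ]
      rw [parity, ← (hh a (parity m)).2, mul_assoc, ← mul_assoc (t a), key, ← map_neg, Algebra.commutes,
        ← mul_assoc, ← (hh a (parity m)).1, ih, ← map_mul, pow_succ]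
  refine ⟨fun i => ?_, ?_⟩
  · rw [isQuadratic_iff, sub_mul, key, ← Algebra.smul_def, Algebra.algebraMap_eq_smul_one q]
    abel
  · have h0 := rev n 0
    have h1 := rev n 1
    rw [h.altProd_eq' _ 0] at h0 h1
    rw [← sub_eq_zero]
    -- Both dual words of length `n` become `(-q) ^ n` after left multiplication by the same
    -- product, the original braid relation making the two reversed words equal.
    apply cancel n 0
    rw [mul_sub, h0, h1, sub_self]

end Algebra

end AlternatingProducts

end HeckeFamilies

end

noncomputable section

namespace HeckeFamilies

/-! ### Normal forms, lengths and descents in the dihedral group -/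

section Dihedral

open CoxeterSystem

lemma fin_two_eq_or (a b : Fin 2) : b = a ∨ b = a + 1 := by
  revert a b; decide

lemma fin_two_add_one_ne (a : Fin 2) : a + 1 ≠ a := by
  revert a; decide

/-- `alternatingWord` prescribes the last letter and `altProd` the first one; the shift by `parity
k` converts between the two conventions. -/
lemma prod_map_alternatingWord {R : Type*} [Monoid R] (t : Fin 2 → R) (a : Fin 2) (k : ℕ) :
    ((alternatingWord a (a + 1) k).map t).prod = altProd t (a + parity k) k := by
  induction k with
  | zero => simp [alternatingWord]
  | succ k ih =>
    have h : (if Even k then a + 1 else a) = a + parity (k + 1) ∧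
        (if Even k then a else a + 1) = a + parity k := by
      clear ih
      induction k with
      | zero => simp [parity]
      | succ k ihk =>
        rw [parity, ← add_assoc, ← ihk.1]
        by_cases h : Even k <;> simp [Nat.even_add_one, h, add_one_add_one]
    rw [alternatingWord_succ', List.map_cons, List.prod_cons, ih, h.1, altProd_succ, parity,
      ← add_assoc, add_one_add_one]

lemma prod_braidWord_iff {R : Type*} [Monoid R] (t : Fin 2 → R) (n : ℕ) :
    ((alternatingWord 0 1 n).map t).prod = ((alternatingWord 1 0 n).map t).prod ↔
      altProd t 0 n = altProd t 1 n := by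
  have h0 := prod_map_alternatingWord t 0 n
  have h1 := prod_map_alternatingWord t 1 n
  rw [show (0 : Fin 2) + 1 = 1 from rfl] at h0
  rw [show (1 : Fin 2) + 1 = 0 from rfl] at h1
  rw [h0, h1]
  rcases fin_two_eq_or 0 (parity n) with h | h <;> rw [h]
  · simp
  · simp [eq_comm]

variable {m : ℕ} {W : Type*} [Group W] (cs : CoxeterSystem (CoxeterMatrix.I m) W)

lemma dihedralMatrix_of_ne {i j : Fin 2} (h : i ≠ j) : CoxeterMatrix.I m i j = m + 2 := by
  simp [CoxeterMatrix.I, h]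

lemma altProd_simple_braid : altProd cs.simple 0 (m + 2) = altProd cs.simple 1 (m + 2) := by
  have h := cs.wordProd_braidWord_eq 0 1
  rw [braidWord, braidWord, dihedralMatrix_of_ne (by decide), dihedralMatrix_of_ne (by decide)] at h
  exact (prod_braidWord_iff cs.simple (m + 2)).1 h

lemma altProd_simple_eq (a b : Fin 2) :
    altProd cs.simple a (m + 2) = altProd cs.simple b (m + 2) := by
  have := altProd_simple_braid cs
  fin_cases a <;> fin_cases b <;> simp_all

lemma simple_mul_altProd (a : Fin 2) (k : ℕ) :
    cs.simple a * altProd cs.simple a (k + 1) = altProd cs.simple (a + 1) k := by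
  rw [altProd_succ, cs.simple_mul_simple_cancel_left]

/-- The sign `1` or `-1` attached to a letter. -/
def letterSign (a : Fin 2) : ℤ := if a = 0 then 1 else -1

lemma letterSign_add_one (a : Fin 2) : letterSign (a + 1) = - letterSign a := by
  revert a; decide

/-- The action of the dihedral group on the `2 n`-cycle. -/
def cycleReflection (n : ℕ) (a : Fin 2) : Equiv.Perm (ZMod (2 * n)) :=
  Equiv.subLeft ((letterSign a : ℤ) : ZMod (2 * n))

lemma cycleReflection_isLiftable :
    (CoxeterMatrix.I m).IsLiftable (cycleReflection (m + 2)) := by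
  intro i j
  have h : ∀ (i j : Fin 2) (k : ℕ) (p : ZMod (2 * (m + 2))),
      ((cycleReflection (m + 2) i * cycleReflection (m + 2) j) ^ k) p =
        p + k * ((letterSign i - letterSign j : ℤ) : ZMod (2 * (m + 2))) := by
    intro i j k
    induction k with
    | zero => simp
    | succ k ih =>
      intro p
      rw [pow_succ', Equiv.Perm.mul_apply, ih]
      simp only [cycleReflection, Equiv.Perm.mul_apply, Equiv.subLeft_apply]
      push_cast
      ring
  ext1 p
  rw [h]
  rcases fin_two_eq_or i j with rfl | rfl
  · simp
  · rw [dihedralMatrix_of_ne (fin_two_add_one_ne i).symm, letterSign_add_one,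
      show ((m + 2 : ℕ) : ZMod (2 * (m + 2))) * ((letterSign i - -letterSign i : ℤ) : ZMod _) =
        ((2 * (m + 2) : ℕ) : ZMod (2 * (m + 2))) * ((letterSign i : ℤ) : ZMod (2 * (m + 2))) by
        push_cast; ring, ZMod.natCast_self]
    simp

/-- The position of an element of the dihedral group in its Cayley graph, a `2 n`-cycle. -/
def cyclePos (w : W) : ZMod (2 * (m + 2)) :=
  cs.lift ⟨cycleReflection (m + 2), cycleReflection_isLiftable⟩ w 0

lemma cyclePos_altProd (a : Fin 2) (k : ℕ) :
    cyclePos cs (altProd cs.simple a k) = ((letterSign a * k : ℤ) : ZMod (2 * (m + 2))) := by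
  induction k generalizing a with
  | zero => simp [cyclePos]
  | succ k ih =>
    have := ih (a + 1)
    rw [cyclePos] at this ⊢
    rw [altProd_succ, map_mul, Equiv.Perm.mul_apply, this, cs.lift_apply_simple]
    simp only [cycleReflection, Equiv.subLeft_apply]
    rw [letterSign_add_one]
    push_cast
    ring

/-- An alternating word of length `k` moves the base point of the `2n`-cycle to `k` or `-k`,
according to its first letter. For lengths up to `n` these positions coincide only at `0` and at the
antipode `n`. -/
lemma altProd_simple_inj {a b : Fin 2} {k l : ℕ} (hk : k ≤ m + 2) (hl : l ≤ m + 2)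
    (h : altProd cs.simple a k = altProd cs.simple b l) :
    k = l ∧ (a = b ∨ k = 0 ∨ k = m + 2) := by
  have h1 := congrArg (cyclePos cs) h
  rw [cyclePos_altProd, cyclePos_altProd, ZMod.intCast_eq_intCast_iff_dvd_sub] at h1
  obtain ⟨c, hc⟩ := h1
  push_cast at hc
  have hc1 : c ≤ 1 := by
    by_contra hcon
    have : (2 : ℤ) ≤ c := by omega
    revert hc
    rcases fin_two_eq_or 0 a with rfl | rfl <;> rcases fin_two_eq_or 0 b with rfl | rfl <;>
      simp [letterSign] <;> nlinarith
  have hc2 : -1 ≤ c := by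
    by_contra hcon
    have : c ≤ (-2 : ℤ) := by omega
    revert hc
    rcases fin_two_eq_or 0 a with rfl | rfl <;> rcases fin_two_eq_or 0 b with rfl | rfl <;>
      simp [letterSign] <;> nlinarith
  have h3 : c = -1 ∨ c = 0 ∨ c = 1 := by omega
  rcases fin_two_eq_or 0 a with rfl | rfl <;> rcases fin_two_eq_or 0 b with rfl | rfl <;>
      rcases h3 with rfl | rfl | rfl <;> simp [letterSign] at hc ⊢ <;> omega

/-- Prepending a letter lengthens an alternating word or cancels its first letter. The bound by the
length of `ω` is what later identifies the number of letters with the Coxeter length. -/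
lemma exists_altProd_of_word (ω : List (Fin 2)) :
    ∃ a k, k ≤ m + 2 ∧ k ≤ ω.length ∧ cs.wordProd ω = altProd cs.simple a k := by
  induction ω with
  | nil => exact ⟨0, 0, by simp⟩
  | cons i ω ih =>
    obtain ⟨a, k, hk, hkω, h⟩ := ih
    rw [cs.wordProd_cons, h, List.length_cons]
    rcases k with _ | k
    · exact ⟨i, 1, by omega, by omega, by simp⟩
    by_cases hn : k + 1 = m + 2
    -- The longest element can be rewritten to start with either letter, so prepending always
    -- shortens it.
    · refine ⟨i + 1, k, by omega, by omega, ?_⟩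
      rw [hn, altProd_simple_eq cs a i, ← hn, simple_mul_altProd]
    · rcases fin_two_eq_or i a with rfl | rfl
      · exact ⟨a + 1, k, by omega, by omega, simple_mul_altProd cs a k⟩
      · exact ⟨i, k + 2, by omega, by omega, rfl⟩

lemma length_altProd_le (a : Fin 2) (k : ℕ) : cs.length (altProd cs.simple a k) ≤ k := by
  induction k generalizing a with
  | zero => simp
  | succ k ih =>
    rw [altProd_succ]
    refine (cs.length_mul_le _ _).trans ?_
    rw [cs.length_simple]
    have := ih (a + 1)
    omega

@[simp] lemma length_altProd (a : Fin 2) {k : ℕ} (hk : k ≤ m + 2) :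
    cs.length (altProd cs.simple a k) = k := by
  refine le_antisymm (length_altProd_le cs a k) ?_
  obtain ⟨ω, hω, h⟩ := cs.exists_isReduced (altProd cs.simple a k)
  obtain ⟨b, l, hl, hlω, h'⟩ := exists_altProd_of_word cs ω
  rw [h, hω.eq]
  rw [h'] at h
  rw [(altProd_simple_inj cs hk hl h).1]
  exact hlω

lemma exists_altProd (w : W) : ∃ a k, k ≤ m + 2 ∧ w = altProd cs.simple a k := by
  obtain ⟨ω, rfl⟩ := cs.wordProd_surjective w
  obtain ⟨a, k, hk, -, h⟩ := exists_altProd_of_word cs ω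
  exact ⟨a, k, hk, h⟩

lemma exists_altProd_length (w : W) : ∃ a, w = altProd cs.simple a (cs.length w) := by
  obtain ⟨a, k, hk, rfl⟩ := exists_altProd cs w
  exact ⟨a, by rw [length_altProd cs a hk]⟩

include cs in
lemma finite_of_dihedral : Finite W := by
  refine Set.finite_univ_iff.1 (Set.Finite.subset
    (Set.finite_range fun p : Fin 2 × Fin (m + 3) => altProd cs.simple p.1 p.2) fun w _ => ?_)
  obtain ⟨a, k, hk, rfl⟩ := exists_altProd cs w
  exact ⟨(a, ⟨k, by omega⟩), rfl⟩

lemma isLeftDescent_altProd (a i : Fin 2) {k : ℕ} (hk : k ≤ m + 2) :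
    cs.IsLeftDescent (altProd cs.simple a k) i ↔ k = m + 2 ∨ (a = i ∧ k ≠ 0) := by
  rw [IsLeftDescent, length_altProd cs a hk]
  rcases k with _ | k
  · simp
  by_cases hn : k + 1 = m + 2
  · rw [hn, altProd_simple_eq cs a i, ← hn, simple_mul_altProd, length_altProd cs _ (by omega)]
    simp [hn]; omega
  · rcases fin_two_eq_or i a with rfl | rfl
    · rw [simple_mul_altProd, length_altProd cs _ (by omega)]
      simp
    · rw [← altProd_succ, length_altProd cs _ (by omega)]
      simp; omega

/-- Write `w` as a word starting with `i`; changing its right end leaves the first letter alone.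
There are two exceptions, `w = s_i` with `j = i`, and the longest element when appending `j` forces
the other expression; in both of them `s_i w = w s_j`. -/
lemma isLeftDescent_mul_simple {w : W} {i j : Fin 2} (h : cs.simple i * w ≠ w * cs.simple j)
    (hd : cs.IsLeftDescent w i) : cs.IsLeftDescent (w * cs.simple j) i := by
  obtain ⟨a, k, hk, rfl⟩ := exists_altProd cs w
  rw [isLeftDescent_altProd cs a i hk] at hd
  obtain ⟨k, rfl⟩ : ∃ l, k = l + 1 := Nat.exists_eq_succ_of_ne_zero (by omega)
  have hw : altProd cs.simple a (k + 1) = altProd cs.simple i (k + 1) := by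
    rcases hd with hd | hd
    · rw [hd, altProd_simple_eq cs a i]
    · rw [hd.1]
  rw [hw] at h ⊢
  rw [simple_mul_altProd] at h
  rcases fin_two_eq_or j (i + parity k) with hj | hj
  · rw [altProd_succ', hj, cs.simple_mul_simple_cancel_right] at h ⊢
    rw [isLeftDescent_altProd cs i i (by omega)]
    refine Or.inr ⟨rfl, ?_⟩
    rintro rfl
    simp at h
  · have hj' : j = i + parity (k + 1) := by
      rw [parity, ← add_assoc, hj, add_one_add_one]
    rw [hj', ← altProd_succ'] at h ⊢
    by_cases hn : k + 1 = m + 2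
    · exfalso
      apply h
      rw [altProd_succ' _ i (k + 1), ← hj', hn, altProd_simple_eq cs i (i + 1), ← hn, altProd_succ',
        show i + 1 + parity k = j by rw [hj', parity, add_assoc, add_comm 1],
        cs.simple_mul_simple_cancel_right]
    · rw [isLeftDescent_altProd cs i i (by omega)]
      exact Or.inr ⟨rfl, by omega⟩

lemma isLeftDescent_mul_simple_iff {w : W} {i j : Fin 2}
    (h : cs.simple i * w ≠ w * cs.simple j) :
    cs.IsLeftDescent (w * cs.simple j) i ↔ cs.IsLeftDescent w i := by
  refine ⟨fun hd => ?_, isLeftDescent_mul_simple cs h⟩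
  have := isLeftDescent_mul_simple cs (w := w * cs.simple j) (i := i) (j := j) (fun h' => h ?_) hd
  · rwa [cs.simple_mul_simple_cancel_right] at this
  · rw [cs.simple_mul_simple_cancel_right] at h'
    rw [← mul_assoc] at h'
    conv_rhs => rw [← h']
    simp [mul_assoc]

lemma isRightDescent_simple_mul_iff {w : W} {i j : Fin 2}
    (h : cs.simple i * w ≠ w * cs.simple j) :
    cs.IsRightDescent (cs.simple i * w) j ↔ cs.IsRightDescent w j := by
  rw [← cs.isLeftDescent_inv_iff, ← cs.isLeftDescent_inv_iff, mul_inv_rev, cs.inv_simple]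
  apply isLeftDescent_mul_simple_iff cs
  intro h'
  apply h
  have := congrArg (·⁻¹) h'
  simp only [mul_inv_rev, cs.inv_simple, inv_inv] at this
  exact this.symm

/-- In a dihedral group, any braid-compatible family of elements of a monoid has the same product
along all reduced words of a given element. -/
lemma prod_map_of_isReduced {R : Type*} [Monoid R] {t : Fin 2 → R}
    (ht : altProd t 0 (m + 2) = altProd t 1 (m + 2)) {ω : List (Fin 2)} (hω : cs.IsReduced ω)
    {a : Fin 2} {k : ℕ} (hk : k ≤ m + 2) (h : cs.wordProd ω = altProd cs.simple a k) :
    (ω.map t).prod = altProd t a k := by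
  have ht' : ∀ a b, altProd t a (m + 2) = altProd t b (m + 2) := by
    intro a b; fin_cases a <;> fin_cases b <;> simp_all
  induction ω generalizing a k with
  | nil =>
    rw [wordProd_nil, ← altProd_zero cs.simple a] at h
    rw [← (altProd_simple_inj cs (by omega) hk h).1]; simp
  | cons i ω ih =>
    have hω' : cs.IsReduced ω := by simpa using hω.drop 1
    obtain ⟨b, l, hl, hb⟩ := exists_altProd cs (cs.wordProd ω)
    have hlen : l = ω.length := by rw [← hω'.eq, hb, length_altProd cs b hl]
    have hlen2 : cs.length (cs.simple i * altProd cs.simple b l) = l + 1 := by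
      rw [← hb, ← cs.wordProd_cons, hω.eq, hlen, List.length_cons]
    have hnd : ¬ cs.IsLeftDescent (altProd cs.simple b l) i := by
      rw [IsLeftDescent, hlen2, length_altProd cs b hl]; omega
    rw [isLeftDescent_altProd cs b i hl] at hnd
    have hb' : cs.wordProd ω = altProd cs.simple (i + 1) l := by
      rcases fin_two_eq_or i b with rfl | rfl
      · have : l = 0 := by tauto
        rw [hb, this]; simp
      · exact hb
    have h2 : altProd cs.simple a k = altProd cs.simple i (l + 1) := by
      rw [← h, cs.wordProd_cons, hb', altProd_succ]
    have h3 := altProd_simple_inj cs hk (by omega) h2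
    rw [List.map_cons, List.prod_cons, ih hω' hl hb', ← altProd_succ, h3.1]
    rcases h3.2 with h4 | h4 | h4
    · rw [h4]
    · omega
    · rw [← h3.1, h4, ht']

lemma altProd_simple_inv (a : Fin 2) (k : ℕ) :
    (altProd cs.simple a k)⁻¹ = altProd cs.simple (a + parity k + 1) k := by
  have h := altProd_op cs.simple a k
  have h2 : altProd (fun i => MulOpposite.op (cs.simple i)) a k =
      MulEquiv.inv' W (altProd cs.simple a k) := by
    rw [map_altProd]; simp
  rw [h2] at h
  exact MulOpposite.op_injective h

lemma sum_length_eq [Fintype W] {M : Type*} [AddCommMonoid M] (f : W → M) {k : ℕ} (h0 : 0 < k)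
    (hk : k < m + 2) :
    ∑ y with cs.length y = k, f y =
      f (altProd cs.simple 0 k) + f (altProd cs.simple 1 k) := by
  classical
  have : Finset.univ.filter (fun y => cs.length y = k) =
      {altProd cs.simple 0 k, altProd cs.simple 1 k} := by
    ext y
    simp only [Finset.mem_filter, Finset.mem_univ, true_and, Finset.mem_insert,
      Finset.mem_singleton]
    constructor
    · rintro rfl
      obtain ⟨a, ha⟩ := exists_altProd_length cs y
      rcases fin_two_eq_or 0 a with rfl | rfl
      · exact Or.inl ha
      · exact Or.inr ha
    · rintro (rfl | rfl) <;> exact length_altProd cs _ hk.le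
  rw [this, Finset.sum_pair]
  intro h
  have := (altProd_simple_inj cs hk.le hk.le h).2
  simp at this
  omega

/-- Since everything shorter is below in the Bruhat order, the sum over a lower interval splits
according to the first letter. The right side has the shape of the two sums hidden in `altKL`. -/
lemma sum_length_lt [Fintype W] {M : Type*} [AddCommMonoid M] (f : W → M) (a : Fin 2) {k : ℕ}
    (hk : k < m + 2) :
    ∑ y with cs.length y < k + 1, f y + f (altProd cs.simple a (k + 1)) =
      ∑ j ∈ Finset.range (k + 1), f (altProd cs.simple (a + 1) j) +
      ∑ j ∈ Finset.range (k + 1), f (altProd cs.simple a (j + 1)) := by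
  classical
  induction k with
  | zero =>
    have : Finset.univ.filter (fun y => cs.length y < 1) = {1} := by
      ext y; simp [cs.length_eq_zero_iff]
    rw [zero_add, this]; simp
  | succ k ih =>
    have hsplit : Finset.univ.filter (fun y => cs.length y < k + 1 + 1) =
        Finset.univ.filter (fun y => cs.length y < k + 1) ∪
          Finset.univ.filter (fun y => cs.length y = k + 1) := by
      ext y; simp; omega
    rw [hsplit, Finset.sum_union, sum_length_eq cs f (by omega) hk, Finset.sum_range_succ,
      Finset.sum_range_succ (fun j => f (altProd cs.simple a (j + 1)))]
    · have h1 := ih (by omega)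
      have h2 : f (altProd cs.simple 0 (k + 1)) + f (altProd cs.simple 1 (k + 1)) =
          f (altProd cs.simple a (k + 1)) + f (altProd cs.simple (a + 1) (k + 1)) := by
        rcases fin_two_eq_or 0 a with rfl | rfl
        · rfl
        · exact add_comm _ _
      rw [h2, ← add_assoc, h1]
      ac_rfl
    · rw [Finset.disjoint_filter]
      intro y _ h1 h2
      omega

end Dihedral

end HeckeFamilies

end

noncomputable section

namespace HeckeFamilies

/-! ### Universal property of the Hecke algebra -/

section HeckeAlgebraLemmas

variable {m : ℕ}

lemma heckeRel_eq {B : Type*} {M : CoxeterMatrix B} {a b : FreeAlgebra A B} (h : HeckeRel M a b) :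
    heckeMk M a = heckeMk M b := RingQuot.mkAlgHom_rel A h

lemma heckeMk_surjective {B : Type*} (M : CoxeterMatrix B) : Function.Surjective (heckeMk M) :=
  RingQuot.mkAlgHom_surjective A (HeckeRel M)

lemma map_prod_freeAlgebra {B R : Type*} [Ring R] [Algebra A R] (f : FreeAlgebra A B →ₐ[A] R)
    (ω : List B) : f ((ω.map (FreeAlgebra.ι A)).prod) =
      (ω.map fun i => f (FreeAlgebra.ι A i)).prod := by
  rw [map_list_prod, List.map_map]; rfl

lemma isHecke_heckeGen : IsHecke (m + 2) x (heckeGen (CoxeterMatrix.I m)) where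
  quadratic i := by
    have h := heckeRel_eq (HeckeRel.quadratic (M := CoxeterMatrix.I m) i)
    simpa [IsQuadratic, heckeGen] using h
  braid := by
    have h := heckeRel_eq (HeckeRel.braid (M := CoxeterMatrix.I m) 0 1)
    rw [CoxeterSystem.braidWord, CoxeterSystem.braidWord, dihedralMatrix_of_ne (by decide),
      dihedralMatrix_of_ne (by decide), map_prod_freeAlgebra, map_prod_freeAlgebra] at h
    exact (prod_braidWord_iff _ _).1 h

variable {R : Type*} [Ring R] [Algebra A R] {t : Fin 2 → R}

lemma IsHecke.map_rel (h : IsHecke (m + 2) x t) ⦃a b : FreeAlgebra A (Fin 2)⦄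
    (hab : HeckeRel (CoxeterMatrix.I m) a b) :
    FreeAlgebra.lift A t a = FreeAlgebra.lift A t b := by
  induction hab with
  | quadratic i => simpa [IsQuadratic] using h.quadratic i
  | braid i j =>
    rw [map_prod_freeAlgebra, map_prod_freeAlgebra]
    simp only [FreeAlgebra.lift_ι_apply]
    rcases eq_or_ne i j with rfl | hij
    · rfl
    · rw [CoxeterSystem.braidWord, CoxeterSystem.braidWord, dihedralMatrix_of_ne hij,
        dihedralMatrix_of_ne hij.symm]
      have := (prod_braidWord_iff t (m + 2)).2 h.braid
      rcases fin_two_eq_or 0 i with rfl | rfl <;> rcases fin_two_eq_or 0 j with rfl | rfl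
      · rfl
      · exact this
      · exact this.symm
      · rfl

/-- The homomorphism from the Hecke algebra attached to a solution of the Hecke relations. -/
def heckeLift (h : IsHecke (m + 2) x t) : HeckeAlgebra (CoxeterMatrix.I m) →ₐ[A] R :=
  RingQuot.liftAlgHom A ⟨FreeAlgebra.lift A t, h.map_rel⟩

@[simp] lemma heckeLift_gen (h : IsHecke (m + 2) x t) (i : Fin 2) :
    heckeLift h (heckeGen (CoxeterMatrix.I m) i) = t i := by
  have := RingQuot.liftAlgHom_mkAlgHom_apply A (FreeAlgebra.lift A t) h.map_rel
    (FreeAlgebra.ι A i)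
  rw [FreeAlgebra.lift_ι_apply] at this
  exact this

lemma heckeAlgHom_ext {B : Type*} {M : CoxeterMatrix B} {f g : HeckeAlgebra M →ₐ[A] R}
    (h : ∀ i, f (heckeGen M i) = g (heckeGen M i)) : f = g := by
  have : f.comp (heckeMk M) = g.comp (heckeMk M) := FreeAlgebra.hom_ext (funext h)
  ext r
  obtain ⟨a, rfl⟩ := heckeMk_surjective M r
  exact DFunLike.congr_fun this a

lemma adjoin_heckeGen {B : Type*} (M : CoxeterMatrix B) :
    Algebra.adjoin A (Set.range (heckeGen M)) = ⊤ := by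
  rw [eq_top_iff, ← (AlgHom.range_eq_top _).2 (heckeMk_surjective M), ← Algebra.map_top,
    ← FreeAlgebra.adjoin_range_ι, AlgHom.map_adjoin, ← Set.range_comp]
  rfl

/-- A subspace containing `1` and stable under left multiplication by the generators is
everything. -/
lemma submodule_eq_top_of_gen_mul {B : Type*} {M : CoxeterMatrix B}
    (U : Submodule A (HeckeAlgebra M)) (h1 : 1 ∈ U)
    (h : ∀ i, ∀ u ∈ U, heckeGen M i * u ∈ U) : U = ⊤ := by
  have key : ∀ r ∈ Algebra.adjoin A (Set.range (heckeGen M)), ∀ u ∈ U, r * u ∈ U := by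
    intro r hr
    induction hr using Algebra.adjoin_induction with
    | mem r hr => obtain ⟨i, rfl⟩ := hr; exact h i
    | algebraMap c => intro u hu; rw [← Algebra.smul_def]; exact U.smul_mem c hu
    | add a b _ _ ha hb => intro u hu; rw [add_mul]; exact U.add_mem (ha u hu) (hb u hu)
    | mul a b _ _ ha hb => intro u hu; rw [mul_assoc]; exact ha _ (hb u hu)
  rw [eq_top_iff]
  intro r _
  have := key r (by rw [adjoin_heckeGen]; trivial) 1 h1
  rwa [mul_one] at this

lemma isUnit_x : IsUnit x := LaurentPolynomial.isUnit_T 1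

end HeckeAlgebraLemmas

/-! ### The regular representation on the free module with basis `W` -/

section RegularRepresentation

lemma linearMap_ext_single {W A M : Type*} [CommRing A] [AddCommMonoid M] [Module A M] {f g : (W →₀ A) →ₗ[A] M}
    (h : ∀ w, f (Finsupp.single w 1) = g (Finsupp.single w 1)) : f = g := by
  ext w; simpa using h w

variable {m : ℕ} {W : Type*} [Group W] (cs : CoxeterSystem (CoxeterMatrix.I m) W)
  {A : Type*} [CommRing A] (q : A)

open Classical in
/-- Left multiplication by `T_i` on the free module with basis `W`. -/
def leftOp (i : Fin 2) : Module.End A (W →₀ A) :=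
  Finsupp.linearCombination A fun w =>
    if cs.IsLeftDescent w i then
      (q - 1) • Finsupp.single w 1 + q • Finsupp.single (cs.simple i * w) 1
    else Finsupp.single (cs.simple i * w) 1

open Classical in
/-- Right multiplication by `T_i` on the free module with basis `W`. -/
def rightOp (i : Fin 2) : Module.End A (W →₀ A) :=
  Finsupp.linearCombination A fun w =>
    if cs.IsRightDescent w i then
      (q - 1) • Finsupp.single w 1 + q • Finsupp.single (w * cs.simple i) 1
    else Finsupp.single (w * cs.simple i) 1

open Classical in
lemma leftOp_single (i : Fin 2) (w : W) : leftOp cs q i (Finsupp.single w 1) =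
    if cs.IsLeftDescent w i then
      (q - 1) • Finsupp.single w 1 + q • Finsupp.single (cs.simple i * w) 1
    else Finsupp.single (cs.simple i * w) 1 := by
  simp [leftOp]

open Classical in
lemma rightOp_single (i : Fin 2) (w : W) : rightOp cs q i (Finsupp.single w 1) =
    if cs.IsRightDescent w i then
      (q - 1) • Finsupp.single w 1 + q • Finsupp.single (w * cs.simple i) 1
    else Finsupp.single (w * cs.simple i) 1 := by
  simp [rightOp]

lemma leftOp_quadratic (i : Fin 2) : IsQuadratic q (leftOp cs q i) := by
  rw [isQuadratic_iff]
  refine linearMap_ext_single fun w => ?_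
  simp only [Module.End.mul_apply, LinearMap.add_apply, LinearMap.smul_apply, Module.End.one_apply]
  by_cases h : cs.IsLeftDescent w i
  · have h' := cs.isLeftDescent_iff_not_isLeftDescent_mul.1 h
    simp only [leftOp_single, if_pos h, map_add, map_smul, if_neg h',
      cs.simple_mul_simple_cancel_left]
  · have h' : cs.IsLeftDescent (cs.simple i * w) i := by
      by_contra hcon
      exact h (cs.isLeftDescent_iff_not_isLeftDescent_mul.2 hcon)
    simp only [leftOp_single, if_neg h, if_pos h', cs.simple_mul_simple_cancel_left]

/-- If `s_i w = w s_j`, the left and right operators coincide on the span of `w` and `s_i w`, hence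
commute there. Otherwise neither multiplication affects the descent seen by the other, and both
composites have the same expansion. -/
lemma leftOp_comm_rightOp (i j : Fin 2) :
    leftOp cs q i * rightOp cs q j = rightOp cs q j * leftOp cs q i := by
  refine linearMap_ext_single fun w => ?_
  simp only [Module.End.mul_apply]
  by_cases hw : cs.simple i * w = w * cs.simple j
  · have hdesc : ∀ v, cs.simple i * v = v * cs.simple j →
        leftOp cs q i (Finsupp.single v 1) = rightOp cs q j (Finsupp.single v 1) := by
      intro v hv
      have : cs.IsLeftDescent v i ↔ cs.IsRightDescent v j := by
        rw [CoxeterSystem.IsLeftDescent, hv, CoxeterSystem.IsRightDescent]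
      rw [leftOp_single, rightOp_single]
      by_cases hd : cs.IsRightDescent v j <;> simp only [this, hd, hv, if_true, if_false]
    have hw' : cs.simple i * (cs.simple i * w) = cs.simple i * w * cs.simple j := by
      rw [mul_assoc, ← hw]
    rw [hdesc w hw]
    have hspan : ∀ v, v = w ∨ v = cs.simple i * w →
        leftOp cs q i (Finsupp.single v 1) = rightOp cs q j (Finsupp.single v 1) := by
      rintro v (rfl | rfl)
      · exact hdesc _ hw
      · exact hdesc _ hw'
    rw [rightOp_single]
    split_ifs
    · simp only [map_add, map_smul, ← hw, hspan w (Or.inl rfl), hspan _ (Or.inr rfl)]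
    · rw [← hw, hspan _ (Or.inr rfl)]
  · have h1 := isLeftDescent_mul_simple_iff cs hw
    have h2 := isRightDescent_simple_mul_iff cs hw
    rw [leftOp_single, rightOp_single]
    by_cases hl : cs.IsLeftDescent w i <;> by_cases hr : cs.IsRightDescent w j <;>
      simp only [hl, hr, if_true, if_false, map_add, map_smul, leftOp_single, rightOp_single, h1,
        h2, mul_assoc, smul_add]
    simp only [smul_smul, mul_comm q]
    abel

lemma leftOp_altProd (a : Fin 2) {k : ℕ} (hk : k ≤ m + 2) :
    altProd (leftOp cs q) a k (Finsupp.single 1 1) =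
      Finsupp.single (altProd cs.simple a k) (1 : A) := by
  induction k generalizing a with
  | zero => simp
  | succ k ih =>
    rw [altProd_succ, Module.End.mul_apply, ih (a + 1) (by omega), leftOp_single, if_neg,
      altProd_succ]
    rw [isLeftDescent_altProd cs _ _ (by omega)]
    have := fin_two_add_one_ne a
    rintro (h | h)
    · omega
    · exact this h.1

lemma rightOp_altProd (a : Fin 2) {k : ℕ} (hk : k < m + 2) :
    rightOp cs q (a + parity k) (Finsupp.single (altProd cs.simple a k) 1) =
      Finsupp.single (altProd cs.simple a (k + 1)) (1 : A) := by
  rw [rightOp_single, if_neg, altProd_succ']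
  rw [CoxeterSystem.IsRightDescent, ← altProd_succ', length_altProd cs _ (by omega),
    length_altProd cs _ (by omega)]
  omega

/-- The two sides of the braid relation agree on the basis vector of `1`. They commute with the
right operators, and these produce every other basis vector from that one. -/
lemma leftOp_isHecke : IsHecke (m + 2) q (leftOp cs q) where
  quadratic := leftOp_quadratic cs q
  braid := by
    have hcomm : ∀ a j k, altProd (leftOp cs q) a k * rightOp cs q j =
        rightOp cs q j * altProd (leftOp cs q) a k := by
      intro a j k
      induction k generalizing a with
      | zero => simp
      | succ k ih =>
        rw [altProd_succ, mul_assoc, ih, ← mul_assoc, leftOp_comm_rightOp, mul_assoc]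
    refine linearMap_ext_single fun w => ?_
    obtain ⟨a, k, hk, rfl⟩ := exists_altProd cs w
    induction k with
    | zero =>
      rw [altProd_zero, leftOp_altProd cs q _ le_rfl, leftOp_altProd cs q _ le_rfl,
        altProd_simple_braid]
    | succ k ih =>
      rw [← rightOp_altProd cs q a (by omega), ← Module.End.mul_apply, ← Module.End.mul_apply,
        hcomm, hcomm, Module.End.mul_apply, Module.End.mul_apply, ih (by omega)]

end RegularRepresentation

/-! ### The standard basis -/

section Basis

variable {m : ℕ} {W : Type*} [Group W] (cs : CoxeterSystem (CoxeterMatrix.I m) W)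

lemma heckeT_altProd (a : Fin 2) {k : ℕ} (hk : k ≤ m + 2) :
    heckeT cs (altProd cs.simple a k) = altProd (heckeGen (CoxeterMatrix.I m)) a k := by
  have h := (cs.exists_isReduced (altProd cs.simple a k)).choose_spec
  exact prod_map_of_isReduced cs isHecke_heckeGen.braid h.1 hk h.2.symm

lemma heckeLift_leftOp_heckeT (w : W) :
    heckeLift (leftOp_isHecke cs x) (heckeT cs w) (Finsupp.single 1 1) = Finsupp.single w 1 := by
  obtain ⟨a, k, hk, rfl⟩ := exists_altProd cs w
  rw [heckeT_altProd cs a hk, map_altProd]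
  simp only [heckeLift_gen]
  exact leftOp_altProd cs x a hk

/-- Acting on the basis vector of `1` in the regular representation sends `T_w` to the basis vector
of `w`. -/
lemma heckeT_linearIndependent : LinearIndependent A (heckeT cs) := by
  let f : HeckeAlgebra (CoxeterMatrix.I m) →ₗ[A] (W →₀ A) :=
    (LinearMap.applyₗ (Finsupp.single 1 1)) ∘ₗ (heckeLift (leftOp_isHecke cs x)).toLinearMap
  refine LinearIndependent.of_comp f ?_
  have : f ∘ heckeT cs = fun w => Finsupp.single w (1 : A) :=
    funext fun w => heckeLift_leftOp_heckeT cs w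
  rw [this]
  exact Finsupp.linearIndependent_single_one A W

lemma span_heckeT : Submodule.span A (Set.range (heckeT cs)) = ⊤ := by
  have hmem : ∀ a k, k ≤ m + 2 → altProd (heckeGen (CoxeterMatrix.I m)) a k ∈
      Submodule.span A (Set.range (heckeT cs)) := fun a k hk =>
    Submodule.subset_span ⟨_, heckeT_altProd cs a hk⟩
  apply submodule_eq_top_of_gen_mul
  · exact hmem 0 0 (by omega)
  · intro i u hu
    induction hu using Submodule.span_induction with
    | zero => simp
    | add a b _ _ ha hb => rw [mul_add]; exact Submodule.add_mem _ ha hb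
    | smul c a _ ha => rw [mul_smul_comm]; exact Submodule.smul_mem _ _ ha
    | mem u hu =>
      obtain ⟨w, rfl⟩ := hu
      obtain ⟨a, k, hk, rfl⟩ := exists_altProd cs w
      rw [heckeT_altProd cs a hk]
      have hsame : ∀ l, l + 1 ≤ m + 2 → heckeGen (CoxeterMatrix.I m) i *
          altProd (heckeGen (CoxeterMatrix.I m)) i (l + 1) ∈
            Submodule.span A (Set.range (heckeT cs)) := by
        intro l hl
        rw [altProd_succ, ← mul_assoc, (isHecke_heckeGen.quadratic i).mul_self, add_mul,
          smul_mul_assoc, smul_mul_assoc, one_mul, ← altProd_succ]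
        exact Submodule.add_mem _ (Submodule.smul_mem _ _ (hmem _ _ hl))
          (Submodule.smul_mem _ _ (hmem _ _ (by omega)))
      rcases k with _ | k
      · simpa using hmem i 1 (by omega)
      by_cases hn : k + 1 = m + 2
      · rw [hn, isHecke_heckeGen.altProd_eq' a i, ← hn]
        exact hsame k hk
      · rcases fin_two_eq_or i a with rfl | rfl
        · exact hsame k hk
        · rw [← altProd_succ]
          exact hmem _ _ (by omega)

/-- The standard basis of the Hecke algebra. -/
def heckeBasis : Module.Basis W A (HeckeAlgebra (CoxeterMatrix.I m)) :=
  Module.Basis.mk (heckeT_linearIndependent cs) (span_heckeT cs).ge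

@[simp] lemma heckeBasis_apply (w : W) : heckeBasis cs w = heckeT cs w := by
  simp [heckeBasis]

end Basis

end HeckeFamilies

end

noncomputable section

namespace HeckeFamilies

/-! ### Inverse generators and the bar involution -/

section InverseGenerators

variable {A R : Type*} [CommRing A] [Ring R] [Algebra A R] {q q' : A} {t : Fin 2 → R}

/-- The inverses `T_i⁻¹ = q⁻¹ T_i - (1 - q⁻¹)`, where `q'` stands for `q⁻¹`. -/
def invGen (q' : A) (t : Fin 2 → R) (i : Fin 2) : R := q' • t i - (1 - q') • (1 : R)

lemma mul_invGen (hq : q * q' = 1) (h : ∀ i, IsQuadratic q (t i)) (i : Fin 2) :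
    t i * invGen q' t i = 1 := by
  rw [invGen, mul_sub, mul_smul_comm, (h i).mul_self, mul_smul_comm, mul_one, smul_add, smul_smul,
    smul_smul, mul_comm q' q, hq, one_smul, mul_sub, mul_comm q' q, hq, mul_one]
  abel

lemma invGen_mul (hq : q * q' = 1) (h : ∀ i, IsQuadratic q (t i)) (i : Fin 2) :
    invGen q' t i * t i = 1 := by
  rw [← mul_invGen hq h i, invGen, mul_sub, sub_mul]
  simp

lemma invGen_add_one (q' : A) (t : Fin 2 → R) (i : Fin 2) :
    invGen q' t i + 1 = q' • (t i + 1) := by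
  rw [invGen, sub_smul, one_smul, smul_add]; abel

lemma invGen_quadratic (hq : q * q' = 1) (h : ∀ i, IsQuadratic q (t i)) (i : Fin 2) :
    IsQuadratic q' (invGen q' t i) := by
  rw [IsQuadratic, invGen_add_one, invGen, Algebra.algebraMap_eq_smul_one]
  have h1 : q' • t i - (1 - q') • (1 : R) - q' • (1 : R) = q' • (t i - algebraMap A R q) := by
    rw [smul_sub, Algebra.algebraMap_eq_smul_one, smul_smul, mul_comm, hq, sub_smul]; abel
  rw [h1, smul_mul_smul_comm, h i, smul_zero]

lemma altProd_mul_invGen (hq : q * q' = 1) (h : ∀ i, IsQuadratic q (t i)) (a : Fin 2) (k : ℕ) :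
    altProd t (a + parity k + 1) k * altProd (invGen q' t) a k = 1 ∧
      altProd (invGen q' t) a k * altProd t (a + parity k + 1) k = 1 := by
  induction k generalizing a with
  | zero => simp
  | succ k ih =>
    have hh : ∀ a c : Fin 2, a + 1 + c + 1 = a + (c + 1) + 1 ∧ a = a + (c + 1) + 1 + c := by
      decide
    have ih' := ih (a + 1)
    rw [(hh a (parity k)).1] at ih'
    rw [altProd_succ', altProd_succ, parity, ← (hh a (parity k)).2]
    constructor
    · rw [mul_assoc, ← mul_assoc (t a), mul_invGen hq h, one_mul, ih'.1]
    · rw [mul_assoc, ← mul_assoc _ _ (t a), ih'.2, one_mul, invGen_mul hq h]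

/-- The inverse generators satisfy the quadratic relation for `q'`, hence the same recursion, and
`T_i⁻¹ + 1 = q' (T_i + 1)`. The factor `q' ^ k` therefore propagates along `add_one_mul_altKL`. -/
lemma altKL_invGen (hq : q * q' = 1) (h : ∀ i, IsQuadratic q (t i)) (a : Fin 2) (k : ℕ) :
    altKL (invGen q' t) a k = q' ^ k • altKL t a k := by
  -- The recursion has two steps, so two consecutive lengths are carried through the induction.
  have main : ∀ k, (∀ a, altKL (invGen q' t) a k = q' ^ k • altKL t a k) ∧
      ∀ a, altKL (invGen q' t) a (k + 1) = q' ^ (k + 1) • altKL t a (k + 1) := by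
    intro k
    induction k with
    | zero => simp [invGen_add_one]
    | succ k ih =>
      refine ⟨ih.2, fun a => ?_⟩
      have h1 := add_one_mul_altKL (invGen_quadratic hq h) a k
      have h2 := add_one_mul_altKL h a k
      rw [ih.1, ih.2, invGen_add_one, smul_mul_smul_comm, h2] at h1
      have h3 : q' * q' ^ (k + 1) * q = q' * q' ^ k := by
        linear_combination q' * q' ^ k * hq
      rw [smul_add, smul_smul, smul_smul, h3, add_left_inj] at h1
      rw [← h1, pow_succ' q' (k + 1)]
  exact (main k).1 a

end InverseGenerators

/-! ### Kazhdan–Lusztig polynomials of the dihedral group -/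

section KazhdanLusztig

variable {m : ℕ} {W : Type*} [Group W] (cs : CoxeterSystem (CoxeterMatrix.I m) W)

open Classical in
/-- The Kazhdan–Lusztig polynomials of a dihedral group. -/
def dihedralKL (w : W) : W →₀ ℤ[X] :=
  haveI := finite_of_dihedral cs
  Finsupp.equivFunOnFinite.symm fun y => if y = w ∨ cs.length y < cs.length w then 1 else 0

open Classical in
lemma dihedralKL_apply (w y : W) :
    dihedralKL cs w y = if y = w ∨ cs.length y < cs.length w then 1 else 0 := rfl

lemma dihedralKL_sum [Fintype W] {M : Type*} [AddCommMonoid M] (f : W → ℤ[X] → M)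
    (hf : ∀ y, f y 0 = 0) (w : W) :
    (dihedralKL cs w).sum f = ∑ y with cs.length y < cs.length w, f y 1 + f w 1 := by
  classical
  rw [Finsupp.sum_fintype _ _ hf, Finset.sum_filter,
    ← Finset.sum_erase_add _ _ (Finset.mem_univ w),
    ← Finset.sum_erase_add _ (fun a => if cs.length a < cs.length w then f a 1 else 0)
      (Finset.mem_univ w)]
  rw [if_neg (lt_irrefl _), add_zero]
  congr 1
  · refine Finset.sum_congr rfl fun y hy => ?_
    rw [dihedralKL_apply]
    have : y ≠ w := Finset.ne_of_mem_erase hy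
    by_cases h : cs.length y < cs.length w <;> simp [this, h, hf]
  · rw [dihedralKL_apply]; simp

lemma sum_dihedralKL_altProd {R : Type*} [Ring R] {t : Fin 2 → R} (f : W → ℤ[X] → R)
    (hf : ∀ y, f y 0 = 0)
    (h1 : ∀ a k, k ≤ m + 2 → f (altProd cs.simple a k) 1 = altProd t a k) (a : Fin 2) {k : ℕ}
    (hk : k < m + 2) : (dihedralKL cs (altProd cs.simple a (k + 1))).sum f =
      altKL t a (k + 1) := by
  have := finite_of_dihedral cs
  have := Fintype.ofFinite W
  rw [dihedralKL_sum cs f hf, length_altProd cs a (by omega),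
    sum_length_lt cs (fun y => f y 1) a hk, altKL, altSum, add_mul, one_mul, Finset.mul_sum,
    add_comm]
  congr 1
  · refine Finset.sum_congr rfl fun j hj => ?_
    rw [h1 _ _ (by have := Finset.mem_range.1 hj; omega), altProd_succ]
  · refine Finset.sum_congr rfl fun j hj => ?_
    rw [h1 _ _ (by have := Finset.mem_range.1 hj; omega)]

lemma sum_dihedralKL_one {R : Type*} [AddCommMonoid R] (f : W → ℤ[X] → R)
    (hf : ∀ y, f y 0 = 0) : (dihedralKL cs 1).sum f = f 1 1 := by
  have := finite_of_dihedral cs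
  have := Fintype.ofFinite W
  rw [dihedralKL_sum cs f hf]
  simp

lemma klElement_altProd (a : Fin 2) {k : ℕ} (hk : k < m + 2) :
    klElement cs (dihedralKL cs) (altProd cs.simple a (k + 1)) =
      altKL (heckeGen (CoxeterMatrix.I m)) a (k + 1) := by
  refine sum_dihedralKL_altProd cs _ (fun y => ?_) (fun b l hl => ?_) a hk
  · simp
  · simp [heckeT_altProd cs b hl]

@[simp] lemma heckeT_one : heckeT cs 1 = 1 := by
  simpa using heckeT_altProd cs 0 (Nat.zero_le _)

@[simp] lemma klElement_one : klElement cs (dihedralKL cs) 1 = 1 := by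
  rw [klElement, sum_dihedralKL_one cs]
  · simp
  · simp

/-- The inverse of `x` in `A`. -/
def xInv : A := LaurentPolynomial.T (-1)

lemma x_mul_xInv : x * xInv = 1 := by
  rw [x, xInv, ← LaurentPolynomial.T_add]; rfl

lemma xInv_pow (k : ℕ) : xInv ^ k = LaurentPolynomial.T (-(k : ℤ)) := by
  rw [xInv, LaurentPolynomial.T_pow]; simp

lemma inverse_heckeT_altProd (a : Fin 2) {k : ℕ} (hk : k ≤ m + 2) :
    Ring.inverse (heckeT cs (altProd cs.simple a k)⁻¹) =
      altProd (invGen xInv (heckeGen (CoxeterMatrix.I m))) a k := by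
  rw [altProd_simple_inv, heckeT_altProd cs _ hk]
  have h := altProd_mul_invGen x_mul_xInv (isHecke_heckeGen (m := m)).quadratic a k
  exact Ring.inverse_unit ⟨_, _, h.1, h.2⟩

/-- All nonzero polynomials being the constant `1`, the degree condition only says that `y` is
shorter than `w`. Bar invariance is `altKL_invGen`. -/
lemma isKazhdanLusztig_dihedralKL : IsKazhdanLusztig cs (dihedralKL cs) := by
  refine ⟨fun w => by simp [dihedralKL_apply], fun w y hy h => ?_, fun w => ?_⟩
  · rw [dihedralKL_apply] at h ⊢
    by_cases hl : cs.length y < cs.length w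
    · simp [hl]
    · simp [hy, hl] at h
  · obtain ⟨a, k, hk, rfl⟩ := exists_altProd cs w
    rcases k with _ | k
    · rw [altProd_zero, klElement_one, sum_dihedralKL_one]
      · simp
      · simp
    · rw [klElement_altProd cs a (by omega), length_altProd cs a hk, ← xInv_pow,
        ← altKL_invGen x_mul_xInv (isHecke_heckeGen (m := m)).quadratic]
      refine sum_dihedralKL_altProd cs _ (fun y => ?_) (fun b l hl => ?_) a (by omega)
      · simp
      · simp [inverse_heckeT_altProd cs b hl]

lemma gen_mul_heckeT_of_not_isLeftDescent {i : Fin 2} {w : W} (h : ¬ cs.IsLeftDescent w i) :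
    heckeGen _ i * heckeT cs w = heckeT cs (cs.simple i * w) := by
  obtain ⟨a, k, hk, rfl⟩ := exists_altProd cs w
  rw [isLeftDescent_altProd cs a i hk] at h
  push Not at h
  have h2 : altProd cs.simple a k = altProd cs.simple (i + 1) k := by
    rcases fin_two_eq_or i a with rfl | rfl
    · rw [h.2 rfl]; simp
    · rfl
  rw [h2, ← altProd_succ, heckeT_altProd cs _ hk, ← altProd_succ, heckeT_altProd cs]
  omega

lemma gen_mul_heckeT_of_isLeftDescent {i : Fin 2} {w : W} (h : cs.IsLeftDescent w i) :
    heckeGen _ i * heckeT cs w = (x - 1) • heckeT cs w + x • heckeT cs (cs.simple i * w) := by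
  have h' := cs.isLeftDescent_iff_not_isLeftDescent_mul.1 h
  have := gen_mul_heckeT_of_not_isLeftDescent cs h'
  rw [cs.simple_mul_simple_cancel_left] at this
  conv_lhs => rw [← this, ← mul_assoc, (isHecke_heckeGen.quadratic i).mul_self, add_mul,
    smul_mul_assoc, smul_mul_assoc, one_mul, this]

/-- The span of the `T_y` with `ℓ(y) < k`. -/
def heckeLower (k : ℕ) : Submodule A (HeckeAlgebra (CoxeterMatrix.I m)) :=
  Submodule.span A (heckeT cs '' {y | cs.length y < k})

lemma heckeT_mem_heckeLower {k : ℕ} {y : W} (h : cs.length y < k) :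
    heckeT cs y ∈ heckeLower cs k := Submodule.subset_span ⟨y, h, rfl⟩

lemma heckeLower_mono {k l : ℕ} (h : k ≤ l) : heckeLower cs k ≤ heckeLower cs l :=
  Submodule.span_mono (Set.image_mono fun _ hy => lt_of_lt_of_le hy h)

lemma gen_mul_mem_heckeLower (i : Fin 2) {k : ℕ} {u : HeckeAlgebra (CoxeterMatrix.I m)}
    (hu : u ∈ heckeLower cs k) : heckeGen _ i * u ∈ heckeLower cs (k + 1) := by
  induction hu using Submodule.span_induction with
  | zero => simp
  | add a b _ _ ha hb => rw [mul_add]; exact Submodule.add_mem _ ha hb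
  | smul c a _ ha => rw [mul_smul_comm]; exact Submodule.smul_mem _ _ ha
  | mem u hu =>
    obtain ⟨y, hy, rfl⟩ := hu
    have hlen := cs.length_simple_mul y i
    have hy' : cs.length y < k := hy
    by_cases h : cs.IsLeftDescent y i
    · rw [gen_mul_heckeT_of_isLeftDescent cs h]
      exact Submodule.add_mem _
        (Submodule.smul_mem _ _ (heckeT_mem_heckeLower cs (by omega)))
        (Submodule.smul_mem _ _ (heckeT_mem_heckeLower cs (by omega)))
    · rw [gen_mul_heckeT_of_not_isLeftDescent cs h]
      exact heckeT_mem_heckeLower cs (by omega)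

/-- The bar image of `T_w` has leading term `x^{-ℓ(w)} T_w`: each new factor `T_a⁻¹` multiplies the
leading coefficient by `x⁻¹` and otherwise creates only shorter terms. -/
lemma altProd_invGen_sub_mem (a : Fin 2) {k : ℕ} (hk : k ≤ m + 2) :
    altProd (invGen xInv (heckeGen (CoxeterMatrix.I m))) a k -
      xInv ^ k • altProd (heckeGen (CoxeterMatrix.I m)) a k ∈ heckeLower cs k := by
  induction k generalizing a with
  | zero => simp
  | succ k ih =>
    set T := heckeGen (CoxeterMatrix.I m)
    set u := altProd (invGen xInv T) (a + 1) k - xInv ^ k • altProd T (a + 1) k with hu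
    have hu' : u ∈ heckeLower cs k := ih (a + 1) (by omega)
    have e : altProd (invGen xInv T) a (k + 1) - xInv ^ (k + 1) • altProd T a (k + 1) =
        xInv • (T a * u) - (1 - xInv) • u - ((1 - xInv) * xInv ^ k) • altProd T (a + 1) k := by
      have : altProd (invGen xInv T) (a + 1) k = u + xInv ^ k • altProd T (a + 1) k := by
        rw [hu]; abel
      rw [altProd_succ, this, altProd_succ, invGen, sub_mul, smul_mul_assoc, smul_mul_assoc,
        one_mul, mul_add, smul_add, mul_smul_comm, smul_smul, smul_add, smul_smul,
        pow_succ' xInv k]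
      abel
    rw [e]
    refine Submodule.sub_mem _ (Submodule.sub_mem _ (Submodule.smul_mem _ _
      (gen_mul_mem_heckeLower cs a hu')) (Submodule.smul_mem _ _
      (heckeLower_mono cs (Nat.le_succ k) hu'))) (Submodule.smul_mem _ _ ?_)
    rw [← heckeT_altProd cs _ (by omega : k ≤ m + 2)]
    exact heckeT_mem_heckeLower cs (by rw [length_altProd cs _ (by omega)]; omega)

lemma heckeBasis_repr_of_mem_heckeLower {k : ℕ} {u : HeckeAlgebra (CoxeterMatrix.I m)}
    (hu : u ∈ heckeLower cs k) {y : W} (hy : k ≤ cs.length y) :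
    (heckeBasis cs).repr u y = 0 := by
  induction hu using Submodule.span_induction with
  | zero => simp
  | add a b _ _ ha hb => simp [ha, hb]
  | smul c a _ ha => simp [ha]
  | mem u hu =>
    obtain ⟨z, hz, rfl⟩ := hu
    rw [← heckeBasis_apply, Module.Basis.repr_self, Finsupp.single_eq_of_ne]
    rintro rfl
    exact absurd hz (by simpa using hy)

/-- Unitriangularity of the bar involution on the standard basis. -/
lemma heckeBasis_repr_inverse {z y : W} (h : cs.length z ≤ cs.length y) :
    (heckeBasis cs).repr (Ring.inverse (heckeT cs z⁻¹)) y =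
      Finsupp.single z (xInv ^ cs.length z) y := by
  obtain ⟨a, k, hk, rfl⟩ := exists_altProd cs z
  rw [length_altProd cs a hk] at h ⊢
  have h1 := heckeBasis_repr_of_mem_heckeLower cs (altProd_invGen_sub_mem cs a hk) h
  rw [← inverse_heckeT_altProd cs a hk, ← heckeT_altProd cs a hk, map_sub, map_smul,
    ← heckeBasis_apply cs (altProd _ a k), Module.Basis.repr_self, Finsupp.sub_apply, sub_eq_zero] at h1
  rw [h1]; simp

/-- Clearing denominators in a putative equality gives `reverse d * X ^ (l - k) = d * X ^ deg d`.
The left side has degree at least `l - k`, the right side has degree `2 deg d`, which is smaller. -/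
lemma toLaurent_bar_ne {d : ℤ[X]} (hd : d ≠ 0) {k l : ℕ} (h : 2 * d.natDegree + k < l) :
    LaurentPolynomial.invert (Polynomial.toLaurent d) * xInv ^ k ≠
      xInv ^ l * Polynomial.toLaurent d := by
  intro heq
  obtain ⟨c, rfl⟩ : ∃ c, l = k + c := ⟨l - k, by omega⟩
  have hx : ∀ j, x ^ j * xInv ^ j = 1 := fun j => by rw [← mul_pow, x_mul_xInv, one_pow]
  have hX : ∀ j : ℕ, Polynomial.toLaurent (Polynomial.X ^ j : ℤ[X]) = x ^ j := fun j => by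
    rw [map_pow, Polynomial.toLaurent_X]; rfl
  have h1 := LaurentPolynomial.toLaurent_reverse d
  have hT : (LaurentPolynomial.T (d.natDegree : ℤ) : A) = x ^ d.natDegree := by
    rw [x, LaurentPolynomial.T_pow]; simp
  rw [hT] at h1
  have h2 : Polynomial.toLaurent (d.reverse * Polynomial.X ^ c) =
      Polynomial.toLaurent (d * Polynomial.X ^ d.natDegree) := by
    rw [map_mul, map_mul, hX, hX, h1]
    have e1 := hx k
    have e2 := hx c
    rw [pow_add] at heq
    linear_combination x ^ k * x ^ c * x ^ d.natDegree * heq +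
      (Polynomial.toLaurent d * x ^ d.natDegree - LaurentPolynomial.invert (Polynomial.toLaurent d)
        * x ^ c * x ^ d.natDegree) * e1 +
      x ^ k * xInv ^ k * Polynomial.toLaurent d * x ^ d.natDegree * e2
  have h3 := Polynomial.toLaurent_injective h2
  have h4 := congrArg Polynomial.natDegree h3
  rw [Polynomial.natDegree_mul_X_pow _ (by simpa using hd), Polynomial.natDegree_mul_X_pow _ hd]
    at h4
  omega

/-- Uniqueness of the Kazhdan–Lusztig polynomials. -/
lemma IsKazhdanLusztig.eq_dihedralKL {P : W → W →₀ ℤ[X]} (hP : IsKazhdanLusztig cs P) :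
    P = dihedralKL cs := by
  classical
  have hQ := isKazhdanLusztig_dihedralKL cs
  ext1 w
  by_contra hne
  set d : W →₀ ℤ[X] := P w - dihedralKL cs w with hd
  have hd0 : d ≠ 0 := sub_ne_zero.2 hne
  have hdeg : ∀ y, d y ≠ 0 → 2 * (d y).natDegree + cs.length y < cs.length w := by
    intro y hy
    have hyw : y ≠ w := by
      rintro rfl
      apply hy
      rw [hd, Finsupp.sub_apply, hP.1, hQ.1, sub_self]
    have hp := hP.2.1 w y hyw
    have hq := hQ.2.1 w y hyw
    have hle := Polynomial.natDegree_sub_le (P w y) (dihedralKL cs w y)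
    rw [hd, Finsupp.sub_apply] at hy ⊢
    rcases eq_or_ne (P w y) 0 with h1 | h1 <;> rcases eq_or_ne (dihedralKL cs w y) 0 with h2 | h2
    · simp [h1, h2] at hy
    · have := hq h2
      simp only [h1, zero_sub, Polynomial.natDegree_neg]
      exact this
    · have := hp h1
      simp only [h2, sub_zero]
      exact this
    · have h3 := hq h2
      have h4 := hp h1
      rcases le_total (P w y).natDegree (dihedralKL cs w y).natDegree with h5 | h5
      · rw [max_eq_right h5] at hle; omega
      · rw [max_eq_left h5] at hle; omega
  -- Bar invariance is additive, so the difference of two solutions inherits it.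
  have hbar : (d.sum fun y p =>
      LaurentPolynomial.invert (Polynomial.toLaurent p) • Ring.inverse (heckeT cs y⁻¹)) =
      xInv ^ cs.length w • (d.sum fun y p => Polynomial.toLaurent p • heckeT cs y) := by
    rw [hd, Finsupp.sum_sub_index, Finsupp.sum_sub_index, smul_sub, xInv_pow, hP.2.2 w, hQ.2.2 w]
    · rfl
    · intro a b c; rw [map_sub, sub_smul]
    · intro a b c; rw [map_sub, map_sub, sub_smul]
  -- For `y` of maximal length in the support no other term contributes to the coefficient at `y`,
  -- and invariance becomes the equation excluded by `toLaurent_bar_ne`.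
  obtain ⟨y, hy, hmax⟩ := Finset.exists_max_image d.support cs.length (by simpa using hd0)
  have hcoef := congrArg (fun u => (heckeBasis cs).repr u y) hbar
  have hl : (heckeBasis cs).repr (d.sum fun y p => LaurentPolynomial.invert
      (Polynomial.toLaurent p) • Ring.inverse (heckeT cs y⁻¹)) y =
        LaurentPolynomial.invert (Polynomial.toLaurent (d y)) * xInv ^ cs.length y := by
    rw [Finsupp.sum, map_sum, Finsupp.finsetSum_apply, Finset.sum_eq_single y]
    · rw [map_smul, Finsupp.smul_apply, heckeBasis_repr_inverse cs le_rfl]; simp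
    · intro z hz hzy
      rw [map_smul, Finsupp.smul_apply, heckeBasis_repr_inverse cs (hmax z hz),
        Finsupp.single_eq_of_ne hzy.symm, smul_zero]
    · intro h; exact absurd hy h
  have hr : (heckeBasis cs).repr (xInv ^ cs.length w •
      (d.sum fun y p => Polynomial.toLaurent p • heckeT cs y)) y =
        xInv ^ cs.length w * Polynomial.toLaurent (d y) := by
    rw [map_smul, Finsupp.smul_apply, smul_eq_mul, Finsupp.sum, map_sum, Finsupp.finsetSum_apply,
      Finset.sum_eq_single y]
    · rw [map_smul, Finsupp.smul_apply, ← heckeBasis_apply, Module.Basis.repr_self]; simp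
    · intro z _ hzy
      rw [map_smul, Finsupp.smul_apply, ← heckeBasis_apply, Module.Basis.repr_self,
        Finsupp.single_eq_of_ne hzy.symm, smul_zero]
    · intro h; exact absurd hy h
  simp only [hl, hr] at hcoef
  exact toLaurent_bar_ne (Finsupp.mem_support_iff.1 hy) (hdeg y (Finsupp.mem_support_iff.1 hy))
    hcoef

end KazhdanLusztig

end HeckeFamilies

end

noncomputable section

namespace HeckeFamilies

/-! ### Characters with equal values on the two generators -/

section LinearCharacters

variable {m : ℕ} {A R : Type*} [CommRing A] [CommRing R] [Algebra A R] {q : A}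

lemma altProd_const {R : Type*} [Monoid R] (c : R) (a : Fin 2) (k : ℕ) :
    altProd (fun _ => c) a k = c ^ k := by
  induction k generalizing a with
  | zero => simp
  | succ k ih => rw [altProd_succ, ih, pow_succ']

lemma isHecke_const {R : Type*} [Ring R] [Algebra A R] (n : ℕ) {c : R}
    (h : IsQuadratic q c) : IsHecke n q (fun _ : Fin 2 => c) where
  quadratic _ := h
  braid := by rw [altProd_const, altProd_const]

lemma isQuadratic_neg_one {R : Type*} [Ring R] [Algebra A R] (q : A) :
    IsQuadratic q (-1 : R) := by simp [IsQuadratic]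

lemma isQuadratic_self {R : Type*} [Ring R] [Algebra A R] (q : A) :
    IsQuadratic q (algebraMap A R q) := by simp [IsQuadratic]

lemma altKL_neg_one {R : Type*} [Ring R] (a : Fin 2) (k : ℕ) :
    altKL (fun _ => (-1 : R)) a k = 0 := by simp [altKL]

lemma altKL_const {R : Type*} [Ring R] (c : R) (a : Fin 2) (k : ℕ) :
    altKL (fun _ => c) a k = (c + 1) * ∑ j ∈ Finset.range k, c ^ j := by
  simp [altKL, altSum, altProd_const]

end LinearCharacters

/-! ### Two-sided cells -/

section Cells

variable {m : ℕ} {W : Type*} [Group W] (cs : CoxeterSystem (CoxeterMatrix.I m) W)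

/-- The longest element of the dihedral group. -/
def longestElt : W := altProd cs.simple 0 (m + 2)

lemma longestElt_eq (a : Fin 2) : longestElt cs = altProd cs.simple a (m + 2) :=
  altProd_simple_eq cs 0 a

lemma altProd_ne_one (a : Fin 2) {k : ℕ} (hk : k < m + 2) : altProd cs.simple a (k + 1) ≠ 1 := by
  intro h
  have := length_altProd cs a (by omega : k + 1 ≤ m + 2)
  rw [h] at this
  simp at this

lemma altProd_ne_longestElt (a : Fin 2) {k : ℕ} (hk : k < m + 2) :
    altProd cs.simple a k ≠ longestElt cs := by
  intro h
  have := congrArg cs.length h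
  rw [length_altProd cs a hk.le, longestElt, length_altProd cs 0 le_rfl] at this
  omega

lemma longestElt_ne_one : longestElt cs ≠ 1 := altProd_ne_one cs 0 (by omega)

lemma klElement_longestElt : klElement cs (dihedralKL cs) (longestElt cs) =
    altKL (heckeGen (CoxeterMatrix.I m)) 0 (m + 2) :=
  klElement_altProd cs 0 (by omega)

lemma heckeBasis_repr_klElement (w y : W) :
    (heckeBasis cs).repr (klElement cs (dihedralKL cs) w) y =
      Polynomial.toLaurent (dihedralKL cs w y) := by
  rw [klElement, Finsupp.sum, map_sum, Finsupp.finsetSum_apply]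
  simp only [map_smul, ← heckeBasis_apply, Module.Basis.repr_self, Finsupp.smul_apply]
  rw [Finset.sum_eq_single y]
  · simp
  · intro z _ hz; simp [Finsupp.single_eq_of_ne hz.symm]
  · intro h; simp [Finsupp.notMem_support_iff.1 h]

lemma klElement_linearIndependent :
    LinearIndependent A (klElement cs (dihedralKL cs)) := by
  rw [linearIndependent_iff]
  intro l hl
  by_contra hne
  obtain ⟨y, hy, hmax⟩ := Finset.exists_max_image l.support cs.length (by simpa using hne)
  have h := congrArg (fun u => (heckeBasis cs).repr u y) hl
  simp only [Finsupp.linearCombination_apply, Finsupp.sum, map_sum, Finsupp.finsetSum_apply,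
    map_smul, Finsupp.smul_apply, heckeBasis_repr_klElement, map_zero, Finsupp.zero_apply] at h
  rw [Finset.sum_eq_single y] at h
  · rw [dihedralKL_apply] at h
    simp at h
    simp [h] at hy
  · intro z hz hzy
    rw [dihedralKL_apply, if_neg]
    · simp
    · push Not
      exact ⟨hzy.symm, hmax z hz⟩
  · intro h; exact absurd hy h

/-- The character `T_i ↦ -1` kills every `C_w` with `w ≠ 1` and sends `C_1` to `1`, so it reads off
the coefficient of `C_1`. The other `C_w` therefore span a two-sided ideal. -/
lemma KLStep.ne_one {u v : W} (h : KLStep cs (dihedralKL cs) u v) (hu : u ≠ 1) : v ≠ 1 := by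
  rintro rfl
  let σ : HeckeAlgebra (CoxeterMatrix.I m) →ₐ[A] A :=
    heckeLift (isHecke_const (m + 2) (isQuadratic_neg_one x))
  have hσ : ∀ w ≠ 1, σ (klElement cs (dihedralKL cs) w) = 0 := by
    intro w hw
    obtain ⟨a, k, hk, rfl⟩ := exists_altProd cs w
    rcases k with _ | k
    · simp at hw
    · rw [klElement_altProd cs a (by omega), map_altKL]
      simp only [σ, heckeLift_gen]
      exact altKL_neg_one _ _
  obtain ⟨i, a, h1, h2⟩ := h
  apply h2
  have h3 : σ (a.sum fun y c => c • klElement cs (dihedralKL cs) y) = a 1 := by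
    rw [Finsupp.sum, map_sum, Finset.sum_eq_single 1]
    · simp
    · intro y _ hy; rw [map_smul, hσ y hy, smul_zero]
    · intro h; rw [Finsupp.notMem_support_iff.1 h, zero_smul, map_zero]
  rw [← h3]
  rcases h1 with h1 | h1 <;> rw [← h1, map_mul, hσ u hu] <;> simp

/-- Multiplication by a generator on either side scales `C_{w₀}` by `x`; linear independence makes
this the only expansion. -/
lemma KLStep.eq_longestElt {v : W} (h : KLStep cs (dihedralKL cs) (longestElt cs) v) :
    v = longestElt cs := by
  obtain ⟨i, a, h1, h2⟩ := h
  have h3 : Finsupp.linearCombination A (klElement cs (dihedralKL cs)) a =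
      Finsupp.linearCombination A (klElement cs (dihedralKL cs))
        (Finsupp.single (longestElt cs) x) := by
    rw [Finsupp.linearCombination_single, Finsupp.linearCombination_apply,
      klElement_longestElt]
    rcases h1 with h1 | h1 <;> rw [← h1, klElement_longestElt]
    · exact isHecke_heckeGen.mul_longest i 0
    · exact isHecke_heckeGen.longest_mul i 0
  rw [(klElement_linearIndependent cs) h3] at h2
  by_contra hne
  exact h2 (Finsupp.single_eq_of_ne hne)

lemma klStep_of_eq {u v v' : W} {i : Fin 2} {c d : A} (hc : c ≠ 0) (hv : v ≠ v') (hu : v ≠ u)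
    (h : heckeGen _ i * klElement cs (dihedralKL cs) u = c • klElement cs (dihedralKL cs) v +
        d • klElement cs (dihedralKL cs) v' - klElement cs (dihedralKL cs) u ∨
      klElement cs (dihedralKL cs) u * heckeGen _ i = c • klElement cs (dihedralKL cs) v +
        d • klElement cs (dihedralKL cs) v' - klElement cs (dihedralKL cs) u) :
    KLStep cs (dihedralKL cs) u v := by
  refine ⟨i, Finsupp.single v c + Finsupp.single v' d - Finsupp.single u 1, ?_, ?_⟩
  · have : ((Finsupp.single v c + Finsupp.single v' d - Finsupp.single u 1 : W →₀ A).sum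
        fun y c => c • klElement cs (dihedralKL cs) y) = c • klElement cs (dihedralKL cs) v +
        d • klElement cs (dihedralKL cs) v' - klElement cs (dihedralKL cs) u := by
      rw [← Finsupp.linearCombination_apply, map_sub, map_add]
      simp only [Finsupp.linearCombination_single, one_smul]
    rw [this]
    exact h
  · simpa [Finsupp.single_eq_of_ne hv, Finsupp.single_eq_of_ne hu] using hc

lemma x_ne_zero : x ≠ 0 := isUnit_x.ne_zero

lemma klStep_one (i : Fin 2) : KLStep cs (dihedralKL cs) 1 (cs.simple i) := by
  have hne : cs.simple i ≠ 1 := by simpa using altProd_ne_one cs i (k := 0) (by omega)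
  have h := klElement_altProd cs i (k := 0) (by omega)
  rw [zero_add, altProd_one, altKL_one] at h
  refine klStep_of_eq cs (i := i) (c := 1) (d := 0) (v' := 1) one_ne_zero hne hne (Or.inl ?_)
  rw [h, klElement_one]; simp

/-- The lower term is left as an `altKL` because for `k = 0` it is zero and not the Kazhdan–Lusztig
element of `1`. -/
lemma gen_mul_klElement (a : Fin 2) {k : ℕ} (hk : k + 1 < m + 2) :
    heckeGen _ a * klElement cs (dihedralKL cs) (altProd cs.simple (a + 1) (k + 1)) =
      klElement cs (dihedralKL cs) (altProd cs.simple a (k + 2)) +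
        x • altKL (heckeGen (CoxeterMatrix.I m)) a k -
        klElement cs (dihedralKL cs) (altProd cs.simple (a + 1) (k + 1)) := by
  rw [klElement_altProd cs _ (by omega), klElement_altProd cs _ hk,
    ← add_one_mul_altKL isHecke_heckeGen.quadratic]
  noncomm_ring

lemma altProd_ne_altProd {a b : Fin 2} {k l : ℕ} (hk : k ≤ m + 2) (hl : l ≤ m + 2) (h : k ≠ l) :
    altProd cs.simple a k ≠ altProd cs.simple b l :=
  fun h' => h (altProd_simple_inj cs hk hl h').1

lemma klStep_up (a : Fin 2) {k : ℕ} (hk : k + 1 < m + 2) : KLStep cs (dihedralKL cs)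
    (altProd cs.simple (a + 1) (k + 1)) (altProd cs.simple a (k + 2)) := by
  have h := gen_mul_klElement cs a hk
  rcases k with _ | k
  · refine klStep_of_eq cs (i := a) (c := 1) (d := 0) (v' := 1) one_ne_zero
      (altProd_ne_one cs a hk) (altProd_ne_altProd cs (by omega) (by omega) (by omega))
      (Or.inl ?_)
    rw [h]; simp
  · rw [← klElement_altProd cs a (by omega)] at h
    refine klStep_of_eq cs (i := a) (c := 1) (d := x) (v' := altProd cs.simple a (k + 1))
      one_ne_zero (altProd_ne_altProd cs (by omega) (by omega) (by omega))
      (altProd_ne_altProd cs (by omega) (by omega) (by omega)) (Or.inl ?_)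
    rw [h, one_smul]

lemma klStep_down (a : Fin 2) {k : ℕ} (hk : k + 2 < m + 2) : KLStep cs (dihedralKL cs)
    (altProd cs.simple (a + 1) (k + 2)) (altProd cs.simple a (k + 1)) := by
  have h := gen_mul_klElement cs a hk
  rw [← klElement_altProd cs a (by omega)] at h
  refine klStep_of_eq cs (i := a) (c := x) (d := 1) x_ne_zero
      (v' := altProd cs.simple a (k + 3))
      (altProd_ne_altProd cs (by omega) (by omega) (by omega))
      (altProd_ne_altProd cs (by omega) (by omega) (by omega)) (Or.inl ?_)
  rw [h, one_smul, add_comm (x • _)]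

/-- The left multiplication steps `klStep_up` and `klStep_down` keep the last letter of a word. This
right multiplication changes it and merges the middle left cells into one two-sided cell. -/
lemma klStep_right (a : Fin 2) : KLStep cs (dihedralKL cs)
    (altProd cs.simple a 1) (altProd cs.simple a 2) := by
  refine klStep_of_eq cs (i := a + 1) (c := 1) (d := 0) (v' := 1) one_ne_zero
      (altProd_ne_one cs a (by omega)) (altProd_ne_altProd cs (by omega) (by omega) (by omega))
      (Or.inr ?_)
  rw [klElement_altProd cs a (k := 0) (by omega), klElement_altProd cs a (k := 1) (by omega),
    altKL_one, altKL_two]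
  simp only [one_smul, zero_smul, add_zero]
  noncomm_ring

open Relation in
lemma reflTransGen_of_simple (hm : 1 ≤ m) (b : Fin 2) {w : W} (hw : w ≠ 1) :
    ReflTransGen (KLStep cs (dihedralKL cs)) (altProd cs.simple b 1) w := by
  have up : ∀ k, k < m + 2 → ∀ a, ∃ b, ReflTransGen (KLStep cs (dihedralKL cs))
      (altProd cs.simple b 1) (altProd cs.simple a (k + 1)) := by
    intro k
    induction k with
    | zero => exact fun _ a => ⟨a, .refl⟩
    | succ k ih =>
      intro hk a
      obtain ⟨b, hb⟩ := ih (by omega) (a + 1)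
      exact ⟨b, hb.tail (klStep_up cs a hk)⟩
  -- The passage is `s_b → s_b s_{b+1} → s_{b+1}`. Its second arrow needs length `2` to be below
  -- that of the longest element, that is `n ≥ 3`.
  have swap : ∀ b, ReflTransGen (KLStep cs (dihedralKL cs))
      (altProd cs.simple b 1) (altProd cs.simple (b + 1) 1) := by
    intro b
    have h := klStep_down cs (b + 1) (k := 0) (by omega)
    rw [add_one_add_one] at h
    exact (ReflTransGen.single (klStep_right cs b)).tail h
  obtain ⟨a, k, hk, rfl⟩ := exists_altProd cs w
  rcases k with _ | k
  · simp at hw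
  obtain ⟨c, hc⟩ := up k (by omega) a
  rcases fin_two_eq_or b c with rfl | rfl
  · exact hc
  · exact (swap b).trans hc

open Relation in
/-- The two-sided Kazhdan–Lusztig preorder of a dihedral group. -/
lemma lrLe_iff (hm : 1 ≤ m) (v u : W) : LRLe cs (dihedralKL cs) v u ↔
    u = 1 ∨ (v ≠ 1 ∧ (u ≠ longestElt cs ∨ v = longestElt cs)) := by
  constructor
  · intro h
    induction h with
    | refl => tauto
    | tail h1 h2 ih =>
      rcases ih with ih | ih
      · exact Or.inl ih
      · refine Or.inr ⟨h2.ne_one cs ih.1, ?_⟩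
        rcases ih.2 with h3 | rfl
        · exact Or.inl h3
        · exact Or.inr (h2.eq_longestElt cs)
  · intro h
    by_cases hu : u = 1
    · subst hu
      by_cases hv : v = 1
      · subst hv; exact .refl
      · have := reflTransGen_of_simple cs hm 0 hv
        rw [altProd_one] at this
        exact (ReflTransGen.single (klStep_one cs 0)).trans this
    · obtain ⟨hv, h⟩ := h.resolve_left hu
      by_cases hl : u = longestElt cs
      · rw [h.resolve_left (by simpa using hl), hl]; exact .refl
      · obtain ⟨a, k, hk, rfl⟩ := exists_altProd cs u
        have down : ∀ k, k + 1 < m + 2 → ∀ a, ∃ b, ReflTransGen (KLStep cs (dihedralKL cs))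
            (altProd cs.simple a (k + 1)) (altProd cs.simple b 1) := by
          intro k
          induction k with
          | zero => exact fun _ a => ⟨a, .refl⟩
          | succ k ih =>
            intro hk a
            obtain ⟨b, hb⟩ := ih (by omega) (a + 1)
            have hd := klStep_down cs (a + 1) hk
            rw [add_one_add_one] at hd
            exact ⟨b, hb.head hd⟩
        rcases k with _ | k
        · simp at hu
        have hk' : k + 1 < m + 2 := by
          rcases hk.lt_or_eq with h | h
          · exact h
          · exact absurd (by rw [h, longestElt_eq cs a]) hl
        obtain ⟨b, hb⟩ := down k hk' a
        exact hb.trans (reflTransGen_of_simple cs hm b hv)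

end Cells

end HeckeFamilies

end

noncomputable section

namespace HeckeFamilies

/-! ### Irreducible representations and linear characters of a group -/

section Representations

variable {K G : Type*} [Field K] [Group G]

lemma isIrreducible_iff {V : Type*} [AddCommGroup V] [Module K V] (ρ : Representation K G V) :
    ρ.IsIrreducible ↔ Nontrivial V ∧
      ∀ U : Submodule K V, (∀ g, ∀ v ∈ U, ρ g v ∈ U) → U = ⊥ ∨ U = ⊤ := by
  constructor
  · intro h
    refine ⟨?_, fun U hU => ?_⟩
    · by_contra hcon
      rw [not_nontrivial_iff_subsingleton] at hcon
      apply (bot_ne_top : (⊥ : Subrepresentation ρ) ≠ ⊤)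
      ext v
      simp [Subsingleton.elim v 0]
    · let S : Subrepresentation ρ := ⟨U, fun g v hv => hU g v hv⟩
      rcases eq_bot_or_eq_top S with h | h
      · exact Or.inl (congrArg Subrepresentation.toSubmodule h)
      · exact Or.inr (congrArg Subrepresentation.toSubmodule h)
  · rintro ⟨hV, h⟩
    have hnt : Nontrivial (Subrepresentation ρ) :=
      ⟨⊥, ⊤, fun hcon => bot_ne_top (congrArg Subrepresentation.toSubmodule hcon)⟩
    refine { eq_bot_or_eq_top := fun S => ?_ }
    · rcases h S.toSubmodule (fun g v hv => S.apply_mem_toSubmodule g hv) with h | h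
      · exact Or.inl (Subrepresentation.toSubmodule_injective h)
      · exact Or.inr (Subrepresentation.toSubmodule_injective h)

lemma end_fin_one_eq_smul (f : Module.End K (Fin 1 → K)) :
    f = LinearMap.trace K (Fin 1 → K) f • 1 := by
  have h : ∀ v : Fin 1 → K, v = v 0 • (fun _ => 1) := by
    intro v; ext i; fin_cases i; simp
  have hf : f = (f (fun _ => 1) 0) • 1 := by
    refine LinearMap.ext fun v => ?_
    rw [h v, map_smul, h (f fun _ => 1)]
    simp only [LinearMap.smul_apply, Module.End.one_apply, Pi.smul_apply]
    ext i; simp; ring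
  conv_lhs => rw [hf]
  congr 1
  conv_rhs => rw [hf]
  simp

lemma trace_one (d : ℕ) : LinearMap.trace K (Fin d → K) 1 = d := by
  rw [LinearMap.trace_one]; simp

/-- An irreducible representation with a common eigenvector is a linear character. -/
lemma eq_one_of_eigenvector {d : ℕ} {ρ : Representation K G (Fin d → K)} (hρ : ρ.IsIrreducible)
    {χ : G → K} {v : Fin d → K} (hv : v ≠ 0) (h : ∀ g, ρ g v = χ g • v) :
    d = 1 ∧ ∀ g, LinearMap.trace K (Fin d → K) (ρ g) = χ g := by
  have htop : K ∙ v = ⊤ := by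
    refine (((isIrreducible_iff ρ).1 hρ).2 (K ∙ v) fun g u hu => ?_).resolve_left
      (by simpa using hv)
    obtain ⟨c, rfl⟩ := Submodule.mem_span_singleton.1 hu
    rw [map_smul, h, smul_smul]
    exact Submodule.smul_mem _ _ (Submodule.mem_span_singleton_self v)
  have hd : d = 1 := by
    have := finrank_span_singleton (K := K) hv
    rw [htop, finrank_top] at this
    simpa using this
  refine ⟨hd, fun g => ?_⟩
  have : ρ g = χ g • 1 := by
    refine LinearMap.ext fun u => ?_
    have hu : u ∈ K ∙ v := by rw [htop]; trivial
    obtain ⟨c, rfl⟩ := Submodule.mem_span_singleton.1 hu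
    rw [map_smul, h]
    simp [smul_comm c]
  rw [this, map_smul, trace_one, hd]; simp

lemma eq_smul_of_trace [CharZero K] {d : ℕ} {ρ : Representation K G (Fin d → K)} {χ : G → K}
    (h1 : χ 1 = 1) (h : ∀ g, LinearMap.trace K (Fin d → K) (ρ g) = χ g) :
    d = 1 ∧ ∀ g, ρ g = χ g • 1 := by
  have hd : d = 1 := by
    have := h 1
    rw [map_one, trace_one, h1] at this
    exact_mod_cast this
  subst hd
  exact ⟨rfl, fun g => by rw [← h g]; exact end_fin_one_eq_smul _⟩

/-- The one-dimensional representation attached to a linear character. -/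
def linearRep (χ : G →* K) : Representation K G (Fin 1 → K) :=
  (algebraMap K (Module.End K (Fin 1 → K)) : K →* Module.End K (Fin 1 → K)).comp χ

lemma linearRep_apply (χ : G →* K) (g : G) : linearRep χ g = χ g • 1 := by
  rw [← Algebra.algebraMap_eq_smul_one]; rfl

lemma linearRep_irreducible (χ : G →* K) : (linearRep χ).IsIrreducible := by
  rw [isIrreducible_iff]
  refine ⟨inferInstance, fun U _ => ?_⟩
  have : IsSimpleModule K (Fin 1 → K) := by
    rw [isSimpleModule_iff_finrank_eq_one]; simp
  exact eq_bot_or_eq_top U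

lemma trace_linearRep (χ : G →* K) (g : G) :
    LinearMap.trace K (Fin 1 → K) (linearRep χ g) = χ g := by
  rw [linearRep_apply, map_smul, trace_one]; simp

lemma eq_zero_of_span {M V : Type*} [AddCommGroup M] [Module K M] [AddCommGroup V] [Module K V]
    {S : Set M} {I : Submodule K M} (hI : I = Submodule.span K S) (f : I →ₗ[K] V)
    (h : ∀ z ∈ S, ∀ hz : z ∈ I, f ⟨z, hz⟩ = 0) : f = 0 := by
  subst hI
  refine LinearMap.ext fun z => ?_
  obtain ⟨z, hz⟩ := z
  refine Submodule.span_induction (p := fun z hz => f ⟨z, hz⟩ = 0) ?_ ?_ ?_ ?_ hz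
  · exact fun z hz => h z hz _
  · exact map_zero f
  · intro a b ha hb iha ihb
    exact (map_add f ⟨a, ha⟩ ⟨b, hb⟩).trans (by rw [iha, ihb, add_zero])
  · intro c a ha iha
    exact (map_smul f c ⟨a, ha⟩).trans (by rw [iha, smul_zero])

end Representations

/-! ### Characters attached to the cells -/

section Families

variable {m : ℕ} {W : Type*} [Group W] (cs : CoxeterSystem (CoxeterMatrix.I m) W)
  (K : Type*) [Field K]

/-- The generators of `W` in the group algebra. -/
def groupGen (i : Fin 2) : MonoidAlgebra K W := MonoidAlgebra.single (cs.simple i) 1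

lemma altProd_groupGen (a : Fin 2) (k : ℕ) :
    altProd (groupGen cs K) a k = MonoidAlgebra.single (altProd cs.simple a k) 1 := by
  exact (map_altProd cs.simple (MonoidAlgebra.of K W) a k).symm

lemma groupGen_isHecke : IsHecke (m + 2) (1 : K) (groupGen cs K) where
  quadratic i := by
    rw [isQuadratic_iff, groupGen, MonoidAlgebra.single_mul_single, cs.simple_mul_simple_self]
    simp [MonoidAlgebra.one_def]
  braid := by rw [altProd_groupGen, altProd_groupGen, altProd_simple_braid]

lemma klGroupElement_altProd (a : Fin 2) {k : ℕ} (hk : k < m + 2) :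
    klGroupElement K (dihedralKL cs) (altProd cs.simple a (k + 1)) =
      altKL (groupGen cs K) a (k + 1) := by
  refine sum_dihedralKL_altProd cs _ (fun y => ?_) (fun b l hl => ?_) a hk
  · simp
  · simp [altProd_groupGen]

@[simp] lemma klGroupElement_one : klGroupElement K (dihedralKL cs) 1 = 1 := by
  rw [klGroupElement, sum_dihedralKL_one cs]
  · simp [MonoidAlgebra.one_def]
  · simp

lemma altProd_sub_altKL_mem (a : Fin 2) {k : ℕ} (hk : k ≤ m + 2) :
    altProd (groupGen cs K) a k ∈ Submodule.span K (Set.range (klGroupElement K (dihedralKL cs)))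
    := by
  induction k using Nat.strong_induction_on generalizing a with
  | _ k ih =>
    rcases k with _ | k
    · exact Submodule.subset_span ⟨1, by simp⟩
    · have h1 : altKL (groupGen cs K) a (k + 1) ∈
          Submodule.span K (Set.range (klGroupElement K (dihedralKL cs))) :=
        Submodule.subset_span ⟨_, klGroupElement_altProd cs K a hk⟩
      have h2 : altProd (groupGen cs K) a (k + 1) = altKL (groupGen cs K) a (k + 1) -
          (altSum (groupGen cs K) a (k + 1) - altProd (groupGen cs K) a 0 +
            altSum (groupGen cs K) (a + 1) (k + 1)) := by
        rw [altKL_eq, altSum_succ _ a (k + 1), altProd_zero]; abel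
      have h3 : ∀ b, altSum (groupGen cs K) b (k + 1) ∈
          Submodule.span K (Set.range (klGroupElement K (dihedralKL cs))) := fun b =>
        Submodule.sum_mem _ fun j hj => by
          have := Finset.mem_range.1 hj
          exact ih j this b (by omega)
      rw [h2]
      exact Submodule.sub_mem _ h1 (Submodule.add_mem _ (Submodule.sub_mem _ (h3 a)
        (ih 0 (by omega) a (by omega))) (h3 _))

lemma span_klGroupElement :
    Submodule.span K (Set.range (klGroupElement K (dihedralKL cs))) = ⊤ := by
  rw [eq_top_iff]
  intro z _
  induction z using MonoidAlgebra.induction_linear with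
  | zero => exact Submodule.zero_mem _
  | add a b ha hb => exact Submodule.add_mem _ (ha trivial) (hb trivial)
  | single w c =>
    obtain ⟨a, k, hk, rfl⟩ := exists_altProd cs w
    have := Submodule.smul_mem _ c (altProd_sub_altKL_mem cs K a hk)
    rw [altProd_groupGen] at this
    simpa using this

lemma groupGen_mul_klGroupElement (a : Fin 2) {k : ℕ} (hk : k < m + 2) :
    groupGen cs K a * klGroupElement K (dihedralKL cs) (altProd cs.simple a (k + 1)) =
      klGroupElement K (dihedralKL cs) (altProd cs.simple a (k + 1)) := by
  rw [klGroupElement_altProd cs K a hk, mul_altKL (groupGen_isHecke cs K).quadratic, one_smul]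

lemma groupGen_mul_longest (i : Fin 2) :
    groupGen cs K i * klGroupElement K (dihedralKL cs) (longestElt cs) =
      klGroupElement K (dihedralKL cs) (longestElt cs) := by
  rw [longestElt_eq cs i]
  exact groupGen_mul_klGroupElement cs K i (by omega)

lemma single_mul_longest (g : W) :
    MonoidAlgebra.single g 1 * klGroupElement K (dihedralKL cs) (longestElt cs) =
      klGroupElement K (dihedralKL cs) (longestElt cs) := by
  induction g using cs.simple_induction_left with
  | one => rw [← MonoidAlgebra.one_def, one_mul]
  | mul_simple_left w i ih =>
    have : (MonoidAlgebra.single (cs.simple i * w) 1 : MonoidAlgebra K W) =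
      groupGen cs K i * MonoidAlgebra.single w 1 := by simp [groupGen]
    rw [this, mul_assoc, ih, groupGen_mul_longest]

/-- The sign character as a homomorphism. -/
def signHom : W →* K :=
  cs.lift ⟨fun _ => -1, (fun i j => by simp : (CoxeterMatrix.I m).IsLiftable fun _ => (-1 : K))⟩

lemma signHom_simple (i : Fin 2) : signHom cs K (cs.simple i) = -1 :=
  cs.lift_apply_simple _ i

lemma signHom_apply (w : W) : signHom cs K w = signChar cs K w := by
  obtain ⟨a, k, hk, rfl⟩ := exists_altProd cs w
  rw [signChar, length_altProd cs a hk, map_altProd]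
  simp only [signHom_simple, altProd_const]

/-- The extension of a linear character to the group algebra. -/
def groupAlgChar (χ : W →* K) : MonoidAlgebra K W →ₐ[K] K := MonoidAlgebra.lift K K W χ

variable {K}

lemma groupAlgChar_single (χ : W →* K) (g : W) (c : K) :
    groupAlgChar K χ (MonoidAlgebra.single g c) = c * χ g := by
  simp [groupAlgChar]

lemma sign_klGroupElement {w : W} (hw : w ≠ 1) :
    groupAlgChar K (signHom cs K) (klGroupElement K (dihedralKL cs) w) = 0 := by
  obtain ⟨a, k, hk, rfl⟩ := exists_altProd cs w
  rcases k with _ | k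
  · simp at hw
  rw [klGroupElement_altProd cs K a (by omega), map_altKL]
  simp only [groupGen, groupAlgChar_single, signHom_simple, one_mul]
  exact altKL_neg_one _ _

lemma trivial_longest [CharZero K] :
    groupAlgChar K (1 : W →* K) (klGroupElement K (dihedralKL cs) (longestElt cs)) ≠ 0 := by
  rw [longestElt, klGroupElement_altProd cs K 0 (by omega), map_altKL]
  simp only [groupGen, groupAlgChar_single, MonoidHom.one_apply, one_mul]
  rw [altKL_const]
  simp only [one_pow, Finset.sum_const, Finset.card_range, nsmul_eq_mul, mul_one]
  have : ((m + 2 : ℕ) : K) ≠ 0 := Nat.cast_ne_zero.2 (by omega)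
  refine mul_ne_zero ?_ this
  rw [one_add_one_eq_two]
  exact two_ne_zero

/-- The elements `C_v` with `v ≠ 1` lie in the kernel of the sign character. Together with `C_1 =
1`, on which the sign is `1`, they span the group algebra, so they fill the kernel. -/
lemma mem_span_klGroupElement_iff (z : MonoidAlgebra K W) :
    z ∈ Submodule.span K (klGroupElement K (dihedralKL cs) '' {v | v ≠ 1}) ↔
      groupAlgChar K (signHom cs K) z = 0 := by
  constructor
  · intro hz
    induction hz using Submodule.span_induction with
    | zero => simp
    | add a b _ _ ha hb => rw [map_add, ha, hb, add_zero]
    | smul c a _ ha => rw [map_smul, ha, smul_zero]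
    | mem u hu =>
      obtain ⟨v, hv, rfl⟩ := hu
      exact sign_klGroupElement cs hv
  · intro hz
    have hz' : z ∈ Submodule.span K (Set.range (klGroupElement K (dihedralKL cs))) := by
      rw [span_klGroupElement]; trivial
    have hr : Set.range (klGroupElement K (dihedralKL cs)) =
        insert 1 (klGroupElement K (dihedralKL cs) '' {v | v ≠ 1}) := by
      ext u
      simp only [Set.mem_range, Set.mem_insert_iff, Set.mem_image, Set.mem_ofPred_eq]
      constructor
      · rintro ⟨v, rfl⟩
        by_cases hv : v = 1
        · subst hv; left; simp
        · exact Or.inr ⟨v, hv, rfl⟩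
      · rintro (rfl | ⟨v, -, rfl⟩)
        · exact ⟨1, by simp⟩
        · exact ⟨v, rfl⟩
    rw [hr, Submodule.mem_span_insert] at hz'
    obtain ⟨c, u, hu, rfl⟩ := hz'
    have hu0 : groupAlgChar K (signHom cs K) u = 0 := by
      clear hz
      induction hu using Submodule.span_induction with
      | zero => simp
      | add a b _ _ ha hb => rw [map_add, ha, hb, add_zero]
      | smul c a _ ha => rw [map_smul, ha, smul_zero]
      | mem u hu =>
        obtain ⟨v, hv, rfl⟩ := hu
        exact sign_klGroupElement cs hv
    rw [map_add, hu0, add_zero, map_smul, map_one, smul_eq_mul, mul_one] at hz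
    rw [hz, zero_smul, zero_add]
    exact hu

lemma rep_eq_of_simple {V : Type*} [AddCommGroup V] [Module K V] (ρ : Representation K W V)
    (χ : W →* K) {v : V} (h : ∀ i, ρ (cs.simple i) v = χ (cs.simple i) • v) (g : W) :
    ρ g v = χ g • v := by
  induction g using cs.simple_induction_left with
  | one => simp
  | mul_simple_left w i ih =>
    rw [map_mul, Module.End.mul_apply, ih, map_smul, h, smul_smul, map_mul, mul_comm]

lemma one_ne_zero_fin : (fun _ => 1 : Fin 1 → K) ≠ 0 := fun h => by
  simpa using congrFun h 0

/-- The intertwining map from a left ideal of the group algebra to a linear character. -/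
def charMap (χ : W →* K) (I : Submodule K (MonoidAlgebra K W)) : I →ₗ[K] (Fin 1 → K) :=
  (LinearMap.toSpanSingleton K (Fin 1 → K) (fun _ => 1)) ∘ₗ (groupAlgChar K χ).toLinearMap ∘ₗ
    I.subtype

lemma charMap_apply (χ : W →* K) (I : Submodule K (MonoidAlgebra K W)) (z : I) :
    charMap χ I z = groupAlgChar K χ (z : MonoidAlgebra K W) • fun _ => 1 := rfl

lemma charMap_intertwines (χ : W →* K) (I : Submodule K (MonoidAlgebra K W)) (g : W) (z z' : I)
    (h : (z' : MonoidAlgebra K W) = MonoidAlgebra.single g 1 * (z : MonoidAlgebra K W)) :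
    charMap χ I z' = linearRep χ g (charMap χ I z) := by
  rw [charMap_apply, charMap_apply, h, map_mul, groupAlgChar_single, linearRep_apply, one_mul]
  simp [mul_smul, smul_comm (χ g)]

variable (K)

/-- The layer is `K[W] / ker ε`. It is generated by the class of `1`, and `s_i` acts there by `-1`
because `C_{s_i} = s_i + 1` belongs to the smaller ideal. -/
lemma cellFamily_one (hm : 1 ≤ m) : cellFamily cs K (dihedralKL cs) 1 = {signChar cs K} := by
  have hI : ∀ v, klGroupElement K (dihedralKL cs) v ∈ cellIdeal cs K (dihedralKL cs) 1 :=
    fun v => Submodule.subset_span ⟨v, (lrLe_iff cs hm v 1).2 (Or.inl rfl), rfl⟩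
  have hS : {v | LRLe cs (dihedralKL cs) v 1 ∧ ¬ LRLe cs (dihedralKL cs) 1 v} = {v | v ≠ 1} := by
    ext v
    simp [lrLe_iff cs hm]
  ext φ
  simp only [Set.mem_singleton_iff]
  constructor
  · rintro ⟨d, ρ, hρ, rfl, f, hf, hint, hker⟩
    set u := f ⟨_, hI 1⟩ with hu
    have hu0 : u ≠ 0 := by
      intro h0
      apply hf
      refine eq_zero_of_span rfl f ?_
      rintro _ ⟨v, hv, rfl⟩ h
      by_cases h1 : v = 1
      · subst h1; exact h0
      · refine hker _ ?_
        rw [strictCellIdeal, hS]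
        exact Submodule.subset_span ⟨v, h1, rfl⟩
    have hsimple : ∀ i, ρ (cs.simple i) u = signHom cs K (cs.simple i) • u := by
      intro i
      have hne : cs.simple i ≠ 1 := by simpa using altProd_ne_one cs i (k := 0) (by omega)
      have hks : klGroupElement K (dihedralKL cs) (cs.simple i) =
          MonoidAlgebra.single (cs.simple i) 1 + 1 := by
        simpa [groupGen] using klGroupElement_altProd cs K i (k := 0) (by omega)
      have h1 : f ⟨_, hI (cs.simple i)⟩ = 0 := by
        refine hker _ ?_
        rw [strictCellIdeal, hS]
        exact Submodule.subset_span ⟨_, hne, rfl⟩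
      have h2 := hint (cs.simple i) ⟨_, hI 1⟩ (⟨_, hI (cs.simple i)⟩ - ⟨_, hI 1⟩) (by simp [hks])
      rw [map_sub, h1, zero_sub] at h2
      rw [hu, ← h2, signHom_simple, neg_smul, one_smul]
    have := eq_one_of_eigenvector hρ hu0 (rep_eq_of_simple cs ρ (signHom cs K) hsimple)
    ext g
    rw [this.2, signHom_apply]
  · rintro rfl
    refine ⟨1, linearRep (signHom cs K), linearRep_irreducible _, ?_, charMap _ _, ?_,
      charMap_intertwines _ _, ?_⟩
    · ext g; rw [trace_linearRep, signHom_apply]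
    · intro h
      have := LinearMap.congr_fun h ⟨_, hI 1⟩
      rw [charMap_apply] at this
      simp at this
      exact one_ne_zero_fin this
    · intro z hz
      rw [strictCellIdeal, hS] at hz
      rw [charMap_apply, (mem_span_klGroupElement_iff cs _).1 hz, zero_smul]

/-- At `x = 1` the element `C_{w₀}` is the sum of all group elements; the layer is the line it
spans, with trivial action. -/
lemma cellFamily_longestElt [CharZero K] (hm : 1 ≤ m) :
    cellFamily cs K (dihedralKL cs) (longestElt cs) = {trivialChar K W} := by
  have hne := longestElt_ne_one cs
  have hI : {v | LRLe cs (dihedralKL cs) v (longestElt cs)} = {longestElt cs} := by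
    ext v
    simp only [lrLe_iff cs hm, Set.mem_ofPred_eq, Set.mem_singleton_iff]
    constructor
    · tauto
    · rintro rfl; tauto
  have hS : {v | LRLe cs (dihedralKL cs) v (longestElt cs) ∧
      ¬ LRLe cs (dihedralKL cs) (longestElt cs) v} = ∅ := by
    ext v
    simp only [lrLe_iff cs hm, Set.mem_ofPred_eq, Set.mem_empty_iff_false]
    tauto
  have hspan : cellIdeal cs K (dihedralKL cs) (longestElt cs) =
      K ∙ klGroupElement K (dihedralKL cs) (longestElt cs) := by
    rw [cellIdeal, hI, Set.image_singleton]
  have hmem : klGroupElement K (dihedralKL cs) (longestElt cs) ∈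
      cellIdeal cs K (dihedralKL cs) (longestElt cs) := by
    rw [hspan]; exact Submodule.mem_span_singleton_self _
  ext φ
  simp only [Set.mem_singleton_iff]
  constructor
  · rintro ⟨d, ρ, hρ, rfl, f, hf, hint, hker⟩
    set u := f ⟨_, hmem⟩ with hu
    have hu0 : u ≠ 0 := by
      intro h0
      apply hf
      refine LinearMap.ext fun z => ?_
      obtain ⟨z, hz⟩ := z
      obtain ⟨c, hc⟩ := Submodule.mem_span_singleton.1 (hspan ▸ hz)
      have : (⟨z, hz⟩ : cellIdeal cs K (dihedralKL cs) (longestElt cs)) = c • ⟨_, hmem⟩ :=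
        Subtype.ext hc.symm
      rw [this, map_smul, ← hu, h0]; simp
    have hinv : ∀ g, ρ g u = (1 : W → K) g • u := by
      intro g
      rw [Pi.one_apply, one_smul, hu]
      exact (hint g _ _ (single_mul_longest cs K g).symm).symm
    have := eq_one_of_eigenvector hρ hu0 hinv
    ext g
    rw [this.2]; rfl
  · rintro rfl
    refine ⟨1, linearRep 1, linearRep_irreducible _, ?_, charMap _ _, ?_,
      charMap_intertwines _ _, ?_⟩
    · ext g; rw [trace_linearRep]; rfl
    · intro h
      have := LinearMap.congr_fun h ⟨_, hmem⟩
      rw [charMap_apply] at this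
      exact smul_ne_zero (trivial_longest cs) one_ne_zero_fin this
    · intro z hz
      rw [strictCellIdeal, hS, Set.image_empty, Submodule.span_empty, Submodule.mem_bot] at hz
      rw [charMap_apply, hz, map_zero, zero_smul]

lemma single_mul_sum_eq (z : MonoidAlgebra K W) :
    klGroupElement K (dihedralKL cs) (longestElt cs) * z = groupAlgChar K 1 z •
      klGroupElement K (dihedralKL cs) (longestElt cs) := by
  induction z using MonoidAlgebra.induction_linear with
  | zero => simp
  | add a b ha hb => rw [mul_add, ha, hb, map_add, add_smul]
  | single w c =>
    rw [groupAlgChar_single, MonoidHom.one_apply, mul_one]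
    have h : klGroupElement K (dihedralKL cs) (longestElt cs) * MonoidAlgebra.single w 1 =
        klGroupElement K (dihedralKL cs) (longestElt cs) := by
      induction w using cs.simple_induction_left with
      | one => rw [← MonoidAlgebra.one_def, mul_one]
      | mul_simple_left w i ih =>
        have : (MonoidAlgebra.single (cs.simple i * w) 1 : MonoidAlgebra K W) =
          groupGen cs K i * MonoidAlgebra.single w 1 := by simp [groupGen]
        rw [this, ← mul_assoc, longestElt, klGroupElement_altProd cs K 0 (by omega),
          (groupGen_isHecke cs K).longest_mul, one_smul,
          ← klGroupElement_altProd cs K 0 (by omega)]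
        exact ih
    have h2 : (MonoidAlgebra.single w c : MonoidAlgebra K W) = c • MonoidAlgebra.single w 1 := by
      simp
    rw [h2, mul_smul_comm, h]

/-- The layer is `ker ε` modulo the line of the invariant element `C_{w₀}`. Removing the two extreme
layers from the regular representation leaves every irreducible character except the trivial one and
the sign. -/
lemma cellFamily_middle [CharZero K] (hm : 1 ≤ m) {w : W} (hw1 : w ≠ 1) (hw0 : w ≠ longestElt cs) :
    cellFamily cs K (dihedralKL cs) w =
      {φ | φ ∈ irrGroup K W ∧ φ ≠ trivialChar K W ∧ φ ≠ signChar cs K} := by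
  have hne := longestElt_ne_one cs
  have hI : {v | LRLe cs (dihedralKL cs) v w} = {v | v ≠ 1} := by
    ext v
    simp only [lrLe_iff cs hm, Set.mem_ofPred_eq]
    tauto
  have hS : {v | LRLe cs (dihedralKL cs) v w ∧ ¬ LRLe cs (dihedralKL cs) w v} =
      {longestElt cs} := by
    ext v
    simp only [lrLe_iff cs hm, Set.mem_ofPred_eq, Set.mem_singleton_iff]
    constructor
    · tauto
    · rintro rfl; tauto
  have hmem : ∀ z, z ∈ cellIdeal cs K (dihedralKL cs) w ↔
      groupAlgChar K (signHom cs K) z = 0 := by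
    intro z
    rw [cellIdeal, hI, mem_span_klGroupElement_iff]
  have hstrict : ∀ z, z ∈ strictCellIdeal cs K (dihedralKL cs) w ↔
      z ∈ K ∙ klGroupElement K (dihedralKL cs) (longestElt cs) := by
    intro z
    rw [strictCellIdeal, hS, Set.image_singleton]
  ext φ
  constructor
  · rintro ⟨d, ρ, hρ, rfl, f, hf, hint, hker⟩
    refine ⟨⟨d, ρ, hρ, rfl⟩, fun htriv => hf ?_, fun hsgn => hf ?_⟩
    · have hρ1 := (eq_smul_of_trace (ρ := ρ) (χ := trivialChar K W) rfl
        (fun g => congrFun htriv g)).2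
      refine LinearMap.ext fun z => ?_
      -- When `ρ` is trivial, `f (h z)` is `f z` times the augmentation of `h`. Taking `h = C_{w₀}`,
      -- the product lies in the smaller ideal while the augmentation is nonzero, so `f z = 0`.
      have key : ∀ h : MonoidAlgebra K W, ∀ hh : h * (z : MonoidAlgebra K W) ∈
          cellIdeal cs K (dihedralKL cs) w, f ⟨_, hh⟩ = groupAlgChar K 1 h • f z := by
        intro h
        induction h using MonoidAlgebra.induction_linear with
        | zero =>
          intro hh
          have : (⟨_, hh⟩ : cellIdeal cs K (dihedralKL cs) w) = 0 := Subtype.ext (zero_mul _)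
          rw [this]; simp
        | add a b ha hb =>
          intro hh
          have hl : ∀ c : MonoidAlgebra K W, c * (z : MonoidAlgebra K W) ∈
              cellIdeal cs K (dihedralKL cs) w := by
            intro c; rw [hmem, map_mul, (hmem _).1 z.2, mul_zero]
          have : (⟨_, hh⟩ : cellIdeal cs K (dihedralKL cs) w) = ⟨_, hl a⟩ + ⟨_, hl b⟩ :=
            Subtype.ext (add_mul _ _ _)
          rw [this, map_add, ha, hb, map_add, add_smul]
        | single g c =>
          intro hh
          have hl : ∀ c : MonoidAlgebra K W, c * (z : MonoidAlgebra K W) ∈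
              cellIdeal cs K (dihedralKL cs) w := by
            intro c; rw [hmem, map_mul, (hmem _).1 z.2, mul_zero]
          have : (⟨_, hh⟩ : cellIdeal cs K (dihedralKL cs) w) =
              c • ⟨_, hl (MonoidAlgebra.single g 1)⟩ :=
            Subtype.ext (by simp [← smul_mul_assoc])
          rw [this, map_smul, hint g z ⟨_, hl _⟩ rfl, hρ1 g, groupAlgChar_single]
          simp [trivialChar]
      have hh : klGroupElement K (dihedralKL cs) (longestElt cs) * (z : MonoidAlgebra K W) ∈
          cellIdeal cs K (dihedralKL cs) w := by
        rw [hmem, map_mul, (hmem _).1 z.2, mul_zero]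
      have h1 := key _ hh
      rw [hker _ ((hstrict _).2 (by
        simp only [single_mul_sum_eq]
        exact Submodule.smul_mem _ _ (Submodule.mem_span_singleton_self _)))] at h1
      exact (smul_eq_zero.1 h1.symm).resolve_left (trivial_longest cs)
    · have hρ1 := (eq_smul_of_trace (ρ := ρ) (χ := signChar cs K) (by simp [signChar])
        (fun g => congrFun hsgn g)).2
      refine eq_zero_of_span (by rw [cellIdeal, hI]) f ?_
      rintro _ ⟨v, hv, rfl⟩ h
      obtain ⟨a, k, hk, rfl⟩ := exists_altProd cs v
      rcases k with _ | k
      · simp at hv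
      -- If `v` starts with `a`, then `s_a C_v = C_v`; the sign representation turns this into `f
      -- (C_v) = -f (C_v)`.
      have h1 := hint (cs.simple a) ⟨_, h⟩ ⟨_, h⟩
        (groupGen_mul_klGroupElement cs K a (by omega)).symm
      rw [hρ1, signChar, cs.length_simple, pow_one, LinearMap.smul_apply, neg_smul, one_smul,
        Module.End.one_apply, eq_neg_iff_add_eq_zero, ← two_smul K, smul_eq_zero] at h1
      exact h1.resolve_left two_ne_zero
  · rintro ⟨⟨d, ρ, hρ, rfl⟩, htriv, hsgn⟩
    obtain ⟨hnt, -⟩ := (isIrreducible_iff ρ).1 hρ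
    -- A vector not negated by some `s_i` makes the orbit map `z ↦ ρ(z) v` nonzero on `s_i + 1`,
    -- which lies in `ker ε`.
    obtain ⟨v, i, hvi⟩ : ∃ v i, ρ (cs.simple i) v ≠ signHom cs K (cs.simple i) • v := by
      by_contra hcon
      push Not at hcon
      obtain ⟨v, hv⟩ := exists_ne (0 : Fin d → K)
      apply hsgn
      ext g
      rw [(eq_one_of_eigenvector hρ hv (rep_eq_of_simple cs ρ (signHom cs K) (hcon v))).2,
        signHom_apply]
    let F : MonoidAlgebra K W →ₗ[K] (Fin d → K) :=
      (LinearMap.applyₗ v) ∘ₗ ρ.asAlgebraHom.toLinearMap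
    have hF : ∀ g z, F (MonoidAlgebra.single g 1 * z) = ρ g (F z) := by
      intro g z
      simp [F]
    have hF1 : F 1 = v := by simp [F]
    refine ⟨d, ρ, hρ, rfl, F ∘ₗ (cellIdeal cs K (dihedralKL cs) w).subtype, fun h0 => hvi ?_,
      fun g z z' h => ?_, fun z hz => ?_⟩
    · have hks : (MonoidAlgebra.single (cs.simple i) 1 * 1 + 1 : MonoidAlgebra K W) ∈
          cellIdeal cs K (dihedralKL cs) w := by
        rw [hmem, map_add, map_mul, groupAlgChar_single, signHom_simple]; simp
      have h1 := LinearMap.congr_fun h0 ⟨_, hks⟩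
      simp only [LinearMap.comp_apply, Submodule.subtype_apply, map_add, LinearMap.zero_apply] at h1
      rw [hF, hF1] at h1
      rw [signHom_simple, neg_smul, one_smul]
      exact eq_neg_of_add_eq_zero_left h1
    · simp only [LinearMap.comp_apply, Submodule.subtype_apply, h, hF]
    · obtain ⟨c, hc⟩ := Submodule.mem_span_singleton.1 ((hstrict _).1 hz)
      simp only [LinearMap.comp_apply, Submodule.subtype_apply, ← hc, map_smul]
      by_contra hne0
      apply htriv
      -- The image of `C_{w₀}` is an invariant vector; were it nonzero, `ρ` would be trivial.
      have hu0 : F (klGroupElement K (dihedralKL cs) (longestElt cs)) ≠ 0 := by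
        intro h; rw [h, smul_zero] at hne0; exact hne0 rfl
      ext g
      rw [(eq_one_of_eigenvector (χ := trivialChar K W) hρ hu0 fun g => ?_).2]
      rw [← hF, single_mul_longest, trivialChar, one_smul]

/-- Lusztig's families for a dihedral group. -/
theorem lusztigFamilies_dihedral [CharZero K] (hm : 1 ≤ m) : lusztigFamilies cs K =
    {{trivialChar K W}, {signChar cs K},
      {φ | φ ∈ irrGroup K W ∧ φ ≠ trivialChar K W ∧ φ ≠ signChar cs K}} := by
  ext F
  simp only [Set.mem_insert_iff, Set.mem_singleton_iff]
  constructor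
  · rintro ⟨P, hP, w, rfl⟩
    obtain rfl := hP.eq_dihedralKL cs
    by_cases h1 : w = 1
    · rw [h1, cellFamily_one cs K hm]; tauto
    by_cases h0 : w = longestElt cs
    · rw [h0, cellFamily_longestElt cs K hm]; tauto
    · rw [cellFamily_middle cs K hm h1 h0]; tauto
  · rintro (rfl | rfl | rfl)
    · exact ⟨_, isKazhdanLusztig_dihedralKL cs, longestElt cs,
        (cellFamily_longestElt cs K hm).symm⟩
    · exact ⟨_, isKazhdanLusztig_dihedralKL cs, 1, (cellFamily_one cs K hm).symm⟩
    · exact ⟨_, isKazhdanLusztig_dihedralKL cs, altProd cs.simple 0 1,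
        (cellFamily_middle cs K hm (altProd_ne_one cs 0 (by omega))
          (altProd_ne_longestElt cs 0 (by omega))).symm⟩

end Families

end HeckeFamilies

end

noncomputable section

namespace HeckeFamilies

/-! ### Two-dimensional representations and their parameters -/

section TwoDimensional

/-- The two-dimensional matrices solving the quadratic relations. -/
def dihMat {S : Type*} [CommRing S] (Q α : S) (i : Fin 2) : Matrix (Fin 2) (Fin 2) S :=
  if i = 0 then !![Q, α; 0, -1] else !![-1, 0; 1, Q]

/-- The sequence governing the braid relation for `dihMat`. -/
def braidSeq {S : Type*} [CommRing S] (Q α : S) : ℕ → S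
  | 0 => 0
  | 1 => 1
  | k + 2 => (if Even k then 1 else α) * braidSeq Q α (k + 1) - Q * braidSeq Q α k

section CommRing

variable {A S S' : Type*} [CommRing A] [CommRing S] [CommRing S'] [Algebra A S]

@[simp] lemma dihMat_zero (Q α : S) : dihMat Q α 0 = !![Q, α; 0, -1] := rfl

@[simp] lemma dihMat_one (Q α : S) : dihMat Q α 1 = !![-1, 0; 1, Q] := rfl

lemma map_dihMat (f : S →+* S') (Q α : S) (i : Fin 2) :
    (dihMat Q α i).map f = dihMat (f Q) (f α) i := by
  ext a b
  fin_cases i <;> fin_cases a <;> fin_cases b <;> simp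

lemma map_braidSeq (f : S →+* S') (Q α : S) (k : ℕ) :
    f (braidSeq Q α k) = braidSeq (f Q) (f α) k := by
  induction k using Nat.twoStepInduction with
  | zero => simp [braidSeq]
  | one => simp [braidSeq]
  | more k h0 h1 =>
    rw [braidSeq, braidSeq, map_sub, map_mul, map_mul, h0, h1]
    split_ifs <;> simp

lemma dihMat_quadratic (q : A) (α : S) (i : Fin 2) :
    IsQuadratic q (dihMat (algebraMap A S q) α i) := by
  rw [IsQuadratic, Matrix.algebraMap_eq_diagonal]
  ext a b
  fin_cases i <;> fin_cases a <;> fin_cases b <;>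
    simp [Matrix.mul_apply, Matrix.one_apply, Matrix.diagonal_apply]

/-- Each Kazhdan–Lusztig element acts as a scalar times a matrix depending only on the parity of the
length and supported on the row of its first letter. The recursion `add_one_mul_altKL` becomes the
recursion defining `braidSeq`. -/
lemma altKL_dihMat (q : A) (α : S) (k : ℕ) :
    altKL (dihMat (algebraMap A S q) α) 0 k = braidSeq (algebraMap A S q) α k •
        (if Even k then !![α, α * (1 + algebraMap A S q); 0, 0]
          else !![1 + algebraMap A S q, α; 0, 0]) ∧
      altKL (dihMat (algebraMap A S q) α) 1 k = braidSeq (algebraMap A S q) α k •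
        (if Even k then !![0, 0; 1 + algebraMap A S q, α]
          else !![0, 0; 1, 1 + algebraMap A S q]) := by
  set Q := algebraMap A S q with hQ
  induction k using Nat.twoStepInduction with
  | zero => simp [braidSeq]
  | one =>
    constructor <;> ext a b <;> fin_cases a <;> fin_cases b <;>
      simp [braidSeq, add_comm]
  | more k h0 h1 =>
    have e0 := add_one_mul_altKL (t := dihMat Q α) (dihMat_quadratic q α) 0 k
    have e1 := add_one_mul_altKL (t := dihMat Q α) (dihMat_quadratic q α) 1 k
    rw [show (0 : Fin 2) + 1 = 1 from rfl, h1.2, h0.1] at e0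
    rw [show (1 : Fin 2) + 1 = 0 from rfl, h1.1, h0.2] at e1
    rw [eq_sub_of_add_eq e0.symm, eq_sub_of_add_eq e1.symm, braidSeq]
    have hs : ∀ M : Matrix (Fin 2) (Fin 2) S, q • M = Q • M := fun M => by
      rw [hQ, algebraMap_smul]
    rw [hs, hs]
    by_cases hk : Even k
    · have h2 : ¬ Even (k + 1) := by rw [Nat.even_add_one]; simpa using hk
      have h3 : Even (k + 2) := by rw [Nat.even_add_one]; exact h2
      simp only [hk, h2, h3, if_true, if_false]
      constructor <;> ext a b <;> fin_cases a <;> fin_cases b <;>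
        simp [Matrix.mul_apply, Matrix.one_apply] <;> ring
    · have h2 : Even (k + 1) := by rw [Nat.even_add_one]; exact hk
      have h3 : ¬ Even (k + 2) := by rw [Nat.even_add_one]; simpa using h2
      simp only [hk, h2, h3, if_true, if_false]
      constructor <;> ext a b <;> fin_cases a <;> fin_cases b <;>
        simp [Matrix.mul_apply, Matrix.one_apply] <;> ring

lemma dihMat_isHecke {n : ℕ} {q : A} {α : S} (h : braidSeq (algebraMap A S q) α n = 0) :
    IsHecke n q (dihMat (algebraMap A S q) α) where
  quadratic := dihMat_quadratic q α
  braid := by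
    rw [← altKL_eq_iff, (altKL_dihMat q α n).1, (altKL_dihMat q α n).2, h, zero_smul, zero_smul]

/-- The matrices for the two first letters sit in different rows, so equality forces each to vanish.
One entry of the fixed matrix is `1 + q`, up to no further factor, and it cancels. -/
lemma braidSeq_eq_zero_of_isHecke [IsDomain S] {n : ℕ} {q : A} {α : S}
    (hq : 1 + algebraMap A S q ≠ 0) (h : IsHecke n q (dihMat (algebraMap A S q) α)) :
    braidSeq (algebraMap A S q) α n = 0 := by
  have h1 := (altKL_eq_iff _ _).2 h.braid
  rw [(altKL_dihMat q α n).1, (altKL_dihMat q α n).2] at h1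
  by_cases hn : Even n
  · have := congrFun (congrFun h1 1) 0
    simp [hn] at this
    exact this.resolve_right hq
  · have := congrFun (congrFun h1 0) 0
    simp [hn] at this
    exact this.resolve_right hq

/-- With `α = Q (2 + ξ + ξ⁻¹)` the recursion is of Chebyshev type and is solved by powers of `ξ`.
The denominators `ξ - ξ⁻¹` and `Q` are multiplied out, so the identities hold in any commutative
ring. -/
lemma braidSeq_formula {Q ξ ξ' : S} (h : ξ * ξ' = 1) (k : ℕ) :
    braidSeq Q (Q * (2 + (ξ + ξ'))) (2 * k) * (Q * (ξ - ξ')) = Q ^ k * (ξ ^ k - ξ' ^ k) ∧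
      braidSeq Q (Q * (2 + (ξ + ξ'))) (2 * k + 1) * (ξ - ξ') =
        Q ^ k * (ξ ^ (k + 1) - ξ' ^ k) * (1 + ξ') := by
  induction k with
  | zero =>
    simp only [braidSeq, zero_add, pow_zero, pow_one]
    constructor
    · ring
    · linear_combination -h
  | succ k ih =>
    have h2 : ¬ Even (2 * k + 1) := by simp
    obtain ⟨i1, i2⟩ := ih
    have e1 : braidSeq Q (Q * (2 + (ξ + ξ'))) (2 * (k + 1)) * (Q * (ξ - ξ')) =
        Q ^ (k + 1) * (ξ ^ (k + 1) - ξ' ^ (k + 1)) := by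
      rw [show 2 * (k + 1) = 2 * k + 2 by ring, braidSeq, if_pos (by simp)]
      linear_combination Q * i2 - Q * i1 + Q ^ (k + 1) * ξ ^ k * h
    refine ⟨e1, ?_⟩
    rw [show 2 * (k + 1) + 1 = (2 * k + 1) + 2 by ring, braidSeq, if_neg h2]
    rw [show 2 * (k + 1) = 2 * k + 1 + 1 by ring] at e1
    have h3 : Q * (2 + (ξ + ξ')) = Q * ((1 + ξ) * (1 + ξ')) := by linear_combination -Q * h
    have hp : ξ * ξ' ^ (k + 1) = ξ' ^ k := by rw [pow_succ']; linear_combination ξ' ^ k * h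
    linear_combination (2 + (ξ + ξ')) * e1 - Q * i2 +
      Q ^ (k + 1) * (- (ξ ^ (k + 1) - ξ' ^ (k + 1))) * h - Q ^ (k + 1) * (1 + ξ') * hp

/-- The case `ξ = 1`, where the general closed form degenerates to `0 = 0`. -/
lemma braidSeq_formula_one (Q : S) (k : ℕ) :
    braidSeq Q (Q * (2 + 2)) (2 * k) * Q = Q ^ k * k ∧
      braidSeq Q (Q * (2 + 2)) (2 * k + 1) = Q ^ k * (2 * k + 1) := by
  induction k with
  | zero => simp [braidSeq]
  | succ k ih =>
    have h2 : ¬ Even (2 * k + 1) := by simp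
    obtain ⟨i1, i2⟩ := ih
    have e1 : braidSeq Q (Q * (2 + 2)) (2 * (k + 1)) * Q = Q ^ (k + 1) * ((k + 1 : ℕ) : S) := by
      rw [show 2 * (k + 1) = 2 * k + 2 by ring, braidSeq, if_pos (by simp)]
      push_cast
      linear_combination Q * i2 - Q * i1
    refine ⟨e1, ?_⟩
    rw [show 2 * (k + 1) + 1 = (2 * k + 1) + 2 by ring, braidSeq, if_neg h2]
    rw [show 2 * (k + 1) = 2 * k + 1 + 1 by ring] at e1
    push_cast at e1 ⊢
    linear_combination 4 * e1 - Q * i2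

end CommRing

section Field

variable {L : Type*} [Field L]

lemma braidSeq_eq_zero_iff {Q ξ : L} (hQ : Q ≠ 0) (h0 : ξ ≠ 0) (h1 : ξ ≠ 1) (h2 : ξ ≠ -1) (n : ℕ) :
    braidSeq Q (Q * (2 + (ξ + ξ⁻¹))) n = 0 ↔ ξ ^ n = 1 := by
  have hξ : ξ - ξ⁻¹ ≠ 0 := by
    intro h
    have : ξ * ξ = 1 := by
      rw [sub_eq_zero] at h
      nth_rewrite 2 [h]
      exact mul_inv_cancel₀ h0
    rcases mul_self_eq_one_iff.1 this with h | h
    · exact h1 h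
    · exact h2 h
  have hξ' : 1 + ξ⁻¹ ≠ 0 := by
    intro h
    have h3 : ξ⁻¹ = -1 := by linear_combination h
    apply h2
    rw [← inv_inv ξ, h3, inv_neg, inv_one]
  rcases Nat.even_or_odd' n with ⟨k, rfl | rfl⟩
  · have h := (braidSeq_formula (Q := Q) (mul_inv_cancel₀ h0) k).1
    rw [← mul_left_inj' (mul_ne_zero hQ hξ), h, zero_mul, mul_eq_zero, sub_eq_zero,
      or_iff_right (pow_ne_zero k hQ), inv_pow, ← mul_eq_one_iff_eq_inv₀ (pow_ne_zero k h0),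
      two_mul, pow_add]
  · have h := (braidSeq_formula (Q := Q) (mul_inv_cancel₀ h0) k).2
    rw [← mul_left_inj' hξ, h, zero_mul, mul_eq_zero, or_iff_left hξ', mul_eq_zero, sub_eq_zero,
      or_iff_right (pow_ne_zero k hQ), inv_pow, ← mul_eq_one_iff_eq_inv₀ (pow_ne_zero k h0),
      ← pow_add]
    rw [show k + 1 + k = 2 * k + 1 by ring]

/-- In characteristic zero this excludes the parameter `c = 2`, that is `ξ = 1`. -/
lemma braidSeq_two_ne_zero [CharZero L] {Q : L} (hQ : Q ≠ 0) {n : ℕ} (hn : n ≠ 0) :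
    braidSeq Q (Q * (2 + 2)) n ≠ 0 := by
  rcases Nat.even_or_odd' n with ⟨k, rfl | rfl⟩
  · intro h
    have h1 := (braidSeq_formula_one Q k).1
    rw [h, zero_mul] at h1
    have hk : (k : L) ≠ 0 := Nat.cast_ne_zero.2 (by omega)
    exact mul_ne_zero (pow_ne_zero k hQ) hk h1.symm
  · rw [(braidSeq_formula_one Q k).2]
    refine mul_ne_zero (pow_ne_zero k hQ) ?_
    exact_mod_cast Nat.succ_ne_zero (2 * k)

variable {K : Type*} [Field K]

/-- `c = ξ + ξ⁻¹` for some `n`-th root of unity `ξ ≠ ±1`. -/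
def IsDihedralParam (n : ℕ) (c : K) : Prop :=
  ∃ ξ : AlgebraicClosure K, ξ ^ n = 1 ∧ ξ ≠ 1 ∧ ξ ≠ -1 ∧
    algebraMap K (AlgebraicClosure K) c = ξ + ξ⁻¹

lemma exists_add_inv_eq {L : Type*} [Field L] [IsAlgClosed L] (c : L) :
    ∃ ξ : L, ξ ≠ 0 ∧ c = ξ + ξ⁻¹ := by
  obtain ⟨ξ, hξ⟩ := IsAlgClosed.exists_root
    (Polynomial.X ^ 2 - Polynomial.C c * Polynomial.X + 1 : L[X]) (by
      have : (Polynomial.X ^ 2 - Polynomial.C c * Polynomial.X + 1 : L[X]).degree = 2 := by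
        compute_degree!
      rw [this]; decide)
  have h : ξ ^ 2 - c * ξ + 1 = 0 := by simpa [Polynomial.IsRoot] using hξ
  have h0 : ξ ≠ 0 := by rintro rfl; simp at h
  refine ⟨ξ, h0, ?_⟩
  field_simp
  linear_combination -h

lemma IsDihedralParam.braidSeq_eq_zero {n : ℕ} {c : K} (hn : n ≠ 0) (h : IsDihedralParam n c)
    {Q : K} (hQ : Q ≠ 0) : braidSeq Q (Q * (2 + c)) n = 0 := by
  obtain ⟨ξ, hξ, h1, h2, hc⟩ := h
  have h0 : ξ ≠ 0 := by
    rintro rfl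
    rw [zero_pow hn] at hξ
    exact zero_ne_one hξ
  apply (algebraMap K (AlgebraicClosure K)).injective
  rw [map_braidSeq, map_zero, map_mul, map_add, hc, map_ofNat,
    braidSeq_eq_zero_iff ((map_ne_zero _).2 hQ) h0 h1 h2, hξ]

lemma isDihedralParam_of_braidSeq [CharZero K] {n : ℕ} {c : K} (hn : n ≠ 0) {Q : K} (hQ : Q ≠ 0)
    (hc : c ≠ -2) (h : braidSeq Q (Q * (2 + c)) n = 0) : IsDihedralParam n c := by
  obtain ⟨ξ, h0, hξ⟩ := exists_add_inv_eq (algebraMap K (AlgebraicClosure K) c)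
  have hQ' := (map_ne_zero (algebraMap K (AlgebraicClosure K))).2 hQ
  have h' := congrArg (algebraMap K (AlgebraicClosure K)) h
  rw [map_braidSeq, map_zero, map_mul, map_add, map_ofNat, hξ] at h'
  have h1 : ξ ≠ 1 := by
    rintro rfl
    rw [inv_one, one_add_one_eq_two] at h'
    have : CharZero (AlgebraicClosure K) :=
      charZero_of_injective_algebraMap (algebraMap K (AlgebraicClosure K)).injective
    exact braidSeq_two_ne_zero hQ' hn h'
  have h2 : ξ ≠ -1 := by
    rintro rfl
    apply hc
    apply (algebraMap K (AlgebraicClosure K)).injective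
    rw [hξ, map_neg, map_ofNat, inv_neg, inv_one]
    norm_num
  exact ⟨ξ, (braidSeq_eq_zero_iff hQ' h0 h1 h2 n).1 h', h1, h2, hξ⟩

lemma IsDihedralParam.ne_neg_two {n : ℕ} {c : K} (h : IsDihedralParam n c) (hn : n ≠ 0) :
    2 + c ≠ 0 := by
  obtain ⟨ξ, hξ, h1, h2, hc⟩ := h
  have h0 : ξ ≠ 0 := by
    rintro rfl
    rw [zero_pow hn] at hξ
    exact zero_ne_one hξ
  intro h
  have h3 := congrArg (algebraMap K (AlgebraicClosure K)) h
  rw [map_add, hc, map_ofNat, map_zero] at h3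
  have h4 : (ξ + 1) ^ 2 = 0 := by
    field_simp at h3
    linear_combination h3
  apply h2
  have := pow_eq_zero_iff two_ne_zero |>.1 h4
  linear_combination this

end Field

/-! ### Classification of irreducible representations -/

section Classification

variable {K V : Type*} [Field K] [AddCommGroup V] [Module K V] {n : ℕ} {q : K}
  {t : Fin 2 → Module.End K V}

/-- The quadratic relations alone make `(t 0 - t 1)²` commute with both generators: its only mixed
part is `-(t 0 t 1 + t 1 t 0)`, and moving `t i` across yields the same expansion on both sides. On
an irreducible representation its eigenvalue determines the parameter `c`. -/
lemma sq_sub_comm {R : Type*} [Ring R] [Algebra K R] {t : Fin 2 → R}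
    (h : ∀ i, IsQuadratic q (t i)) (i : Fin 2) :
    (t 0 - t 1) * (t 0 - t 1) * t i = t i * ((t 0 - t 1) * (t 0 - t 1)) := by
  have h0 := (h 0).mul_self
  have h1 := (h 1).mul_self
  have e0 : t 0 * (t 0 * t 1) = (q - 1) • (t 0 * t 1) + q • t 1 := by
    rw [← mul_assoc, h0]; simp [add_mul]
  have e1 : t 1 * (t 1 * t 0) = (q - 1) • (t 1 * t 0) + q • t 0 := by
    rw [← mul_assoc, h1]; simp [add_mul]
  have hz : (t 0 - t 1) * (t 0 - t 1) = (q - 1) • t 0 + q • 1 + ((q - 1) • t 1 + q • 1)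
      - t 0 * t 1 - t 1 * t 0 := by
    rw [← h0, ← h1]; noncomm_ring
  rw [hz]
  rcases fin_two_eq_or 0 i with rfl | rfl
  · simp only [sub_mul, add_mul, mul_sub, mul_add, smul_mul_assoc, mul_smul_comm, one_mul, mul_one,
      mul_assoc, h0, e0, smul_add]
    abel
  · simp only [zero_add, sub_mul, add_mul, mul_sub, mul_add, smul_mul_assoc, mul_smul_comm, one_mul,
      mul_one, mul_assoc, h1, e1, smul_add]
    abel

lemma scalar_of_eigenvector (hirr : ∀ U : Submodule K V, (∀ i, ∀ u ∈ U, t i u ∈ U) → U = ⊥ ∨ U = ⊤)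
    (h : ∀ i, IsQuadratic q (t i)) {v : V} (hv : v ≠ 0) {a : Fin 2 → K}
    (ha : ∀ i, t i v = a i • v) :
    Module.finrank K V = 1 ∧ ∀ i, t i = a i • 1 ∧ (a i = q ∨ a i = -1) := by
  have htop : K ∙ v = ⊤ := by
    refine (hirr (K ∙ v) fun g u hu => ?_).resolve_left (by simpa using hv)
    obtain ⟨c, rfl⟩ := Submodule.mem_span_singleton.1 hu
    rw [map_smul, ha, smul_smul]
    exact Submodule.smul_mem _ _ (Submodule.mem_span_singleton_self v)
  refine ⟨?_, fun i => ⟨?_, ?_⟩⟩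
  · have := finrank_span_singleton (K := K) hv
    rwa [htop, finrank_top] at this
  · refine LinearMap.ext fun u => ?_
    have hu : u ∈ K ∙ v := by rw [htop]; trivial
    obtain ⟨c, rfl⟩ := Submodule.mem_span_singleton.1 hu
    rw [map_smul, ha]
    simp [smul_comm c]
  · have h1 := LinearMap.congr_fun (h i) v
    simp only [Module.End.mul_apply, LinearMap.add_apply, LinearMap.sub_apply, ha,
      Module.End.one_apply, map_add, map_smul, Module.algebraMap_end_apply,
      LinearMap.zero_apply] at h1
    have h2 : ((a i - q) * (a i + 1)) • v = 0 := by rw [← h1]; module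
    rcases mul_eq_zero.1 ((smul_eq_zero.1 h2).resolve_right hv) with h3 | h3
    · exact Or.inl (sub_eq_zero.1 h3)
    · exact Or.inr (eq_neg_of_add_eq_zero_left h3)

/-- Classification of the irreducible representations of the dihedral Hecke algebra. -/
lemma classify_irreducible [CharZero K] [Nontrivial V] (hn : n ≠ 0) (hq : q ≠ 0) (hq1 : 1 + q ≠ 0)
    (hirr : ∀ U : Submodule K V, (∀ i, ∀ u ∈ U, t i u ∈ U) → U = ⊥ ∨ U = ⊤)
    (h : IsHecke n q t) {μ : K}
    (hμ : ((t 0 - t 1) * (t 0 - t 1)).HasEigenvalue μ) :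
    (∃ a : Fin 2 → K, Module.finrank K V = 1 ∧ ∀ i, t i = a i • 1 ∧ (a i = q ∨ a i = -1)) ∨
    ∃ c : K, IsDihedralParam n c ∧ ∃ b : Module.Basis (Fin 2) K V, ∀ i,
      LinearMap.toMatrixAlgEquiv b (t i) = dihMat q (q * (2 + c)) i := by
  by_cases hE : ∃ v ≠ 0, ∃ a : Fin 2 → K, ∀ i, t i v = a i • v
  · obtain ⟨v, hv, a, ha⟩ := hE
    exact Or.inl ⟨a, scalar_of_eigenvector hirr h.quadratic hv ha⟩
  right
  -- The eigenspace of a central element is an invariant subspace, hence everything.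
  have hz : (t 0 - t 1) * (t 0 - t 1) = μ • 1 := by
    have htop : ((t 0 - t 1) * (t 0 - t 1)).eigenspace μ = ⊤ := by
      refine (hirr _ fun i u hu => ?_).resolve_left hμ
      rw [Module.End.mem_eigenspace_iff] at hu ⊢
      rw [← Module.End.mul_apply, sq_sub_comm h.quadratic, Module.End.mul_apply, hu, map_smul]
    refine LinearMap.ext fun u => ?_
    have : u ∈ ((t 0 - t 1) * (t 0 - t 1)).eigenspace μ := by rw [htop]; trivial
    rw [Module.End.mem_eigenspace_iff.1 this]; simp
  have hCv : ∀ i u, t i ((t i + 1) u) = q • (t i + 1) u := fun i u => by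
    rw [← Module.End.mul_apply, (h.quadratic i).mul_add_one, LinearMap.smul_apply]
  -- If `t 0 = -1`, a common eigenvector exists: any vector if `t 1 = -1` too, otherwise any nonzero
  -- vector in the image of `t 1 + 1`.
  have hC0 : t 0 + 1 ≠ 0 := by
    intro h0
    apply hE
    have ht0 : ∀ u, t 0 u = (-1 : K) • u := fun u => by
      rw [eq_neg_of_add_eq_zero_left h0]; simp
    by_cases h1 : t 1 + 1 = 0
    · obtain ⟨v, hv⟩ := exists_ne (0 : V)
      refine ⟨v, hv, fun _ => -1, fun i => ?_⟩
      rcases fin_two_eq_or 0 i with rfl | rfl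
      · exact ht0 v
      · rw [zero_add, eq_neg_of_add_eq_zero_left h1]; simp
    · obtain ⟨u, hu⟩ : ∃ u, (t 1 + 1) u ≠ 0 := by
        by_contra hcon
        push Not at hcon
        exact h1 (LinearMap.ext hcon)
      refine ⟨_, hu, fun i => if i = 0 then -1 else q, fun i => ?_⟩
      rcases fin_two_eq_or 0 i with rfl | rfl
      · exact ht0 _
      · exact hCv 1 u
  obtain ⟨u, hu⟩ : ∃ u, (t 0 + 1) u ≠ 0 := by
    by_contra hcon
    push Not at hcon
    exact hC0 (LinearMap.ext hcon)
  set v := (t 0 + 1) u with hv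
  have h0v : t 0 v = q • v := hCv 0 u
  set w := (t 1 + 1) v with hw
  have h1v : t 1 v = w - v := by rw [hw]; simp
  have h1w : t 1 w = q • w := hCv 1 v
  -- Solves `μ = 1 + q² - q c`, the value of `(t 0 - t 1)²` in the model matrices.
  set c := (1 + q ^ 2 - μ) / q with hc
  have hqc : q * c = 1 + q ^ 2 - μ := by rw [hc]; field_simp
  have h0w : t 0 w = (q * (2 + c)) • v - w := by
    have h1 := LinearMap.congr_fun hz v
    simp only [Module.End.mul_apply, LinearMap.sub_apply, map_sub, h0v, h1v, h1w, map_smul,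
      LinearMap.smul_apply, Module.End.one_apply] at h1
    have h2 : t 0 w = (q * q + 2 * q + 1 - μ) • v - w := by
      linear_combination (norm := module) (-1 : K) • h1
    rw [h2, mul_add, hqc]
    congr 2
    ring
  -- If `w` were a multiple of `v`, then `v` would be a common eigenvector.
  have hind : LinearIndependent K ![v, w] := by
    rw [LinearIndependent.pair_iff' hu]
    intro a haw
    apply hE
    refine ⟨v, hu, fun i => if i = 0 then q else a - 1, fun i => ?_⟩
    rcases fin_two_eq_or 0 i with rfl | rfl
    · exact h0v
    · rw [zero_add, h1v, ← haw]; simp [sub_smul]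
  have hspan : ⊤ ≤ Submodule.span K (Set.range ![v, w]) := by
    refine ((hirr _ fun i z hz => ?_).resolve_left fun hbot => hu ?_).ge
    · rw [Matrix.range_cons, Matrix.range_cons, Matrix.range_empty, Set.union_empty,
        Set.singleton_union, Submodule.mem_span_pair] at hz ⊢
      obtain ⟨a, b, rfl⟩ := hz
      rcases fin_two_eq_or 0 i with rfl | rfl
      · refine ⟨a * q + b * (q * (2 + c)), -b, ?_⟩
        rw [map_add, map_smul, map_smul, h0v, h0w]; module
      · refine ⟨-a, a + b * q, ?_⟩
        rw [zero_add, map_add, map_smul, map_smul, h1v, h1w]; module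
    · have : v ∈ Submodule.span K (Set.range ![v, w]) := Submodule.subset_span ⟨0, rfl⟩
      rwa [hbot, Submodule.mem_bot] at this
  let b := Module.Basis.mk hind hspan
  have hb0 : b 0 = v := by simp [b]
  have hb1 : b 1 = w := by simp [b]
  have hmat : ∀ i, LinearMap.toMatrixAlgEquiv b (t i) = dihMat q (q * (2 + c)) i := by
    intro i
    have hrepr0 : b.repr v = Finsupp.single 0 1 := by rw [← hb0, Module.Basis.repr_self]
    have hrepr1 : b.repr w = Finsupp.single 1 1 := by rw [← hb1, Module.Basis.repr_self]
    ext x y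
    rw [LinearMap.toMatrixAlgEquiv_apply]
    rcases fin_two_eq_or 0 i with rfl | rfl <;> rcases fin_two_eq_or 0 y with rfl | rfl
    · rw [hb0, h0v, map_smul, hrepr0]; fin_cases x <;> simp
    · rw [zero_add, hb1, h0w, map_sub, map_smul, hrepr0, hrepr1]; fin_cases x <;> simp
    · rw [zero_add, hb0, h1v, map_sub, hrepr0, hrepr1]; fin_cases x <;> simp
    · rw [zero_add, hb1, h1w, map_smul, hrepr1]; fin_cases x <;> simp
  refine ⟨c, ?_, b, hmat⟩
  -- For `c = -2` the representation is triangular, with `w` as common eigenvector.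
  have hc2 : c ≠ -2 := by
    intro hc2
    apply hE
    have hw0 : w ≠ 0 := by rw [← hb1]; exact b.ne_zero 1
    refine ⟨w, hw0, fun i => if i = 0 then -1 else q, fun i => ?_⟩
    rcases fin_two_eq_or 0 i with rfl | rfl
    · rw [h0w, hc2]; simp
    · exact h1w
  have hH := h.map (LinearMap.toMatrixAlgEquiv b).toAlgHom
  have hH' : IsHecke n q (dihMat (algebraMap K K q) (q * (2 + c))) := by
    have : (fun i => (LinearMap.toMatrixAlgEquiv b).toAlgHom (t i)) =
        dihMat (algebraMap K K q) (q * (2 + c)) := funext hmat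
    rwa [this] at hH
  exact isDihedralParam_of_braidSeq hn hq hc2 (braidSeq_eq_zero_of_isHecke hq1 hH')

end Classification

end TwoDimensional

/-! ### Eigenvalues of central elements in split algebras -/

section SplitSemisimple

open Polynomial in
-- In each matrix factor a central element is a scalar from `K`, and the product of the
-- corresponding linear polynomials kills it. Splitness is used through this fact to keep
-- eigenvalues inside `K`.
lemma IsSplitSemisimple.exists_aeval_eq_zero {K R : Type*} [Field K] [Ring R] [Algebra K R]
    (h : IsSplitSemisimple K R) {z : R} (hz : ∀ r, z * r = r * z) :
    ∃ (m : ℕ) (c : Fin m → K), aeval z (∏ i, (X - C (c i))) = 0 := by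
  obtain ⟨m, d, ⟨e⟩⟩ := h
  have hcen : ∀ i, ∃ c : K, e z i = Matrix.scalar (Fin (d i)) c := by
    intro i
    have h1 : ∀ M : Matrix (Fin (d i)) (Fin (d i)) K, Commute (e z i) M := by
      intro M
      have h2 := hz (e.symm (Pi.single i M))
      have h3 := congrFun (congrArg e h2) i
      rw [map_mul, map_mul, AlgEquiv.apply_symm_apply, Pi.mul_apply, Pi.mul_apply,
        Pi.single_eq_same] at h3
      exact h3
    have h4 := Matrix.mem_range_scalar_of_commute_single (M := e z i) fun a b _ => (h1 _).symm
    obtain ⟨c, hc⟩ := h4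
    exact ⟨c, hc.symm⟩
  choose c hc using hcen
  refine ⟨m, c, e.injective ?_⟩
  rw [map_zero]
  ext1 i
  have h5 : e (aeval z (∏ i, (X - C (c i)))) i = aeval (e z i) (∏ i, (X - C (c i))) := by
    have := Polynomial.aeval_algHom_apply ((Pi.evalAlgHom K _ i).comp e.toAlgHom) z
      (∏ i, (X - C (c i)))
    exact this.symm
  rw [h5, ← Finset.mul_prod_erase _ _ (Finset.mem_univ i), map_mul, map_sub, aeval_X, aeval_C, hc]
  have : algebraMap K (Matrix (Fin (d i)) (Fin (d i)) K) (c i) = Matrix.scalar (Fin (d i)) (c i) :=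
    rfl
  rw [this, sub_self, zero_mul]; rfl

open Polynomial in
-- Without eigenvalues every factor `f - c i` would be injective, and so would their product, which
-- is zero.
lemma exists_hasEigenvalue_of_aeval_prod {K V : Type*} [Field K] [AddCommGroup V] [Module K V]
    [Nontrivial V] {f : Module.End K V} {m : ℕ} {c : Fin m → K}
    (h : aeval f (∏ i, (X - C (c i))) = 0) : ∃ μ, f.HasEigenvalue μ := by
  by_contra hcon
  push Not at hcon
  have hinj : ∀ s : Finset (Fin m), Function.Injective (aeval f (∏ i ∈ s, (X - C (c i)))) := by
    classical
    intro s
    induction s using Finset.induction_on with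
    | empty => exact fun a b h => by simpa using h
    | insert a s ha ih =>
      rw [Finset.prod_insert ha, map_mul, Module.End.coe_mul]
      refine Function.Injective.comp ?_ ih
      rw [map_sub, aeval_X, aeval_C, ← LinearMap.ker_eq_bot]
      have := hcon (c a)
      rw [Module.End.hasEigenvalue_iff, not_not, Module.End.eigenspace_def] at this
      exact this
  obtain ⟨v, hv⟩ := exists_ne (0 : V)
  apply hv
  apply hinj Finset.univ
  rw [h]; simp

end SplitSemisimple

end HeckeFamilies

end

noncomputable section

namespace HeckeFamilies

/-! ### Chains of roots of unity of prime power order -/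

section RootsOfUnity

/-- `ξ` is killed by a power of a prime number. -/
def IsPrimePowRoot {M : Type*} [Monoid M] (ξ : M) : Prop :=
  ∃ p b : ℕ, p.Prime ∧ ξ ^ p ^ b = 1

variable {M β : Type*} [CommMonoid M] {n : ℕ} {g : M → β}

/-- If `ξ η ≠ 1`, both values equal the value at `ξ η`. If `ξ η = 1`, the two elements are killed by
the same prime power, so `ξ` can be multiplied directly by `ξ⁻¹ η`. -/
lemma eq_of_isPrimePowRoot
    (hg : ∀ ξ η : M, ξ ^ n = 1 → η ^ n = 1 → ξ ≠ 1 → ξ * η ≠ 1 → IsPrimePowRoot η →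
      g ξ = g (ξ * η)) {ξ η : M} (hξn : ξ ^ n = 1) (hηn : η ^ n = 1) (hξ : ξ ≠ 1) (hη : η ≠ 1)
    (hξp : IsPrimePowRoot ξ) (hηp : IsPrimePowRoot η) : g ξ = g η := by
  by_cases h : ξ * η = 1
  · obtain ⟨q, b, hq, hb⟩ := hξp
    have hpos : 0 < q ^ b := pow_pos hq.pos b
    have hη' : η ^ q ^ b = 1 := by
      have : (ξ * η) ^ q ^ b = 1 := by rw [h, one_pow]
      rwa [mul_pow, hb, one_mul] at this
    have e : ξ * (ξ ^ (q ^ b - 1) * η) = η := by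
      rw [← mul_assoc, ← pow_succ', Nat.sub_add_cancel hpos, hb, one_mul]
    have := hg ξ (ξ ^ (q ^ b - 1) * η) hξn
      (by rw [mul_pow, pow_right_comm, hξn, one_pow, hηn, one_mul]) hξ
      (by rwa [e]) ⟨q, b, hq, by
        rw [mul_pow, pow_right_comm, hb, one_pow, hη', one_mul]⟩
    rwa [e] at this
  · rw [hg ξ η hξn hηn hξ h hηp, mul_comm, ← hg η ξ hηn hξn hη (by rwa [mul_comm]) hξp]

/-- Induction on the order: split off the `p`-part of `ξ` for the smallest prime `p` dividing the
order. What remains is nontrivial unless `ξ` already has prime power order, and it takes the same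
value. -/
lemma exists_isPrimePowRoot (hn : n ≠ 0)
    (hg : ∀ ξ η : M, ξ ^ n = 1 → η ^ n = 1 → ξ ≠ 1 → ξ * η ≠ 1 → IsPrimePowRoot η →
      g ξ = g (ξ * η)) {ξ : M} (hξn : ξ ^ n = 1) (hξ : ξ ≠ 1) :
    ∃ η : M, η ^ n = 1 ∧ η ≠ 1 ∧ IsPrimePowRoot η ∧ g ξ = g η := by
  induction hN : orderOf ξ using Nat.strong_induction_on generalizing ξ with
  | _ N ih =>
    have hfin : 0 < orderOf ξ := orderOf_pos_iff.2 (isOfFinOrder_iff_pow_eq_one.2 ⟨n, by omega, hξn⟩)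
    have hN1 : N ≠ 1 := by rw [← hN]; exact fun h => hξ (orderOf_eq_one_iff.1 h)
    set p := N.minFac with hp
    have hpp : p.Prime := Nat.minFac_prime hN1
    obtain ⟨a, m, hm, hNm⟩ := Nat.exists_eq_pow_mul_and_not_dvd (n := N) (by omega) p hpp.ne_one
    by_cases hm1 : m = 1
    · exact ⟨ξ, hξn, hξ, ⟨p, a, hpp, by
        rw [← orderOf_dvd_iff_pow_eq_one, hN]; conv_lhs => rw [hNm, hm1, mul_one]⟩, rfl⟩
    have ha : a ≠ 0 := by
      rintro rfl
      rw [pow_zero, one_mul] at hNm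
      exact hm (hNm ▸ Nat.minFac_dvd N)
    have hcop : Nat.Coprime (p ^ a) m := ((Nat.Prime.coprime_iff_not_dvd hpp).2 hm).pow_left a
    -- By the Chinese remainder theorem `ξ = ξ ^ j * ξ ^ k`, with `ξ ^ k` killed by `p ^ a` and `ξ ^
    -- j` killed by `m`.
    obtain ⟨k, hk1, hk0⟩ := Nat.chineseRemainder hcop 1 0
    obtain ⟨j, hj0, hj1⟩ := Nat.chineseRemainder hcop 0 1
    have hkj : ξ ^ j * ξ ^ k = ξ := by
      rw [← pow_add]
      conv_rhs => rw [← pow_one ξ]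
      have hmod : j + k ≡ 1 [MOD orderOf ξ] := by
        rw [hN, hNm, ← Nat.modEq_and_modEq_iff_modEq_mul hcop]
        exact ⟨by simpa using hj0.add hk1, by simpa using hj1.add hk0⟩
      rw [← pow_mod_orderOf, hmod, pow_mod_orderOf]
    have hv : (ξ ^ j) ^ m = 1 := by
      rw [← pow_mul, ← orderOf_dvd_iff_pow_eq_one, hN, hNm]
      exact mul_dvd_mul_right ((Nat.modEq_zero_iff_dvd).1 hj0) m
    have hu : (ξ ^ k) ^ p ^ a = 1 := by
      rw [← pow_mul, ← orderOf_dvd_iff_pow_eq_one, hN, hNm, mul_comm]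
      exact mul_dvd_mul_right ((Nat.modEq_zero_iff_dvd).1 hk0) _
    have hv1 : ξ ^ j ≠ 1 := by
      intro h
      rw [← orderOf_dvd_iff_pow_eq_one, hN] at h
      have h1 : m ∣ j := (Dvd.intro_left _ hNm.symm).trans h
      have h2 : 0 ≡ 1 [MOD m] := ((Nat.modEq_zero_iff_dvd).2 h1).symm.trans hj1
      exact hm1 (Nat.dvd_one.1 ((Nat.modEq_zero_iff_dvd).1 h2.symm))
    have hlt : orderOf (ξ ^ j) < N := by
      have hm0 : 0 < m := Nat.pos_of_ne_zero (by rintro rfl; simp at hm)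
      refine lt_of_le_of_lt (orderOf_le_of_pow_eq_one hm0 hv) ?_
      conv_rhs => rw [hNm]
      have : 1 < p ^ a := Nat.one_lt_pow ha hpp.one_lt
      nlinarith
    have hvn : (ξ ^ j) ^ n = 1 := by rw [← pow_mul, mul_comm, pow_mul, hξn, one_pow]
    have hun : (ξ ^ k) ^ n = 1 := by rw [← pow_mul, mul_comm, pow_mul, hξn, one_pow]
    obtain ⟨η, h1, h2, h3, h4⟩ := ih _ hlt hvn hv1 rfl
    refine ⟨η, h1, h2, h3, ?_⟩
    rw [← h4, hg _ _ hvn hun hv1 (by rwa [hkj]) ⟨p, a, hpp, hu⟩, hkj]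

/-- A function on the nontrivial `n`-th roots of unity that is invariant under multiplication by
roots of unity of prime power order is constant. -/
lemma eq_of_invariant (hn : n ≠ 0)
    (hg : ∀ ξ η : M, ξ ^ n = 1 → η ^ n = 1 → ξ ≠ 1 → ξ * η ≠ 1 → IsPrimePowRoot η →
      g ξ = g (ξ * η)) {ξ ξ' : M} (hξn : ξ ^ n = 1) (hξ : ξ ≠ 1) (hξn' : ξ' ^ n = 1)
    (hξ' : ξ' ≠ 1) : g ξ = g ξ' := by
  obtain ⟨η, h1, h2, h3, h4⟩ := exists_isPrimePowRoot hn hg hξn hξ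
  obtain ⟨η', h1', h2', h3', h4'⟩ := exists_isPrimePowRoot hn hg hξn' hξ'
  rw [h4, h4', eq_of_isPrimePowRoot hg h1 h1' h2 h2' h3 h3']

end RootsOfUnity

/-! ### Nonunits of the ring `𝒪` -/

section Arithmetic

variable {K : Type*} [Field K] [Algebra A K]

/-- The image of `x` is an indeterminate over a field of characteristic zero; powers of `x` are
cleared to reduce to polynomials. -/
lemma algebraMap_A_injective {k : Type*} [Field k] [CharZero k] [Algebra (RatFunc k) K]
    (hx : algebraMap A K x = algebraMap (RatFunc k) K RatFunc.X) :
    Function.Injective (algebraMap A K) := by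
  have hpoly : ∀ f : ℤ[X], algebraMap A K (Polynomial.toLaurent f) = algebraMap (RatFunc k) K
      (algebraMap k[X] (RatFunc k) (f.map (Int.castRingHom k))) := by
    intro f
    have : (algebraMap A K).comp (Polynomial.toLaurent (R := ℤ)) =
        ((algebraMap (RatFunc k) K).comp (algebraMap k[X] (RatFunc k))).comp
          (Polynomial.mapRingHom (Int.castRingHom k)) := by
      refine Polynomial.ringHom_ext' (RingHom.ext_int _ _) ?_
      simp only [RingHom.comp_apply, Polynomial.toLaurent_X, Polynomial.coe_mapRingHom,
        Polynomial.map_X, RatFunc.algebraMap_X]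
      exact hx
    exact DFunLike.congr_fun this f
  rw [injective_iff_map_eq_zero]
  intro a ha
  obtain ⟨N, f, hf⟩ := LaurentPolynomial.exists_T_pow a
  have h1 : algebraMap A K (Polynomial.toLaurent f) = 0 := by rw [hf, map_mul, ha, zero_mul]
  rw [hpoly, map_eq_zero_iff _ (algebraMap (RatFunc k) K).injective,
    map_eq_zero_iff _ (RatFunc.algebraMap_injective k),
    Polynomial.map_eq_zero_iff (RingHom.injective_int _)] at h1
  rw [h1, map_zero] at hf
  exact ((LaurentPolynomial.isUnit_T N).mul_left_eq_zero).1 hf.symm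

/-- The element `1 + x P(x)` of `A`. -/
def unitPoly (P : ℤ[X]) : A := 1 + x * Polynomial.toLaurent P

lemma algebraMap_unitPoly (P : ℤ[X]) : algebraMap A K (unitPoly P) =
    1 + algebraMap A K x * Polynomial.aeval (algebraMap A K x) P := by
  have : (algebraMap A K).comp (Polynomial.toLaurent (R := ℤ)) =
      (Polynomial.aeval (R := ℤ) (algebraMap A K x)).toRingHom := by
    refine Polynomial.ringHom_ext' (RingHom.ext_int _ _) ?_
    simp [x]
  have h := DFunLike.congr_fun this P
  rw [unitPoly, map_add, map_one, map_mul]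
  congr 2

lemma unitPoly_mul (P Q : ℤ[X]) :
    unitPoly P * unitPoly Q = unitPoly (P + Q + Polynomial.X * P * Q) := by
  have : Polynomial.toLaurent (Polynomial.X : ℤ[X]) = x := Polynomial.toLaurent_X
  simp only [unitPoly, map_add, map_mul, this]
  ring

lemma inv_unitPoly_mem (P : ℤ[X]) : (algebraMap A K (unitPoly P))⁻¹ ∈ ringO K := by
  rw [algebraMap_unitPoly]
  exact (le_sup_right : _ ≤ ringO K) (Algebra.subset_adjoin ⟨P, rfl⟩)

lemma integralClosure_le_ringO : integralClosure A K ≤ ringO K := le_sup_left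

/-- Elements `1 + x P` are closed under multiplication, so elements of `K` with such a denominator
over the integral closure form a subalgebra. -/
lemma exists_unitPoly_mul_mem {o : K} (ho : o ∈ ringO K) :
    ∃ P, algebraMap A K (unitPoly P) * o ∈ integralClosure A K := by
  let S : Subalgebra A K :=
    { carrier := {o | ∃ P, algebraMap A K (unitPoly P) * o ∈ integralClosure A K}
      mul_mem' := by
        rintro a b ⟨P, hP⟩ ⟨Q, hQ⟩
        refine ⟨P + Q + Polynomial.X * P * Q, ?_⟩
        rw [← unitPoly_mul P Q, map_mul, mul_mul_mul_comm]
        exact Subalgebra.mul_mem _ hP hQ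
      add_mem' := by
        rintro a b ⟨P, hP⟩ ⟨Q, hQ⟩
        refine ⟨P + Q + Polynomial.X * P * Q, ?_⟩
        rw [← unitPoly_mul P Q, map_mul]
        have e : algebraMap A K (unitPoly P) * algebraMap A K (unitPoly Q) * (a + b) =
            algebraMap A K (unitPoly Q) * (algebraMap A K (unitPoly P) * a) +
            algebraMap A K (unitPoly P) * (algebraMap A K (unitPoly Q) * b) := by ring
        rw [e]
        exact Subalgebra.add_mem _ (Subalgebra.mul_mem _ (Subalgebra.algebraMap_mem _ _) hP)
          (Subalgebra.mul_mem _ (Subalgebra.algebraMap_mem _ _) hQ)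
      algebraMap_mem' := fun r => ⟨0, Subalgebra.mul_mem _ (Subalgebra.algebraMap_mem _ _)
        (Subalgebra.algebraMap_mem _ _)⟩ }
  have hS : ringO K ≤ S := by
    refine sup_le ?_ (Algebra.adjoin_le ?_)
    · intro b hb
      exact ⟨0, Subalgebra.mul_mem _ (Subalgebra.algebraMap_mem _ _) hb⟩
    · rintro _ ⟨P, rfl⟩
      refine ⟨P, ?_⟩
      rw [algebraMap_unitPoly]
      -- The inverse of zero is zero in `K`, and zero is integral, so no nonvanishing is needed
      -- here.
      by_cases h0 : 1 + algebraMap A K x * Polynomial.aeval (algebraMap A K x) P = 0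
      · rw [h0, zero_mul]; exact Subalgebra.zero_mem _
      · rw [mul_inv_cancel₀ h0]; exact Subalgebra.one_mem _
  exact hS ho

/-- The base change `ℤ[x, x⁻¹] → R[x, x⁻¹]`. -/
def laurentReduction (R : Type*) [CommRing R] : A →+* LaurentPolynomial R :=
  LaurentPolynomial.eval₂ (LaurentPolynomial.C.comp (Int.castRingHom R))
    (LaurentPolynomial.isUnit_T 1).unit

/-- The constant term is `1`, and it survives reduction to any nontrivial ring. -/
lemma unitPoly_ne_zero (P : ℤ[X]) (R : Type*) [CommRing R] [Nontrivial R] :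
    laurentReduction R (unitPoly P) ≠ 0 := by
  have h1 : unitPoly P = Polynomial.toLaurent (1 + Polynomial.X * P) := by
    rw [map_add, map_mul, map_one, Polynomial.toLaurent_X]; rfl
  have h2 : ∀ f : ℤ[X], laurentReduction R (Polynomial.toLaurent f) =
      Polynomial.toLaurent (f.map (Int.castRingHom R)) := by
    intro f
    have : (laurentReduction R).comp (Polynomial.toLaurent (R := ℤ)) =
        (Polynomial.toLaurent (R := R)).comp (Polynomial.mapRingHom (Int.castRingHom R)) := by
      refine Polynomial.ringHom_ext' (RingHom.ext_int _ _) ?_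
      simp [laurentReduction]
    exact DFunLike.congr_fun this f
  rw [h1, h2]
  intro h
  have h3 := congrArg (Polynomial.eval 0) (Polynomial.toLaurent_injective (h.trans (map_zero _).symm))
  simp at h3

/-- An element of `K` divisible, among algebraic integers over `A`, by `1 - η` with `η` a root of
unity of prime power order is not invertible in `𝒪`. -/
lemma mul_ne_one_of_isPrimePowRoot (hinj : Function.Injective (algebraMap A K))
    {y : K} {η w : AlgebraicClosure K} (hη : IsPrimePowRoot η)
    (hw : IsIntegral A w) (hy : algebraMap K (AlgebraicClosure K) y = (1 - η) * w)
    {o : K} (ho : o ∈ ringO K) : y * o ≠ 1 := by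
  intro hyo
  obtain ⟨p, b, hp, hb⟩ := hη
  have := Fact.mk hp
  obtain ⟨P, hP⟩ := exists_unitPoly_mul_mem ho
  -- Reduction of coefficients modulo `p`; its kernel is a prime of `A` containing `p` but no `1 + x
  -- P`.
  let φ : A →+* LaurentPolynomial (ZMod p) := laurentReduction (ZMod p)
  let B := integralClosure A (AlgebraicClosure K)
  have hinj' : Function.Injective (algebraMap A B) := by
    have h1 : Function.Injective (algebraMap A (AlgebraicClosure K)) := by
      rw [IsScalarTower.algebraMap_eq A K]
      exact (algebraMap K (AlgebraicClosure K)).injective.comp hinj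
    intro a b hab
    exact h1 (congrArg (Subtype.val) hab)
  have hker : (RingHom.ker φ).IsPrime := RingHom.ker_isPrime φ
  -- Lying over, in the integral closure inside an algebraic closure of `K`, where `η` lives.
  obtain ⟨𝔓, hprime, h𝔓⟩ := Ideal.exists_ideal_over_prime_of_isIntegral_of_isDomain (S := B)
    (RingHom.ker φ) (by rw [(RingHom.injective_iff_ker_eq_bot _).1 hinj']; exact bot_le)
  have hηint : IsIntegral A η := by
    refine IsIntegral.of_pow (pow_pos hp.pos b) ?_
    rw [hb]; exact isIntegral_one
  let η' : B := ⟨η, hηint⟩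
  let w' : B := ⟨w, hw⟩
  have hp0 : ((p : ℕ) : B ⧸ 𝔓) = 0 := by
    have h1 : algebraMap A B (p : A) ∈ 𝔓 := by
      rw [← Ideal.mem_comap, h𝔓, RingHom.mem_ker, map_natCast]
      have : ((p : ℕ) : ZMod p) = 0 := ZMod.natCast_self p
      rw [← map_natCast (LaurentPolynomial.C (R := ZMod p)), this, map_zero]
    rw [map_natCast] at h1
    rw [← map_natCast (Ideal.Quotient.mk 𝔓)]
    exact Ideal.Quotient.eq_zero_iff_mem.2 h1
  have hchar : CharP (B ⧸ 𝔓) p := (CharP.charP_iff_prime_eq_zero hp).2 hp0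
  -- In characteristic `p`, `(1 - η)^{p^b} = 1 - η^{p^b} = 0`, and the quotient by a prime is
  -- reduced.
  have hmem : Ideal.Quotient.mk 𝔓 (1 - η') = 0 := by
    have h1 : (Ideal.Quotient.mk 𝔓 (1 - η')) ^ p ^ b = 0 := by
      rw [map_sub, map_one, sub_pow_char_pow, one_pow, ← map_pow]
      have : η' ^ p ^ b = 1 := Subtype.ext hb
      rw [this, map_one, sub_self]
    exact pow_eq_zero_iff (pow_pos hp.pos b).ne' |>.1 h1
  have hbint : IsIntegral A (algebraMap K (AlgebraicClosure K) (algebraMap A K (unitPoly P) * o)) :=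
    IsIntegral.algebraMap hP
  let b' : B := ⟨_, hbint⟩
  -- If `y o = 1`, then `1 + x P = (1 - η) w b'` with integral factors, so it would lie in `𝔓`.
  have heq : algebraMap A B (unitPoly P) = (1 - η') * (w' * b') := by
    apply Subtype.ext
    change algebraMap A (AlgebraicClosure K) (unitPoly P) = (1 - η) * (w *
      algebraMap K (AlgebraicClosure K) (algebraMap A K (unitPoly P) * o))
    rw [← mul_assoc, ← hy, ← map_mul, IsScalarTower.algebraMap_apply A K]
    congr 1
    linear_combination -(algebraMap A K (unitPoly P)) * hyo
  have h2 : algebraMap A B (unitPoly P) ∈ 𝔓 := by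
    rw [← Ideal.Quotient.eq_zero_iff_mem, heq, map_mul, hmem, zero_mul]
  rw [← Ideal.mem_comap, h𝔓, RingHom.mem_ker] at h2
  exact unitPoly_ne_zero P (ZMod p) h2

lemma isIntegral_of_pow_eq_one {R L : Type*} [CommRing R] [CommRing L] [Algebra R L] {ξ : L} {n : ℕ}
    (hn : n ≠ 0) (h : ξ ^ n = 1) : IsIntegral R ξ := by
  refine IsIntegral.of_pow (Nat.pos_of_ne_zero hn) ?_
  rw [h]; exact isIntegral_one

lemma isIntegral_of_add_inv {ξ : AlgebraicClosure K} {n : ℕ} (hn : n ≠ 0) (h : ξ ^ n = 1) {c : K}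
    (hc : algebraMap K (AlgebraicClosure K) c = ξ + ξ⁻¹) : IsIntegral A c := by
  rw [← isIntegral_algebraMap_iff (algebraMap K (AlgebraicClosure K)).injective, hc]
  exact (isIntegral_of_pow_eq_one hn h).add
    (isIntegral_of_pow_eq_one hn (by rw [inv_pow, h, inv_one]))

/-- If `ξ / ξ'` has prime power order, then `(ξ + ξ⁻¹) - (ξ' + ξ'⁻¹)` is not invertible
in `𝒪`. -/
lemma sub_mul_ne_one (hinj : Function.Injective (algebraMap A K)) {n : ℕ} (hn : n ≠ 0)
    {ξ η : AlgebraicClosure K} (hξ : ξ ^ n = 1) (hηn : η ^ n = 1) (hη : IsPrimePowRoot η) {c c' : K}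
    (hc : algebraMap K (AlgebraicClosure K) c = ξ + ξ⁻¹)
    (hc' : algebraMap K (AlgebraicClosure K) c' = ξ * η + (ξ * η)⁻¹)
    {o : K} (ho : o ∈ ringO K) : (c - c') * o ≠ 1 := by
  have h0 : ∀ {ζ : AlgebraicClosure K}, ζ ^ n = 1 → ζ ≠ 0 := by
    rintro ζ hζ rfl
    rw [zero_pow hn] at hζ
    exact zero_ne_one hζ
  have hξη : (ξ * η) ^ n = 1 := by rw [mul_pow, hξ, hηn, one_mul]
  have h1 := h0 hξ
  have h2 := h0 hηn
  -- The factorization is `ξ + ξ⁻¹ - ξη - (ξη)⁻¹ = (1 - η)(ξ - (ξη)⁻¹)`.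
  refine mul_ne_one_of_isPrimePowRoot hinj (η := η) (w := ξ - (ξ * η)⁻¹) hη
    ((isIntegral_of_pow_eq_one hn hξ).sub
      (isIntegral_of_pow_eq_one hn (by rw [inv_pow, hξη, inv_one]))) ?_ ho
  rw [map_sub, hc, hc']
  field_simp
  ring

end Arithmetic

/-! ### The parameters lie in the splitting field -/

section SplittingField

variable {m : ℕ} {W : Type*} [Group W] (cs : CoxeterSystem (CoxeterMatrix.I m) W)
  {K : Type*} [Field K]

/-- The monomial matrices generating the two-dimensional representations of the dihedral group. -/
def monomialMat {L : Type*} [Field L] (ξ : L) (i : Fin 2) : Matrix (Fin 2) (Fin 2) L :=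
  if i = 0 then !![0, 1; 1, 0] else !![0, ξ⁻¹; ξ, 0]

lemma monomialMat_isLiftable {L : Type*} [Field L] {ξ : L} (h : ξ ^ (m + 2) = 1) :
    (CoxeterMatrix.I m).IsLiftable (monomialMat ξ) := by
  have h0 : ξ ≠ 0 := by
    rintro rfl
    simp at h
  have hdiag : ∀ a b : L, !![a, 0; 0, b] = Matrix.diagonal ![a, b] := by
    intro a b
    ext i j
    fin_cases i <;> fin_cases j <;> simp
  intro i j
  rcases fin_two_eq_or 0 i with rfl | rfl <;> rcases fin_two_eq_or 0 j with rfl | rfl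
  · simp [monomialMat, Matrix.one_fin_two]
  · rw [dihedralMatrix_of_ne (by decide)]
    have : monomialMat ξ 0 * monomialMat ξ (0 + 1) = Matrix.diagonal ![ξ, ξ⁻¹] := by
      rw [← hdiag]; simp [monomialMat]
    rw [this, Matrix.diagonal_pow, ← Matrix.diagonal_one]
    congr 1
    ext i
    fin_cases i <;> simp [h]
  · rw [dihedralMatrix_of_ne (by decide)]
    have : monomialMat ξ (0 + 1) * monomialMat ξ 0 = Matrix.diagonal ![ξ⁻¹, ξ] := by
      rw [← hdiag]; simp [monomialMat]
    rw [this, Matrix.diagonal_pow, ← Matrix.diagonal_one]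
    congr 1
    ext i
    fin_cases i <;> simp [h]
  · simp [monomialMat, Matrix.one_fin_two, h0]

open Polynomial in
/-- A splitting field of the dihedral group of order `2 n` contains `ξ + ξ⁻¹` for all `n`-th roots
of unity `ξ`. -/
lemma exists_eq_add_inv (cs : CoxeterSystem (CoxeterMatrix.I m) W)
    (hKW : IsSplitSemisimple K (MonoidAlgebra K W)) {ξ : AlgebraicClosure K}
    (h : ξ ^ (m + 2) = 1) : ∃ c : K, algebraMap K (AlgebraicClosure K) c = ξ + ξ⁻¹ := by
  have hquad := (groupGen_isHecke cs K).quadratic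
  set t := groupGen cs K with ht
  -- The element `(s - t)²` is central in `K[W]`, so splitness provides a polynomial that kills it
  -- and has all its roots in `K`.
  have hcen : ∀ r : MonoidAlgebra K W, (t 0 - t 1) * (t 0 - t 1) * r =
      r * ((t 0 - t 1) * (t 0 - t 1)) := by
    intro r
    induction r using MonoidAlgebra.induction_linear with
    | zero => simp
    | add a b ha hb => rw [mul_add, add_mul, ha, hb]
    | single w c =>
      have h1 : (t 0 - t 1) * (t 0 - t 1) * MonoidAlgebra.single w 1 =
          MonoidAlgebra.single w 1 * ((t 0 - t 1) * (t 0 - t 1)) := by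
        induction w using cs.simple_induction_left with
        | one => rw [← MonoidAlgebra.one_def, mul_one, one_mul]
        | mul_simple_left w i ih =>
          have : (MonoidAlgebra.single (cs.simple i * w) 1 : MonoidAlgebra K W) =
            t i * MonoidAlgebra.single w 1 := by simp [ht, groupGen]
          rw [this, ← mul_assoc, sq_sub_comm hquad, mul_assoc, ih, mul_assoc]
      have h2 : (MonoidAlgebra.single w c : MonoidAlgebra K W) = c • MonoidAlgebra.single w 1 := by
        simp
      rw [h2, mul_smul_comm, h1, smul_mul_assoc]
  obtain ⟨N, c, hc⟩ := hKW.exists_aeval_eq_zero hcen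
  let ρ : MonoidAlgebra K W →ₐ[K] Matrix (Fin 2) (Fin 2) (AlgebraicClosure K) :=
    MonoidAlgebra.lift K _ W (cs.lift ⟨monomialMat ξ, monomialMat_isLiftable h⟩)
  have hρ : ∀ i, ρ (t i) = monomialMat ξ i := by
    intro i
    simp only [ρ, ht, groupGen, MonoidAlgebra.lift_single, one_smul]
    exact cs.lift_apply_simple _ i
  have h0 : ξ ≠ 0 := by
    rintro rfl
    simp at h
  -- The monomial representation over the algebraic closure turns `(s - t)² = 2 - st - ts` into the
  -- scalar `2 - (ξ + ξ⁻¹)`, which must then be one of those roots.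
  have hz : ρ ((t 0 - t 1) * (t 0 - t 1)) =
      algebraMap (AlgebraicClosure K) _ (2 - (ξ + ξ⁻¹)) := by
    rw [map_mul, map_sub, hρ, hρ]
    ext a b
    fin_cases a <;> fin_cases b <;>
      simp [monomialMat, Matrix.mul_apply, Matrix.algebraMap_matrix_apply] <;> field_simp <;> ring
  have h1 := congrArg ρ hc
  rw [← Polynomial.aeval_algHom_apply, hz, map_zero, Polynomial.aeval_algebraMap_apply,
    map_eq_zero_iff _ (algebraMap (AlgebraicClosure K)
      (Matrix (Fin 2) (Fin 2) (AlgebraicClosure K))).injective, map_prod,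
    Finset.prod_eq_zero_iff] at h1
  obtain ⟨i, -, hi⟩ := h1
  rw [map_sub, aeval_X, aeval_C] at hi
  refine ⟨2 - c i, ?_⟩
  rw [map_sub, map_ofNat]
  linear_combination hi

end SplittingField

end HeckeFamilies

end

noncomputable section

namespace HeckeFamilies

/-! ### Extension of scalars of the Hecke algebra -/

section BaseChange

variable {A S R : Type*} [CommRing A] [CommRing S] [Ring R] [Algebra A S] [Algebra A R]
  [Algebra S R] [IsScalarTower A S R]

lemma isHecke_algebraMap {n : ℕ} {q : A} {t : Fin 2 → R} :
    IsHecke n (algebraMap A S q) t ↔ IsHecke n q t := by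
  have h : ∀ i, IsQuadratic (algebraMap A S q) (t i) ↔ IsQuadratic q (t i) := fun i => by
    rw [IsQuadratic, IsQuadratic, ← IsScalarTower.algebraMap_apply]
  exact ⟨fun H => ⟨fun i => (h i).1 (H.quadratic i), H.braid⟩,
    fun H => ⟨fun i => (h i).2 (H.quadratic i), H.braid⟩⟩

end BaseChange

section BaseChange

variable {m : ℕ} (S : Type*) [CommRing S] [Algebra A S] {R : Type*} [Ring R] [Algebra A R]
  [Algebra S R] [IsScalarTower A S R] {t : Fin 2 → R}

/-- The generators of the Hecke algebra with scalars extended to `S`. -/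
def baseGen (i : Fin 2) : S ⊗[A] HeckeAlgebra (CoxeterMatrix.I m) :=
  1 ⊗ₜ heckeGen (CoxeterMatrix.I m) i

lemma baseGen_isHecke : IsHecke (m + 2) x (baseGen (m := m) S) :=
  isHecke_heckeGen.map (Algebra.TensorProduct.includeRight :
    HeckeAlgebra (CoxeterMatrix.I m) →ₐ[A] S ⊗[A] HeckeAlgebra (CoxeterMatrix.I m))

lemma adjoin_baseGen : Algebra.adjoin S (Set.range (baseGen (m := m) S)) = ⊤ := by
  rw [eq_top_iff]
  intro z _
  induction z using TensorProduct.induction_on with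
  | zero => exact zero_mem _
  | add a b ha hb => exact add_mem (ha trivial) (hb trivial)
  | tmul s h =>
    have h1 : (1 : S) ⊗ₜ[A] h ∈ Algebra.adjoin S (Set.range (baseGen (m := m) S)) := by
      have hh : h ∈ Algebra.adjoin A (Set.range (heckeGen (CoxeterMatrix.I m))) := by
        rw [adjoin_heckeGen]; trivial
      clear * - hh
      induction hh using Algebra.adjoin_induction with
      | mem y hy =>
        obtain ⟨i, rfl⟩ := hy
        exact Algebra.subset_adjoin ⟨i, rfl⟩
      | algebraMap r =>
        have : (1 : S) ⊗ₜ[A] algebraMap A (HeckeAlgebra (CoxeterMatrix.I m)) r =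
            algebraMap S _ (algebraMap A S r) := by
          rw [Algebra.TensorProduct.algebraMap_apply, Algebra.algebraMap_eq_smul_one,
            Algebra.algebraMap_eq_smul_one, TensorProduct.tmul_smul, TensorProduct.smul_tmul',
            algebraMap_smul]
        rw [this]
        exact Subalgebra.algebraMap_mem _ _
      | add a b _ _ ha hb => rw [TensorProduct.tmul_add]; exact add_mem ha hb
      | mul a b _ _ ha hb =>
        have : (1 : S) ⊗ₜ[A] (a * b) = (1 ⊗ₜ[A] a) * (1 ⊗ₜ[A] b) := by simp
        rw [this]; exact mul_mem ha hb
    have h2 : s ⊗ₜ[A] h = s • ((1 : S) ⊗ₜ[A] h) := by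
      rw [TensorProduct.smul_tmul', smul_eq_mul, mul_one]
    rw [h2]
    exact Subalgebra.smul_mem _ h1 s

/-- The homomorphism from the Hecke algebra over `S` attached to a solution of its relations. -/
def baseLift (h : IsHecke (m + 2) x t) : S ⊗[A] HeckeAlgebra (CoxeterMatrix.I m) →ₐ[S] R :=
  Algebra.TensorProduct.lift (Algebra.ofId S R) (heckeLift h) fun s y =>
    show Commute _ _ from Algebra.commutes s (heckeLift h y)

lemma baseLift_tmul (h : IsHecke (m + 2) x t) (s : S) (y : HeckeAlgebra (CoxeterMatrix.I m)) :
    baseLift S h (s ⊗ₜ y) = s • heckeLift h y := by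
  rw [baseLift, Algebra.TensorProduct.lift_tmul, Algebra.ofId_apply, Algebra.smul_def]

@[simp] lemma baseLift_gen (h : IsHecke (m + 2) x t) (i : Fin 2) :
    baseLift S h (baseGen S i) = t i := by
  rw [baseGen, baseLift_tmul, one_smul, heckeLift_gen]

variable {S} in
lemma baseHom_ext {R : Type*} [Ring R] [Algebra S R]
    {f g : S ⊗[A] HeckeAlgebra (CoxeterMatrix.I m) →ₐ[S] R}
    (h : ∀ i, f (baseGen S i) = g (baseGen S i)) : f = g :=
  AlgHom.ext_of_adjoin_eq_top (adjoin_baseGen S) (by rintro _ ⟨i, rfl⟩; exact h i)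

variable {S} in
/-- Compatibility of `baseLift` with a change of scalars. -/
lemma map_baseLift {S' R' : Type*} [CommRing S'] [Algebra A S'] [Ring R'] [Algebra A R']
    [Algebra S' R'] [IsScalarTower A S' R'] {t' : Fin 2 → R'} (h : IsHecke (m + 2) x t)
    (h' : IsHecke (m + 2) x t') (σ : S →ₐ[A] S') (θ : R →ₐ[A] R')
    (hθ : ∀ s, θ (algebraMap S R s) = algebraMap S' R' (σ s)) (ht : ∀ i, θ (t i) = t' i)
    (z : S ⊗[A] HeckeAlgebra (CoxeterMatrix.I m)) :
    θ (baseLift S h z) = baseLift S' h' (Algebra.TensorProduct.map σ (AlgHom.id A _) z) := by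
  induction z using TensorProduct.induction_on with
  | zero => simp
  | add a b ha hb => simp only [map_add, ha, hb]
  | tmul s y =>
    have : θ.comp (heckeLift h) = heckeLift h' := heckeAlgHom_ext fun i => by
      simp [ht]
    rw [Algebra.TensorProduct.map_tmul, baseLift_tmul, baseLift_tmul, Algebra.smul_def, map_mul, hθ,
      Algebra.smul_def, ← this]
    rfl

lemma tmul_heckeWord (ω : List (Fin 2)) :
    (1 : S) ⊗ₜ[A] heckeWord (CoxeterMatrix.I m) ω = (ω.map (baseGen S)).prod := by
  have := map_list_prod (Algebra.TensorProduct.includeRight :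
    HeckeAlgebra (CoxeterMatrix.I m) →ₐ[A] S ⊗[A] HeckeAlgebra (CoxeterMatrix.I m))
    (ω.map (heckeGen (CoxeterMatrix.I m)))
  rw [List.map_map] at this
  exact this

end BaseChange

/-! ### Linear characters with commuting values -/

section ScalarRepresentations

variable {A R : Type*} [CommRing A] [CommRing R] [Algebra A R]

lemma altProd_even (t : Fin 2 → R) (a : Fin 2) (k : ℕ) :
    altProd t a (2 * k) = (t 0 * t 1) ^ k := by
  have h : t a * t (a + 1) = t 0 * t 1 := by
    fin_cases a
    · rfl
    · exact mul_comm _ _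
  induction k with
  | zero => simp
  | succ k ih =>
    rw [show 2 * (k + 1) = 2 * k + 1 + 1 by ring, altProd_succ, altProd_succ, add_one_add_one, ih,
      pow_succ', ← h, mul_assoc]

lemma altProd_odd (t : Fin 2 → R) (a : Fin 2) (k : ℕ) :
    altProd t a (2 * k + 1) = t a * (t 0 * t 1) ^ k := by
  rw [altProd_succ, altProd_even]

/-- In a commutative ring both alternating products are `(t 0 t 1)^{n/2}`, so the braid relation is
automatic. This is the source of the two mixed linear characters. -/
lemma isHecke_of_even {n : ℕ} (hn : Even n) {q : A} {t : Fin 2 → R} (h : ∀ i, IsQuadratic q (t i)) :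
    IsHecke n q t where
  quadratic := h
  braid := by
    obtain ⟨k, rfl⟩ := hn
    rw [← two_mul, altProd_even, altProd_even]

/-- For odd `n` the two sides differ only by a leftover factor `t 0` or `t 1`. -/
lemma eq_of_altProd_eq [IsDomain R] {t : Fin 2 → R} (h0 : ∀ i, t i ≠ 0) {n : ℕ} (hn : ¬ Even n)
    (h : altProd t 0 n = altProd t 1 n) : t 0 = t 1 := by
  obtain ⟨k, rfl⟩ := Nat.not_even_iff_odd.1 hn
  rw [altProd_odd, altProd_odd] at h
  exact mul_right_cancel₀ (pow_ne_zero k (mul_ne_zero (h0 0) (h0 1))) h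

end ScalarRepresentations

/-! ### Irreducible representations of a split algebra with Hecke generators -/

section Irreducible

variable {K R : Type*} [Field K] [Ring R] [Algebra K R] {n : ℕ} {q : K} {t : Fin 2 → R}

lemma invariant_of_gen {V : Type*} [AddCommGroup V] [Module K V]
    (hgen : Algebra.adjoin K (Set.range t) = ⊤) (ρ : R →ₐ[K] Module.End K V) {U : Submodule K V}
    (h : ∀ i, ∀ u ∈ U, ρ (t i) u ∈ U) (r : R) : ∀ u ∈ U, ρ r u ∈ U := by
  have hr : r ∈ Algebra.adjoin K (Set.range t) := by rw [hgen]; trivial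
  induction hr using Algebra.adjoin_induction with
  | mem y hy =>
    obtain ⟨i, rfl⟩ := hy
    exact h i
  | algebraMap c => intro u hu; simpa using U.smul_mem c hu
  | add a b _ _ ha hb => intro u hu; rw [map_add]; exact U.add_mem (ha u hu) (hb u hu)
  | mul a b _ _ ha hb => intro u hu; rw [map_mul]; exact ha _ (hb u hu)

lemma commute_of_gen (hgen : Algebra.adjoin K (Set.range t) = ⊤) {z : R}
    (h : ∀ i, z * t i = t i * z) (r : R) : z * r = r * z := by
  have hr : r ∈ Algebra.adjoin K (Set.range t) := by rw [hgen]; trivial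
  induction hr using Algebra.adjoin_induction with
  | mem y hy =>
    obtain ⟨i, rfl⟩ := hy
    exact h i
  | algebraMap c => exact (Algebra.commutes c z).symm
  | add a b _ _ ha hb => rw [mul_add, add_mul, ha, hb]
  | mul a b _ _ ha hb => rw [← mul_assoc, ha, mul_assoc, hb, mul_assoc]

/-- Splitness supplies the eigenvalue of `(t 0 - t 1)²` in `K` required by `classify_irreducible`;
the same lemma serves the Hecke algebra and, with `q = 1`, the group algebra. -/
lemma classify_of_split [CharZero K] (hR : IsSplitSemisimple K R) (hn : n ≠ 0) (hq : q ≠ 0)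
    (hq1 : 1 + q ≠ 0) (ht : IsHecke n q t) (hgen : Algebra.adjoin K (Set.range t) = ⊤)
    {V : Type*} [AddCommGroup V] [Module K V] [Nontrivial V] {ρ : R →ₐ[K] Module.End K V}
    (hirr : ∀ U : Submodule K V, (∀ r, ∀ v ∈ U, ρ r v ∈ U) → U = ⊥ ∨ U = ⊤) :
    (∃ a : Fin 2 → K, Module.finrank K V = 1 ∧ ∀ i, ρ (t i) = a i • 1 ∧ (a i = q ∨ a i = -1)) ∨
    ∃ c : K, IsDihedralParam n c ∧ ∃ b : Module.Basis (Fin 2) K V, ∀ i,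
      LinearMap.toMatrixAlgEquiv b (ρ (t i)) = dihMat q (q * (2 + c)) i := by
  obtain ⟨N, c, hc⟩ := hR.exists_aeval_eq_zero
    (commute_of_gen hgen (sq_sub_comm ht.quadratic))
  have hc' := congrArg ρ hc
  rw [← Polynomial.aeval_algHom_apply, map_zero, map_mul, map_sub] at hc'
  obtain ⟨μ, hμ⟩ := exists_hasEigenvalue_of_aeval_prod hc'
  exact classify_irreducible hn hq hq1 (fun U hU => hirr U (invariant_of_gen hgen ρ hU))
    (ht.map ρ) hμ

/-- An irreducible representation with a common eigenvector is given by a linear character. -/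
lemma eq_smul_of_eigenvector (hgen : Algebra.adjoin K (Set.range t) = ⊤)
    {V : Type*} [AddCommGroup V] [Module K V] {ρ : R →ₐ[K] Module.End K V}
    (hirr : ∀ U : Submodule K V, (∀ r, ∀ v ∈ U, ρ r v ∈ U) → U = ⊥ ∨ U = ⊤) (χ : R →ₐ[K] K)
    {v : V} (hv : v ≠ 0) (h : ∀ i, ρ (t i) v = χ (t i) • v) :
    Module.finrank K V = 1 ∧ ∀ r, ρ r = χ r • 1 := by
  have hrv : ∀ r, ρ r v = χ r • v := by
    intro r
    have hr : r ∈ Algebra.adjoin K (Set.range t) := by rw [hgen]; trivial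
    induction hr using Algebra.adjoin_induction with
    | mem y hy =>
      obtain ⟨i, rfl⟩ := hy
      exact h i
    | algebraMap c => simp
    | add a b _ _ ha hb => simp [ha, hb, add_smul]
    | mul a b _ _ ha hb => simp [ha, hb, smul_smul, mul_comm]
  have htop : K ∙ v = ⊤ := by
    refine (hirr (K ∙ v) fun g u hu => ?_).resolve_left (by simpa using hv)
    obtain ⟨c, rfl⟩ := Submodule.mem_span_singleton.1 hu
    rw [map_smul, hrv]
    exact Submodule.smul_mem _ _ (Submodule.smul_mem _ _ (Submodule.mem_span_singleton_self v))
  refine ⟨?_, fun r => LinearMap.ext fun u => ?_⟩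
  · have := finrank_span_singleton (K := K) hv
    rwa [htop, finrank_top] at this
  · have hu : u ∈ K ∙ v := by rw [htop]; trivial
    obtain ⟨c, rfl⟩ := Submodule.mem_span_singleton.1 hu
    rw [map_smul, hrv]
    simp [smul_comm c]

lemma trace_eq_of_smul {d : ℕ} {ρ : R →ₐ[K] Module.End K (Fin d → K)} {χ : R →ₐ[K] K}
    (hd : d = 1) (h : ∀ r, ρ r = χ r • 1) :
    LinearMap.trace K (Fin d → K) ∘ₗ ρ.toLinearMap = χ.toLinearMap := by
  subst hd
  refine LinearMap.ext fun r => ?_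
  simp [h]

/-- A linear character is an irreducible character. -/
lemma linear_mem_irrAlgebra (χ : R →ₐ[K] K) : χ.toLinearMap ∈ irrAlgebra K R := by
  refine ⟨1, (Algebra.ofId K _).comp χ, one_pos, fun U _ => ?_, ?_⟩
  · have : IsSimpleModule K (Fin 1 → K) := by
      rw [isSimpleModule_iff_finrank_eq_one]; simp
    exact eq_bot_or_eq_top U
  · refine (trace_eq_of_smul rfl fun r => ?_).symm
    rw [AlgHom.comp_apply, Algebra.ofId_apply, Algebra.algebraMap_eq_smul_one]

/-- Irreducible characters congruent to a linear character on `1` and on the generators are equal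
to it. -/
lemma eq_linear_of_congr (hgen : Algebra.adjoin K (Set.range t) = ⊤)
    (hquad : ∀ i, IsQuadratic q (t i)) (𝔪 : AddSubgroup K) (hd𝔪 : ∀ d : ℕ, (d : K) - 1 ∈ 𝔪 → d = 1)
    (hq𝔪 : q + 1 ∉ 𝔪) {v : K} (hv : v = q ∨ v = -1) {d : ℕ}
    (ρ : R →ₐ[K] Module.End K (Fin d → K)) (χ : R →ₐ[K] K) (hχ : ∀ i, χ (t i) = v)
    (h1 : LinearMap.trace K (Fin d → K) (ρ 1) - 1 ∈ 𝔪)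
    (ht : ∀ i, LinearMap.trace K (Fin d → K) (ρ (t i)) - v ∈ 𝔪) :
    LinearMap.trace K (Fin d → K) ∘ₗ ρ.toLinearMap = χ.toLinearMap := by
  rw [map_one, trace_one] at h1
  obtain rfl := hd𝔪 d h1
  have hti : ∀ i, ρ (t i) = v • 1 := by
    intro i
    have hs := end_fin_one_eq_smul (ρ (t i))
    have hi := ht i
    set a := LinearMap.trace K (Fin 1 → K) (ρ (t i)) with ha
    have hquad' : (a - q) * (a + 1) = 0 := by
      have h2 := congrArg ρ (hquad i)
      rw [map_mul, map_sub, map_add, AlgHom.commutes, map_one, map_zero, hs,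
        Algebra.algebraMap_eq_smul_one] at h2
      have h3 := congrArg (LinearMap.trace K (Fin 1 → K)) h2
      have h4 : (a • (1 : Module.End K (Fin 1 → K)) - q • 1) * (a • 1 + 1) =
          ((a - q) * (a + 1)) • 1 := by
        refine LinearMap.ext fun u => ?_
        simp only [Module.End.mul_apply, LinearMap.sub_apply, LinearMap.add_apply,
          LinearMap.smul_apply, Module.End.one_apply]
        module
      rw [h4, map_smul, trace_one] at h3
      simpa using h3
    -- The quadratic relation leaves only `q` and `-1`, and these are incongruent by `hq𝔪`.
    have hav : a = v := by
      rcases mul_eq_zero.1 hquad' with h3 | h3 <;> rcases hv with rfl | rfl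
      · exact sub_eq_zero.1 h3
      · rw [sub_eq_zero.1 h3, sub_neg_eq_add] at hi
        exact absurd hi hq𝔪
      · rw [eq_neg_of_add_eq_zero_left h3] at hi
        refine absurd (neg_mem hi) ?_
        rwa [show -(-1 - v) = v + 1 by ring]
      · exact eq_neg_of_add_eq_zero_left h3
    rw [hs, hav]
  have : ρ = (Algebra.ofId K _).comp χ := by
    refine AlgHom.ext_of_adjoin_eq_top hgen ?_
    rintro _ ⟨i, rfl⟩
    rw [hti, AlgHom.comp_apply, Algebra.ofId_apply, hχ, Algebra.algebraMap_eq_smul_one]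
  refine trace_eq_of_smul rfl fun r => ?_
  rw [this, AlgHom.comp_apply, Algebra.ofId_apply, Algebra.algebraMap_eq_smul_one]

lemma toLinAlgEquiv'_irreducible {K : Type*} [Field K] {d : ℕ} {U : Submodule K (Fin d → K)}
    (hU : ∀ M : Matrix (Fin d) (Fin d) K, ∀ u ∈ U, Matrix.toLinAlgEquiv' M u ∈ U) :
    U = ⊥ ∨ U = ⊤ := by
  by_cases h : U = ⊥
  · exact Or.inl h
  right
  obtain ⟨u, hu, hu0⟩ := (Submodule.ne_bot_iff U).1 h
  obtain ⟨j, hj⟩ := Function.ne_iff.1 hu0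
  rw [eq_top_iff]
  intro w _
  -- The rank-one matrix whose only nonzero column is column `j`, equal to `w` divided by `u j`.
  have : Matrix.toLinAlgEquiv' (Matrix.of fun i k => if k = j then w i * (u j)⁻¹ else 0) u = w := by
    ext i
    rw [Matrix.toLinAlgEquiv'_apply, Matrix.mulVec, dotProduct]
    simp only [Matrix.of_apply, ite_mul, zero_mul, Finset.sum_ite_eq', Finset.mem_univ, if_true]
    rw [mul_assoc, inv_mul_cancel₀ hj, mul_one]
  rw [← this]
  exact hU _ u hu

/-- In a split semisimple algebra, the irreducible representations separate the elements. -/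
lemma eq_zero_of_irreducible (hR : IsSplitSemisimple K R) {z : R}
    (h : ∀ (d : ℕ) (ρ : R →ₐ[K] Module.End K (Fin d → K)), 0 < d →
      (∀ U : Submodule K (Fin d → K), (∀ r, ∀ v ∈ U, ρ r v ∈ U) → U = ⊥ ∨ U = ⊤) → ρ z = 0) :
    z = 0 := by
  obtain ⟨N, d, ⟨e⟩⟩ := hR
  apply e.injective
  rw [map_zero]
  ext1 i
  rcases Nat.eq_zero_or_pos (d i) with hd | hd
  · ext a
    exact absurd a.2 (by omega)
  have := h (d i) (Matrix.toLinAlgEquiv'.toAlgHom.comp ((Pi.evalAlgHom K _ i).comp e.toAlgHom)) hd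
    fun U hU => toLinAlgEquiv'_irreducible fun M u hu => by
      have := hU (e.symm (Pi.single i M)) u hu
      simpa using this
  apply Matrix.toLinAlgEquiv'.injective
  rw [Pi.zero_apply, map_zero]
  exact this

end Irreducible

end HeckeFamilies

end

noncomputable section

namespace HeckeFamilies

/-! ### The two-dimensional representations over a base ring -/

section DihedralRepresentation

/-- The two-dimensional representation of the Hecke algebra with parameter `α`. -/
def dihRep {m : ℕ} (S : Type*) [CommRing S] [Algebra A S] {α : S}
    (h : braidSeq (algebraMap A S x) α (m + 2) = 0) :
    S ⊗[A] HeckeAlgebra (CoxeterMatrix.I m) →ₐ[S] Matrix (Fin 2) (Fin 2) S :=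
  baseLift S (dihMat_isHecke h)

lemma dihRep_gen {m : ℕ} (S : Type*) [CommRing S] [Algebra A S] {α : S}
    (h : braidSeq (algebraMap A S x) α (m + 2) = 0) (i : Fin 2) :
    dihRep S h (baseGen S i) = dihMat (algebraMap A S x) α i :=
  baseLift_gen S _ i

/-- The image of `t i + 1` is contained in the line of the `i`-th basis vector. As `α ≠ (1 + Q)²`,
no nonzero vector is killed by both of these operators, so a nonzero invariant subspace contains a
basis vector; `α ≠ 0` then gives the other one. -/
lemma dihMat_irreducible {K : Type*} [Field K] {Q α : K} (hα : α ≠ 0) (hQ : α ≠ (1 + Q) ^ 2)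
    {U : Submodule K (Fin 2 → K)} (hU : ∀ i, ∀ u ∈ U, Matrix.toLinAlgEquiv' (dihMat Q α i) u ∈ U) :
    U = ⊥ ∨ U = ⊤ := by
  by_cases h : U = ⊥
  · exact Or.inl h
  right
  obtain ⟨u, hu, hu0⟩ := (Submodule.ne_bot_iff U).1 h
  have h0 : ∀ w ∈ U, (((1 + Q) * w 0 + α * w 1) • ![1, 0] : Fin 2 → K) ∈ U := by
    intro w hw
    convert U.add_mem (hU 0 w hw) hw using 1
    rw [Matrix.toLinAlgEquiv'_apply]
    ext i
    fin_cases i <;> simp [dotProduct, Fin.sum_univ_two]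
    ring
  have h1 : ∀ w ∈ U, ((w 0 + (1 + Q) * w 1) • ![0, 1] : Fin 2 → K) ∈ U := by
    intro w hw
    convert U.add_mem (hU 1 w hw) hw using 1
    rw [Matrix.toLinAlgEquiv'_apply]
    ext i
    fin_cases i <;> simp [dotProduct, Fin.sum_univ_two]
    ring
  have hmem : ∀ {a : K} {w : Fin 2 → K}, a ≠ 0 → a • w ∈ U → w ∈ U := fun ha hw => by
    rwa [Submodule.smul_mem_iff _ ha] at hw
  have h01 : (![1, 0] : Fin 2 → K) ∈ U ∧ (![0, 1] : Fin 2 → K) ∈ U := by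
    by_cases ha : (1 + Q) * u 0 + α * u 1 = 0
    · by_cases hb : u 0 + (1 + Q) * u 1 = 0
      · exfalso
        have hu1 : u 1 = 0 := by
          have : (α - (1 + Q) ^ 2) * u 1 = 0 := by linear_combination ha - (1 + Q) * hb
          exact (mul_eq_zero.1 this).resolve_left (sub_ne_zero.2 hQ)
        have hu0' : u 0 = 0 := by rw [hu1] at hb; simpa using hb
        apply hu0
        ext i
        fin_cases i
        · exact hu0'
        · exact hu1
      · have h2 := hmem hb (h1 u hu)
        have h3 := h0 _ h2
        exact ⟨hmem (by simpa using hα) h3, h2⟩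
    · have h2 := hmem ha (h0 u hu)
      have h3 := h1 _ h2
      exact ⟨h2, by simpa using h3⟩
  rw [eq_top_iff]
  intro w _
  have : w = w 0 • ![1, 0] + w 1 • ![0, 1] := by ext i; fin_cases i <;> simp
  rw [this]
  exact U.add_mem (U.smul_mem _ h01.1) (U.smul_mem _ h01.2)

/-- The trace of a word in the matrices `dihMat`. -/
def dihTrace {S : Type*} [CommRing S] (Q α : S) (ω : List (Fin 2)) : S :=
  Matrix.trace (ω.map (dihMat Q α)).prod

lemma map_dihTrace {S S' : Type*} [CommRing S] [CommRing S'] (f : S →+* S') (Q α : S)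
    (ω : List (Fin 2)) : f (dihTrace Q α ω) = dihTrace (f Q) (f α) ω := by
  rw [dihTrace, dihTrace, show f (Matrix.trace (ω.map (dihMat Q α)).prod) =
    Matrix.trace (f.mapMatrix (ω.map (dihMat Q α)).prod) from
      AddMonoidHom.map_trace f _,
    map_list_prod, List.map_map]
  congr 3
  funext i
  exact map_dihMat f Q α i

lemma map_prod_map {R S ι F : Type*} [Monoid R] [Monoid S] [FunLike F R S] [MonoidHomClass F R S]
    (f : F) {t : ι → R} {M : ι → S} (h : ∀ i, f (t i) = M i) (ω : List ι) :
    f (ω.map t).prod = (ω.map M).prod := by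
  rw [map_list_prod, List.map_map]
  congr 2
  funext i
  exact h i

lemma trace_eq_dihTrace {K V R : Type*} [Field K] [AddCommGroup V] [Module K V] [Monoid R]
    (b : Module.Basis (Fin 2) K V) {ρ : R →* Module.End K V} {t : Fin 2 → R} {Q α : K}
    (h : ∀ i, LinearMap.toMatrixAlgEquiv b (ρ (t i)) = dihMat Q α i) (ω : List (Fin 2)) :
    LinearMap.trace K V (ρ (ω.map t).prod) = dihTrace Q α ω := by
  rw [LinearMap.trace_eq_matrix_trace K b, dihTrace, map_prod_map ρ (fun i => rfl)]
  congr 1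
  exact map_prod_map (LinearMap.toMatrixAlgEquiv b) h ω

end DihedralRepresentation

/-! ### Specialization at `x = 1` and congruences modulo `𝔫` -/

section Specialization

/-- Specialization of `A` at `x = 1`. -/
def evalOne : A →+* ℚ := LaurentPolynomial.eval₂ (Int.castRingHom ℚ) 1

@[simp] lemma evalOne_x : evalOne x = 1 := by simp [evalOne, x]

variable {K : Type*} [Field K] [Algebra A K]

lemma algebraMap_ne_zero_of_evalOne (hinj : Function.Injective (algebraMap A K)) {a : A}
    (h : evalOne a ≠ 0) : algebraMap A K a ≠ 0 := by
  rw [Ne, map_eq_zero_iff _ hinj]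
  rintro rfl
  exact h (map_zero _)

lemma charZero_of_A_injective (hinj : Function.Injective (algebraMap A K)) : CharZero K :=
  charZero_of_inj_zero fun n hn => by
    by_contra h
    refine algebraMap_ne_zero_of_evalOne (a := (n : A)) hinj ?_ (by rw [map_natCast, hn])
    rw [map_natCast]
    exact_mod_cast h

lemma algebraMap_x_ne_zero (hinj : Function.Injective (algebraMap A K)) :
    algebraMap A K x ≠ 0 :=
  algebraMap_ne_zero_of_evalOne hinj (by simp)

lemma one_add_algebraMap_x_ne_zero (hinj : Function.Injective (algebraMap A K)) :
    1 + algebraMap A K x ≠ 0 := by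
  have := algebraMap_ne_zero_of_evalOne (a := 1 + x) hinj (by norm_num)
  rwa [map_add, map_one] at this

/-- At `x = 1` the value `(1 + x)²` becomes `4 = 2 + 2`, the case `ξ = 1`, where `braidSeq` does not
vanish over `ℚ`. -/
lemma ne_sq_of_braidSeq (hinj : Function.Injective (algebraMap A K)) {n : ℕ} (hn : n ≠ 0) {α : K}
    (h : braidSeq (algebraMap A K x) α n = 0) : α ≠ (1 + algebraMap A K x) ^ 2 := by
  rintro rfl
  have h1 : algebraMap A K (braidSeq x ((1 + x) ^ 2) n) = 0 := by
    rw [map_braidSeq, map_pow, map_add, map_one, h]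
  rw [map_eq_zero_iff _ hinj] at h1
  have h2 := congrArg evalOne h1
  rw [map_braidSeq, map_zero, map_pow, map_add, map_one, evalOne_x] at h2
  refine braidSeq_two_ne_zero (L := ℚ) one_ne_zero hn ?_
  rw [← h2]
  norm_num

lemma dihRep_irreducible (hinj : Function.Injective (algebraMap A K)) {m : ℕ} {α : K}
    (hα : α ≠ 0) (h : braidSeq (algebraMap A K x) α (m + 2) = 0) (U : Submodule K (Fin 2 → K))
    (hU : ∀ r, ∀ v ∈ U, Matrix.toLinAlgEquiv'.toAlgHom.comp (dihRep K h) r v ∈ U) :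
    U = ⊥ ∨ U = ⊤ := by
  refine dihMat_irreducible hα (ne_sq_of_braidSeq hinj (Nat.succ_ne_zero _) h) fun i u hu => ?_
  have := hU (baseGen K i) u hu
  rw [AlgHom.comp_apply, dihRep_gen] at this
  exact this

lemma dihRep_mem_irrAlgebra (hinj : Function.Injective (algebraMap A K)) {m : ℕ} {α : K}
    (hα : α ≠ 0) (h : braidSeq (algebraMap A K x) α (m + 2) = 0) :
    LinearMap.trace K (Fin 2 → K) ∘ₗ
      (Matrix.toLinAlgEquiv'.toAlgHom.comp (dihRep K h)).toLinearMap ∈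
        irrAlgebra K (K ⊗[A] HeckeAlgebra (CoxeterMatrix.I m)) :=
  ⟨2, _, two_pos, dihRep_irreducible hinj hα h, rfl⟩

/-- The elements of `K` lying in the prime `𝔫` of the integral closure. -/
def idealSubgroup (𝔫 : Ideal (integralClosure A K)) : AddSubgroup K :=
  (Submodule.toAddSubgroup 𝔫).map (algebraMap (integralClosure A K) K).toAddMonoidHom

lemma mem_idealSubgroup {𝔫 : Ideal (integralClosure A K)} {y : K} :
    y ∈ idealSubgroup 𝔫 ↔ ∃ b ∈ 𝔫, (b : K) = y := Iff.rfl

variable {𝔫 : Ideal (integralClosure A K)}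

/-- Used to refute congruences: an element of `A` nonzero at `x = 1`, for instance a nonzero
integer, is outside `𝔫`. -/
lemma evalOne_eq_zero_of_mem
    (h𝔫 : 𝔫.comap (algebraMap A (integralClosure A K)) = Ideal.span {x - 1}) {a : A}
    (h : algebraMap A K a ∈ idealSubgroup 𝔫) : evalOne a = 0 := by
  obtain ⟨b, hb, hba⟩ := h
  have hb' : b = algebraMap A (integralClosure A K) a := Subtype.ext hba
  rw [SetLike.mem_coe, Submodule.mem_toAddSubgroup, hb', ← Ideal.mem_comap, h𝔫,
    Ideal.mem_span_singleton'] at hb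
  obtain ⟨c, rfl⟩ := hb
  simp

lemma x_sub_one_mem
    (h𝔫 : 𝔫.comap (algebraMap A (integralClosure A K)) = Ideal.span {x - 1}) :
    algebraMap A (integralClosure A K) (x - 1) ∈ 𝔫 := by
  rw [← Ideal.mem_comap, h𝔫]
  exact Ideal.mem_span_singleton_self _

end Specialization

end HeckeFamilies

end

noncomputable section

namespace HeckeFamilies

/-! ### The group algebra as a Hecke algebra at parameter `1` -/

section GroupAlgebra

variable {m : ℕ} {W : Type*} [Group W] (cs : CoxeterSystem (CoxeterMatrix.I m) W)
  {K : Type*} [Field K]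

lemma adjoin_groupGen : Algebra.adjoin K (Set.range (groupGen cs K)) = ⊤ := by
  rw [eq_top_iff]
  intro z _
  induction z using MonoidAlgebra.induction_linear with
  | zero => exact zero_mem _
  | add a b ha hb => exact add_mem (ha trivial) (hb trivial)
  | single w c =>
    have h2 : (MonoidAlgebra.single w c : MonoidAlgebra K W) = c • MonoidAlgebra.single w 1 := by
      simp
    rw [h2]
    refine Subalgebra.smul_mem _ ?_ c
    clear * -
    induction w using cs.simple_induction_left with
    | one => rw [← MonoidAlgebra.one_def]; exact one_mem _
    | mul_simple_left w i ih =>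
      have : (MonoidAlgebra.single (cs.simple i * w) 1 : MonoidAlgebra K W) =
        groupGen cs K i * MonoidAlgebra.single w 1 := by simp [groupGen]
      rw [this]
      exact mul_mem (Algebra.subset_adjoin ⟨i, rfl⟩) ih

lemma asAlgebraHom_groupGen {V : Type*} [AddCommGroup V] [Module K V] (ρ : Representation K W V)
    (i : Fin 2) : ρ.asAlgebraHom (groupGen cs K i) = ρ (cs.simple i) := by
  rw [groupGen, Representation.asAlgebraHom_single_one]

lemma asAlgebraHom_irreducible {V : Type*} [AddCommGroup V] [Module K V] {ρ : Representation K W V}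
    (hρ : ρ.IsIrreducible) (U : Submodule K V) (hU : ∀ r, ∀ v ∈ U, ρ.asAlgebraHom r v ∈ U) :
    U = ⊥ ∨ U = ⊤ :=
  ((isIrreducible_iff ρ).1 hρ).2 U fun g v hv => by
    have := hU (MonoidAlgebra.single g 1) v hv
    rwa [Representation.asAlgebraHom_single_one] at this

end GroupAlgebra

/-! ### The bijection between characters of `K H` and of `W` -/

section Correspondence

variable {m : ℕ} {W : Type*} [Group W] (cs : CoxeterSystem (CoxeterMatrix.I m) W)
  {K : Type*} [Field K] [Algebra A K] {𝔫 : Ideal (integralClosure A K)}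

lemma mk_x_eq_one
    (h𝔫 : 𝔫.comap (algebraMap A (integralClosure A K)) = Ideal.span {x - 1}) :
    Ideal.Quotient.mk 𝔫 (algebraMap A (integralClosure A K) x) = 1 := by
  have h := Ideal.Quotient.eq_zero_iff_mem.2 (x_sub_one_mem h𝔫)
  rw [map_sub, map_one, map_sub, map_one] at h
  exact sub_eq_zero.1 h

/-- Both traces are the same integral polynomial expression, evaluated at `(x, x(2 + c))` and at
`(1, 2 + c)`; these points agree modulo `𝔫` because `x ≡ 1`. -/
lemma corresponds_of_dihTrace
    (h𝔫 : 𝔫.comap (algebraMap A (integralClosure A K)) = Ideal.span {x - 1})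
    {χ : (K ⊗[A] HeckeAlgebra (CoxeterMatrix.I m)) →ₗ[K] K} {φ : W → K} (c : integralClosure A K)
    (hχ : ∀ ω, χ (1 ⊗ₜ[A] heckeWord (CoxeterMatrix.I m) ω) =
      dihTrace (algebraMap A K x) (algebraMap A K x * (2 + (c : K))) ω)
    (hφ : ∀ ω, φ (cs.wordProd ω) = dihTrace 1 (2 + (c : K)) ω) : Corresponds cs 𝔫 χ φ := by
  intro ω
  let X := algebraMap A (integralClosure A K) x
  have hX : algebraMap (integralClosure A K) K X = algebraMap A K x := rfl
  have hc : algebraMap (integralClosure A K) K c = c := rfl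
  refine ⟨dihTrace X (X * (2 + c)) ω - dihTrace 1 (2 + c) ω, ?_, ?_⟩
  · have e1 := map_dihTrace (S := integralClosure A K) (S' := integralClosure A K ⧸ 𝔫)
      (Ideal.Quotient.mk 𝔫) X (X * (2 + c)) ω
    have e2 := map_dihTrace (S := integralClosure A K) (S' := integralClosure A K ⧸ 𝔫)
      (Ideal.Quotient.mk 𝔫) 1 (2 + c) ω
    rw [map_mul, mk_x_eq_one h𝔫, one_mul] at e1
    rw [map_one] at e2
    rw [← Ideal.Quotient.eq_zero_iff_mem, map_sub, sub_eq_zero]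
    exact e1.trans e2.symm
  · have h4 := map_dihTrace (algebraMap (integralClosure A K) K) X (X * (2 + c)) ω
    have h5 := map_dihTrace (algebraMap (integralClosure A K) K) 1 (2 + c) ω
    rw [map_mul, map_add, map_ofNat, hX, hc] at h4
    rw [map_one, map_add, map_ofNat, hc] at h5
    rw [hχ, hφ, ← h4, ← h5]
    exact Subalgebra.coe_sub _ _

open Classical in
/-- Every irreducible character of `W` corresponds to an irreducible character of `K H`. -/
lemma exists_corresponds (hinj : Function.Injective (algebraMap A K))
    (h𝔫 : 𝔫.comap (algebraMap A (integralClosure A K)) = Ideal.span {x - 1})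
    (hKW : IsSplitSemisimple K (MonoidAlgebra K W)) {φ : W → K} (hφ : φ ∈ irrGroup K W) :
    ∃ χ ∈ irrAlgebra K (K ⊗[A] HeckeAlgebra (CoxeterMatrix.I m)), Corresponds cs 𝔫 χ φ := by
  have := charZero_of_A_injective hinj
  have hx1 := mk_x_eq_one h𝔫
  obtain ⟨d, ρ, hρ, rfl⟩ := hφ
  have := ((isIrreducible_iff ρ).1 hρ).1
  rcases classify_of_split hKW (Nat.succ_ne_zero (m + 1)) one_ne_zero (by norm_num)
    (groupGen_isHecke cs K) (adjoin_groupGen cs) (asAlgebraHom_irreducible hρ) with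
    ⟨a, hd, ha⟩ | ⟨c, hc, b, hb⟩
  · simp only [asAlgebraHom_groupGen] at ha
    have hd1 : d = 1 := by simpa using hd
    subst hd1
    let B := integralClosure A K
    let aB : Fin 2 → B := fun i => if a i = 1 then 1 else -1
    -- The lift of a linear character: the value `1` on a reflection becomes `x`, the value `-1`
    -- stays. Both families are kept in the integral closure so that they can be reduced modulo `𝔫`.
    let aH : Fin 2 → B := fun i => if a i = 1 then algebraMap A B x else -1
    have haB : ∀ i, (aB i : K) = a i := by
      intro i
      by_cases h : a i = 1
      · simp [aB, h]
      · rcases (ha i).2 with h' | h'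
        · exact absurd h' h
        · simp only [aB, if_neg h, h']; rfl
    have hbraid : altProd a 0 (m + 2) = altProd a 1 (m + 2) := by
      have h := altProd_simple_braid cs
      have h2 : ∀ j k, ρ (altProd cs.simple j k) = altProd a j k • 1 := by
        intro j k
        rw [map_altProd]
        induction k generalizing j with
        | zero => simp
        | succ k ih => rw [altProd_succ, altProd_succ, ih, (ha j).1, smul_mul_smul_comm, one_mul]
      have h3 := congrArg (LinearMap.trace K (Fin 1 → K)) (congrArg ρ h)
      rw [h2, h2, map_smul, map_smul, trace_one] at h3
      simpa using h3
    have hquad : ∀ i, IsQuadratic x (algebraMap B K (aH i)) := by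
      intro i
      by_cases h : a i = 1
      · simp only [aH, if_pos h]
        rw [← IsScalarTower.algebraMap_apply]
        exact isQuadratic_self x
      · simp only [aH, if_neg h, map_neg, map_one]
        exact isQuadratic_neg_one x
    have hH : IsHecke (m + 2) x fun i => algebraMap B K (aH i) := by
      by_cases he : Even (m + 2)
      · exact isHecke_of_even he hquad
      · have h01 : a 0 = a 1 := by
          refine eq_of_altProd_eq (fun i => ?_) he hbraid
          rcases (ha i).2 with h | h <;> rw [h] <;> norm_num
        have : (fun i => algebraMap B K (aH i)) = fun _ => algebraMap B K (aH 0) := by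
          funext i
          fin_cases i
          · rfl
          · simp [aH, h01]
        rw [this]
        exact isHecke_const _ (hquad 0)
    refine ⟨_, linear_mem_irrAlgebra (baseLift K hH), fun ω => ?_⟩
    refine ⟨(ω.map aH).prod - (ω.map aB).prod, ?_, ?_⟩
    · rw [← Ideal.Quotient.eq_zero_iff_mem, map_sub, sub_eq_zero]
      have e1 := map_prod_map (Ideal.Quotient.mk 𝔫) (t := aH)
        (M := fun i => Ideal.Quotient.mk 𝔫 (aB i)) (fun i => by
          by_cases h : a i = 1
          · simp [aH, aB, h, hx1, B]
          · simp [aH, aB, h]) ω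
      have e2 := map_prod_map (Ideal.Quotient.mk 𝔫) (t := aB)
        (M := fun i => Ideal.Quotient.mk 𝔫 (aB i)) (fun i => rfl) ω
      exact e1.trans e2.symm
    · beta_reduce
      rw [AlgHom.toLinearMap_apply, tmul_heckeWord, map_prod_map _ (baseLift_gen K hH)]
      have h1 : ρ (cs.wordProd ω) = (ω.map a).prod • 1 := by
        rw [CoxeterSystem.wordProd, map_prod_map ρ (fun i => (ha i).1)]
        clear * -
        induction ω with
        | nil => simp
        | cons i ω ih => rw [List.map_cons, List.prod_cons, ih, List.map_cons, List.prod_cons,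
            smul_mul_smul_comm, one_mul]
      rw [h1, map_smul, trace_one, Nat.cast_one, smul_eq_mul, mul_one]
      have h2 : algebraMap B K (ω.map aB).prod = (ω.map a).prod := map_prod_map _ haB ω
      have h3 : algebraMap B K (ω.map aH).prod = (ω.map fun i => algebraMap B K (aH i)).prod :=
        map_prod_map _ (fun _ => rfl) ω
      rw [← h2, ← h3, ← map_sub]
      rfl
  · simp only [asAlgebraHom_groupGen, one_mul] at hb
    -- The condition on `c` does not involve the parameter `q`, so the same `c` defines a
    -- representation at `q = x`.
    have hbr := hc.braidSeq_eq_zero (Nat.succ_ne_zero _) (algebraMap_x_ne_zero hinj)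
    have hcint : IsIntegral A c := by
      obtain ⟨ξ, hξ, -, -, h⟩ := hc
      exact isIntegral_of_add_inv (Nat.succ_ne_zero _) hξ h
    refine ⟨_, dihRep_mem_irrAlgebra hinj (mul_ne_zero (algebraMap_x_ne_zero hinj)
      (hc.ne_neg_two (Nat.succ_ne_zero _))) hbr, corresponds_of_dihTrace cs h𝔫 ⟨c, hcint⟩
        (fun ω => ?_) fun ω => trace_eq_dihTrace b (ρ := ρ) (t := cs.simple) hb ω⟩
    rw [LinearMap.comp_apply, AlgHom.toLinearMap_apply, tmul_heckeWord]
    exact trace_eq_dihTrace (Pi.basisFun K (Fin 2)) (t := baseGen K) (ω := ω)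
      (Q := algebraMap A K x) (α := algebraMap A K x * (2 + c))
      (ρ := ((Matrix.toLinAlgEquiv'.toAlgHom.comp (dihRep K hbr) :
        K ⊗[A] HeckeAlgebra (CoxeterMatrix.I m) →ₐ[K] Module.End K (Fin 2 → K)) :
          _ →* Module.End K (Fin 2 → K))) (fun i => by
        have h3 : (Matrix.toLinAlgEquiv'.toAlgHom.comp (dihRep K hbr)) (baseGen K i) =
          Matrix.toLinAlgEquiv' (dihMat (algebraMap A K x) (algebraMap A K x * (2 + c)) i) := by
          rw [AlgHom.comp_apply, dihRep_gen]; rfl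
        exact (congrArg _ h3).trans (LinearMap.toMatrixAlgEquiv'_toLinAlgEquiv' _))

/-- The linear character of the Hecke algebra taking the same value on both generators. -/
def constChar (m : ℕ) (S : Type*) [CommRing S] [Algebra A S] {v : S} (hv : IsQuadratic x v) :
    S ⊗[A] HeckeAlgebra (CoxeterMatrix.I m) →ₐ[S] S :=
  baseLift S (isHecke_const (m + 2) hv)

lemma constChar_gen (m : ℕ) (S : Type*) [CommRing S] [Algebra A S] {v : S} (hv : IsQuadratic x v)
    (i : Fin 2) : constChar m S hv (baseGen S i) = v :=
  baseLift_gen S _ i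

/-- Modulo `𝔫` the degree `1` and the values `1 ≡ x` and `-1` remain distinguishable, since nonzero
integers are not in `𝔫`. Congruence to one of these linear characters thus forces equality, and
`eq_linear_of_congr` applies on either side of the correspondence. -/
lemma corresponds_linear_iff (hinj : Function.Injective (algebraMap A K)) [𝔫.IsPrime]
    (h𝔫 : 𝔫.comap (algebraMap A (integralClosure A K)) = Ideal.span {x - 1})
    {χ : (K ⊗[A] HeckeAlgebra (CoxeterMatrix.I m)) →ₗ[K] K} {φ : W → K}
    (hχ : χ ∈ irrAlgebra K (K ⊗[A] HeckeAlgebra (CoxeterMatrix.I m))) (hφ : φ ∈ irrGroup K W)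
    (h : Corresponds cs 𝔫 χ φ) {v u : K} (hv : IsQuadratic x v) (ψ : W →* K)
    (hψ : ∀ i, ψ (cs.simple i) = u) (hvu : v = algebraMap A K x ∧ u = 1 ∨ v = -1 ∧ u = -1) :
    χ = (constChar m K hv).toLinearMap ↔ φ = ψ := by
  have := charZero_of_A_injective hinj
  have hd𝔪 : ∀ d : ℕ, (d : K) - 1 ∈ idealSubgroup 𝔫 → d = 1 := by
    intro d hd
    have h1 : algebraMap A K ((d : A) - 1) ∈ idealSubgroup 𝔫 := by simpa using hd
    have h2 := evalOne_eq_zero_of_mem h𝔫 h1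
    rw [map_sub, map_natCast, map_one] at h2
    exact_mod_cast sub_eq_zero.1 h2
  have hq1 : algebraMap A K x + 1 ∉ idealSubgroup 𝔫 := by
    intro hd
    have h1 : algebraMap A K (x + 1) ∈ idealSubgroup 𝔫 := by simpa using hd
    have h2 := evalOne_eq_zero_of_mem h𝔫 h1
    norm_num at h2
  have hq2 : (1 : K) + 1 ∉ idealSubgroup 𝔫 := by
    intro hd
    have h1 : algebraMap A K (1 + 1) ∈ idealSubgroup 𝔫 := by rwa [map_add, map_one]
    have h2 := evalOne_eq_zero_of_mem h𝔫 h1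
    rw [map_add, map_one] at h2
    norm_num at h2
  have hvu' : v - u ∈ idealSubgroup 𝔫 := by
    rcases hvu with ⟨rfl, rfl⟩ | ⟨rfl, rfl⟩
    · exact ⟨_, x_sub_one_mem h𝔫, by simp⟩
    · rw [sub_self]; exact zero_mem _
  have h1 : χ 1 - φ 1 ∈ idealSubgroup 𝔫 := by
    have := h []
    rw [tmul_heckeWord] at this
    simpa using mem_idealSubgroup.2 this
  have hs : ∀ i, χ (baseGen K i) - φ (cs.simple i) ∈ idealSubgroup 𝔫 := fun i => by
    have := h [i]
    rw [tmul_heckeWord] at this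
    simpa using mem_idealSubgroup.2 this
  obtain ⟨d', ρ', hρ', rfl⟩ := hφ
  obtain ⟨d, ρ, hd, hρ, rfl⟩ := hχ
  constructor
  · intro hχ
    rw [hχ] at h1 hs
    have key := eq_linear_of_congr (adjoin_groupGen cs) (groupGen_isHecke cs K).quadratic
      (idealSubgroup 𝔫) hd𝔪 hq2 (v := u) (hvu.imp And.right And.right) ρ'.asAlgebraHom
      (groupAlgChar K ψ) (fun i => by rw [groupGen, groupAlgChar_single, hψ, one_mul])
      (by
        have := neg_mem h1
        simpa using this)
      (fun i => by
        rw [asAlgebraHom_groupGen]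
        have := add_mem (neg_mem (hs i)) hvu'
        rw [AlgHom.toLinearMap_apply, constChar_gen] at this
        simpa using this)
    funext w
    have hw := LinearMap.congr_fun key (MonoidAlgebra.single w 1)
    simpa [groupAlgChar_single] using hw
  · intro hφ
    refine eq_linear_of_congr (adjoin_baseGen K)
      (isHecke_algebraMap.2 (baseGen_isHecke (m := m) K)).quadratic (idealSubgroup 𝔫) hd𝔪 hq1
      (hvu.imp And.left And.left) ρ _ (constChar_gen m K hv) ?_ fun i => ?_
    · have h2 := congrFun hφ 1
      simp only [map_one] at h2 h1
      simpa [h2] using h1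
    · have h2 := congrFun hφ (cs.simple i)
      simp only [hψ] at h2
      have h3 := hs i
      beta_reduce at h3
      rw [h2] at h3
      have := sub_mem h3 hvu'
      simpa using this

end Correspondence

end HeckeFamilies

end

noncomputable section

namespace HeckeFamilies

/-! ### Central idempotents attached to linear characters -/

section Idempotents

variable {R : Type*} [Ring R]

lemma IsCentralIdempotent.map {R' F : Type*} [Ring R'] [FunLike F R R'] [RingHomClass F R R']
    {f : R} (hf : IsCentralIdempotent f) (θ : F) : θ f * θ f = θ f := by
  rw [← map_mul, hf.1]

lemma IsCentralIdempotent.mul {e f : R} (he : IsCentralIdempotent e) (hf : IsCentralIdempotent f) :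
    IsCentralIdempotent (e * f) := by
  refine ⟨?_, fun r => by rw [mul_assoc, hf.2, ← mul_assoc, he.2, mul_assoc]⟩
  rw [mul_assoc, ← mul_assoc f, ← he.2 f, mul_assoc e f f, hf.1, ← mul_assoc, he.1]

lemma IsCentralIdempotent.one_sub_sub {e f : R} (he : IsCentralIdempotent e)
    (hf : IsCentralIdempotent f) (hef : e * f = 0) : IsCentralIdempotent (1 - e - f) := by
  have hfe : f * e = 0 := by rw [← he.2, hef]
  refine ⟨?_, fun r => by rw [sub_mul, sub_mul, mul_sub, mul_sub, he.2, hf.2, one_mul, mul_one]⟩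
  simp only [sub_mul, mul_sub, one_mul, mul_one, he.1, hf.1, hef, hfe]
  abel

lemma eq_zero_or_one_of_mul_self {O : Type*} [CommRing O] [IsDomain O] {a : O} (h : a * a = a) :
    a = 0 ∨ a = 1 := by
  have : a * (a - 1) = 0 := by linear_combination h
  exact (mul_eq_zero.1 this).imp_right sub_eq_zero.1

/-- If finitely many block idempotents add up to `1`, they are all the block idempotents. -/
lemma isBlockIdempotent_iff_of_sum {ι : Type*} {s : Finset ι} {e : ι → R}
    (he : ∀ i ∈ s, IsBlockIdempotent (e i)) (hsum : ∑ i ∈ s, e i = 1) {f : R} :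
    IsBlockIdempotent f ↔ ∃ i ∈ s, f = e i := by
  refine ⟨fun hf => ?_, fun ⟨i, hi, h⟩ => h ▸ he i hi⟩
  by_contra hcon
  push Not at hcon
  apply hf.2.1
  rw [← mul_one f, ← hsum, Finset.mul_sum]
  refine Finset.sum_eq_zero fun i hi => ?_
  have hc := hf.1.mul (he i hi).1
  by_contra h0
  apply hcon i hi
  have h1 := ((he i hi).2.2 _ hc (by rw [mul_assoc, (he i hi).1.1])).resolve_left h0
  have h2 := (hf.2.2 _ hc (by rw [mul_assoc, (he i hi).1.2, ← mul_assoc, hf.1.1])).resolve_left h0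
  rw [← h1, h2]

/-- `e` is the idempotent of the linear character `χ`. -/
def IsCharIdempotent {O : Type*} [CommRing O] [Algebra O R] (χ : R →ₐ[O] O) (e : R) : Prop :=
  χ e = 1 ∧ ∀ h, h * e = χ h • e ∧ e * h = χ h • e

lemma IsCharIdempotent.isCentralIdempotent {O : Type*} [CommRing O] [Algebra O R]
    {χ : R →ₐ[O] O} {e : R} (h : IsCharIdempotent χ e) : IsCentralIdempotent e :=
  ⟨by rw [(h.2 e).1, h.1, one_smul], fun r => by rw [(h.2 r).1, (h.2 r).2]⟩

/-- For a central idempotent `f`, `f e = χ(f) e`, and `χ(f)` is an idempotent of a domain. -/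
lemma IsCharIdempotent.isBlockIdempotent {O : Type*} [CommRing O] [IsDomain O] [Algebra O R]
    {χ : R →ₐ[O] O} {e : R} (h : IsCharIdempotent χ e) : IsBlockIdempotent e := by
  refine ⟨h.isCentralIdempotent, ?_, fun f hf hfe => ?_⟩
  · rintro rfl
    exact zero_ne_one ((map_zero χ).symm.trans h.1)
  · rw [← hfe, (h.2 f).1]
    rcases eq_zero_or_one_of_mul_self (hf.map χ) with h0 | h0
    · left; rw [h0, zero_smul]
    · right; rw [h0, one_smul]

lemma isCharIdempotent_of_gen {O : Type*} [CommRing O] [Algebra O R] {χ : R →ₐ[O] O} {t : Fin 2 → R}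
    (hgen : Algebra.adjoin O (Set.range t) = ⊤) {e : R} (he : χ e = 1)
    (h : ∀ i, t i * e = χ (t i) • e ∧ e * t i = χ (t i) • e) : IsCharIdempotent χ e := by
  refine ⟨he, fun r => ?_⟩
  have hr : r ∈ Algebra.adjoin O (Set.range t) := by rw [hgen]; trivial
  induction hr using Algebra.adjoin_induction with
  | mem y hy =>
    obtain ⟨i, rfl⟩ := hy
    exact h i
  | algebraMap c =>
    rw [AlgHom.commutes, ← Algebra.commutes, ← Algebra.smul_def]
    exact ⟨rfl, rfl⟩
  | add a b _ _ ha hb =>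
    rw [map_add, add_smul, add_mul, mul_add, ha.1, ha.2, hb.1, hb.2]
    exact ⟨rfl, rfl⟩
  | mul a b _ _ ha hb =>
    rw [map_mul, mul_assoc, hb.1, mul_smul_comm, ha.1, ← mul_assoc, ha.2, smul_mul_assoc, hb.2,
      smul_smul, smul_smul, mul_comm (χ b)]
    exact ⟨rfl, rfl⟩

end Idempotents

/-! ### The idempotents of the index and sign characters -/

section LinearIdempotents

variable (m : ℕ) (S : Type*) [CommRing S] [Algebra A S]

/-- The character `T_i ↦ x`. -/
def indexChar : S ⊗[A] HeckeAlgebra (CoxeterMatrix.I m) →ₐ[S] S :=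
  constChar m S (isQuadratic_self x)

/-- The character `T_i ↦ -1`. -/
def heckeSignChar : S ⊗[A] HeckeAlgebra (CoxeterMatrix.I m) →ₐ[S] S :=
  constChar m S (isQuadratic_neg_one x)

@[simp] lemma indexChar_gen (i : Fin 2) : indexChar m S (baseGen S i) = algebraMap A S x :=
  constChar_gen m S _ i

@[simp] lemma heckeSignChar_gen (i : Fin 2) : heckeSignChar m S (baseGen S i) = -1 :=
  constChar_gen m S _ i

/-- The Poincaré polynomial of the dihedral group of order `2 (m + 2)`. -/
def poincare : A := (x + 1) * ∑ j ∈ Finset.range (m + 2), x ^ j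

variable {S}

lemma altKL_x : altKL (fun _ => algebraMap A S x) 0 (m + 2) = algebraMap A S (poincare m) := by
  rw [altKL_const, poincare]; simp

/-- Generators act on `C_{w₀}` by `x` on both sides, and the index character sends it to the
Poincaré polynomial; the idempotent is the normalized `C_{w₀}`. -/
lemma exists_index_idempotent {u : S} (hu : u * algebraMap A S (poincare m) = 1) :
    ∃ e, IsCharIdempotent (indexChar m S) e ∧ heckeSignChar m S e = 0 := by
  have hH := (isHecke_algebraMap (S := S)).2 (baseGen_isHecke (m := m) S)
  refine ⟨u • altKL (baseGen S) 0 (m + 2),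
    isCharIdempotent_of_gen (adjoin_baseGen S) ?_ fun i => ⟨?_, ?_⟩, ?_⟩
  · rw [map_smul, map_altKL]
    simp only [indexChar_gen]
    rw [altKL_x, smul_eq_mul, hu]
  · rw [mul_smul_comm, hH.mul_longest, indexChar_gen, smul_comm]
  · rw [smul_mul_assoc, hH.longest_mul, indexChar_gen, smul_comm]
  · rw [map_smul, map_altKL]
    simp only [heckeSignChar_gen]
    rw [altKL_neg_one, smul_zero]

/-- The same construction for the generators `x - 1 - T_i`, an exchange that swaps the values `x`
and `-1`. -/
lemma exists_sign_idempotent {u : S} (hu : u * algebraMap A S (poincare m) = 1) :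
    ∃ e, IsCharIdempotent (heckeSignChar m S) e ∧ indexChar m S e = 0 := by
  have hH := ((isHecke_algebraMap (S := S)).2 (baseGen_isHecke (m := m) S)).dual (isUnit_x.map (algebraMap A S))
  have key : ∀ i, (baseGen (m := m) S i) = algebraMap S _ (algebraMap A S x - 1) -
      (algebraMap S _ (algebraMap A S x - 1) - baseGen S i) := fun i => by abel
  refine ⟨u • altKL (fun i => algebraMap S _ (algebraMap A S x - 1) - baseGen S i) 0 (m + 2),
    isCharIdempotent_of_gen (adjoin_baseGen S) ?_ fun i => ⟨?_, ?_⟩, ?_⟩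
  · rw [map_smul, map_altKL]
    simp only [map_sub, heckeSignChar_gen, AlgHom.commutes, Algebra.algebraMap_self, RingHom.id_apply,
      map_one, sub_neg_eq_add, sub_add_cancel]
    rw [altKL_x, smul_eq_mul, hu]
  · rw [mul_smul_comm, heckeSignChar_gen, smul_comm]
    congr 1
    conv_lhs => rw [key i]
    rw [sub_mul, hH.mul_longest, ← Algebra.smul_def, ← sub_smul]
    congr 1
    ring
  · rw [smul_mul_assoc, heckeSignChar_gen, smul_comm]
    congr 1
    conv_lhs => rw [key i]
    rw [mul_sub, hH.longest_mul, ← Algebra.commutes, ← Algebra.smul_def, ← sub_smul]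
    congr 1
    ring
  · rw [map_smul, map_altKL]
    simp only [map_sub, indexChar_gen, AlgHom.commutes, Algebra.algebraMap_self, RingHom.id_apply,
      map_one, sub_sub_cancel_left]
    rw [altKL_neg_one, smul_zero]

/-- The constant term is `1`, which makes the Poincaré polynomial one of the denominators allowed in
`𝒪`. -/
lemma exists_poincare_eq : ∃ P, poincare m = unitPoly P := by
  refine ⟨1 + (1 + Polynomial.X) * ∑ j ∈ Finset.range (m + 1), Polynomial.X ^ j, ?_⟩
  have hX : Polynomial.toLaurent (Polynomial.X : ℤ[X]) = x := Polynomial.toLaurent_X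
  simp only [poincare, unitPoly, map_add, map_mul, map_one, map_sum, map_pow, hX]
  rw [Finset.sum_range_succ']
  simp only [pow_succ, pow_zero, ← Finset.sum_mul]
  ring

lemma exists_mul_poincare {K : Type*} [Field K] [Algebra A K]
    (hinj : Function.Injective (algebraMap A K)) :
    ∃ u : ringO K, u * algebraMap A (ringO K) (poincare m) = 1 := by
  obtain ⟨P, hP⟩ := exists_poincare_eq m
  refine ⟨⟨_, inv_unitPoly_mem P⟩, Subtype.ext ?_⟩
  rw [hP]
  refine inv_mul_cancel₀ ?_
  rw [Ne, map_eq_zero_iff _ hinj]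
  intro h
  exact unitPoly_ne_zero P ℚ (by rw [h, map_zero])

end LinearIdempotents

/-! ### Values of central idempotents and congruences between representations -/

section CentralValues

variable {m : ℕ} {S : Type*} [CommRing S] [Algebra A S]

/-- A matrix commuting with both `dihMat` is scalar as soon as `1 + x` is not a zero divisor, and a
scalar idempotent in a domain is `0` or `1`. -/
lemma dihRep_central [IsDomain S] (hQ : 1 + algebraMap A S x ≠ 0) {α : S}
    (h : braidSeq (algebraMap A S x) α (m + 2) = 0)
    {f : S ⊗[A] HeckeAlgebra (CoxeterMatrix.I m)} (hf : IsCentralIdempotent f) :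
    ∃ p : S, (p = 0 ∨ p = 1) ∧ dihRep S h f = p • 1 := by
  set Q := algebraMap A S x
  have hcomm : ∀ i, dihRep S h f * dihMat Q α i = dihMat Q α i * dihRep S h f := fun i => by
    rw [← dihRep_gen S h, ← map_mul, hf.2, map_mul]
  have hidem := hf.map (dihRep S h)
  set M := dihRep S h f
  have h1 := hcomm 1
  have h0 := hcomm 0
  rw [← Matrix.ext_iff] at h0 h1 hidem
  have e100 := h1 0 0
  have e110 := h1 1 0
  have e011 := h0 1 0
  have hid := hidem 0 0
  simp [Matrix.mul_apply, Fin.sum_univ_two] at e100 e110 e011 hid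
  have h01 : M 0 1 = 0 := by linear_combination e100
  have h10 : M 1 0 = 0 := by
    have : M 1 0 * (1 + Q) = 0 := by linear_combination e011
    exact (mul_eq_zero.1 this).resolve_right hQ
  have h11 : M 1 1 = M 0 0 := by rw [h10] at e110; linear_combination e110
  rw [h01, zero_mul, add_zero] at hid
  refine ⟨M 0 0, eq_zero_or_one_of_mul_self hid, ?_⟩
  ext i j
  fin_cases i <;> fin_cases j <;> simp [h01, h10, h11]

/-- The values `0` and `1` differ by a unit, so they are never congruent modulo a nonunit. -/
lemma eq_of_sub_mem {O : Type*} [CommRing O] {y p p' : O} (hy : ¬ IsUnit y) (hp : p = 0 ∨ p = 1)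
    (hp' : p' = 0 ∨ p' = 1) (h : p - p' ∈ Ideal.span {y}) : p = p' := by
  by_contra hne
  apply hy
  rw [← Ideal.span_singleton_eq_top, Ideal.eq_top_iff_one]
  rcases hp with rfl | rfl <;> rcases hp' with rfl | rfl
  · exact absurd rfl hne
  · simpa using neg_mem h
  · simpa using h
  · exact absurd rfl hne

/-- Two members of the family of two-dimensional representations that are congruent modulo a
nonunit take the same value on a central idempotent. -/
lemma dihRep_eq_dihRep {c c' p p' : S} (hcc : ¬ IsUnit (c - c'))
    (h : braidSeq (algebraMap A S x) (algebraMap A S x * (2 + c)) (m + 2) = 0)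
    (h' : braidSeq (algebraMap A S x) (algebraMap A S x * (2 + c')) (m + 2) = 0)
    {f : S ⊗[A] HeckeAlgebra (CoxeterMatrix.I m)} (hp : p = 0 ∨ p = 1) (hp' : p' = 0 ∨ p' = 1)
    (hf : dihRep S h f = p • 1) (hf' : dihRep S h' f = p' • 1) : p = p' := by
  refine eq_of_sub_mem hcc hp hp' ?_
  let I := Ideal.span {c - c'}
  let θ : Matrix (Fin 2) (Fin 2) S →ₐ[S] Matrix (Fin 2) (Fin 2) (S ⧸ I) :=
    (Ideal.Quotient.mkₐ S I).mapMatrix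
  have hc : Ideal.Quotient.mk I c = Ideal.Quotient.mk I c' :=
    Ideal.Quotient.eq.2 (Ideal.mem_span_singleton_self _)
  -- Modulo `c - c'` the generators have the same matrices.
  have key : θ.comp (dihRep S h) = θ.comp (dihRep S h') := baseHom_ext fun i => by
    rw [AlgHom.comp_apply, AlgHom.comp_apply, dihRep_gen, dihRep_gen]
    have e := fun c : S => map_dihMat (S' := S ⧸ I) (Ideal.Quotient.mk I) (algebraMap A S x)
      (algebraMap A S x * (2 + c)) i
    have e1 := e c
    have e2 := e c'
    rw [map_mul, map_add, hc] at e1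
    rw [map_mul, map_add] at e2
    exact e1.trans e2.symm
  have h1 := DFunLike.congr_fun key f
  rw [AlgHom.comp_apply, AlgHom.comp_apply, hf, hf'] at h1
  have hs : ∀ p : S, θ (p • 1) 0 0 = Ideal.Quotient.mk I p := fun p => by
    change Ideal.Quotient.mk I ((p • (1 : Matrix (Fin 2) (Fin 2) S)) 0 0) = _
    simp
  have h3 : Ideal.Quotient.mk I p = Ideal.Quotient.mk I p' := by rw [← hs, ← hs, h1]
  exact Ideal.Quotient.eq.1 h3

/-- A two-dimensional representation that is triangular modulo a nonunit takes the same value on a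
central idempotent as its diagonal constituents. -/
lemma dihRep_eq_baseLift {c p p' : S} (hc : ¬ IsUnit (2 + c))
    (h : braidSeq (algebraMap A S x) (algebraMap A S x * (2 + c)) (m + 2) = 0)
    {a : Fin 2 → S} (ha : IsHecke (m + 2) x a)
    (ha' : a 0 = algebraMap A S x ∧ a 1 = -1 ∨ a 0 = -1 ∧ a 1 = algebraMap A S x)
    {f : S ⊗[A] HeckeAlgebra (CoxeterMatrix.I m)} (hp : p = 0 ∨ p = 1) (hp' : p' = 0 ∨ p' = 1)
    (hf : dihRep S h f = p • 1) (hf' : baseLift S ha f = p') : p = p' := by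
  refine eq_of_sub_mem hc hp hp' ?_
  let I := Ideal.span {2 + c}
  let θ : Matrix (Fin 2) (Fin 2) S →ₐ[S] Matrix (Fin 2) (Fin 2) (S ⧸ I) :=
    (Ideal.Quotient.mkₐ S I).mapMatrix
  have hα : Ideal.Quotient.mk I (algebraMap A S x * (2 + c)) = 0 := by
    rw [map_mul, Ideal.Quotient.eq_zero_iff_mem.2 (Ideal.mem_span_singleton_self _), mul_zero]
  -- The diagonals of the two matrices are `(x, -1)` and `(-1, x)`; each position carries one mixed
  -- character.
  obtain ⟨j, hj⟩ : ∃ j : Fin 2, ∀ i, dihMat (algebraMap A S x) (algebraMap A S x * (2 + c)) i j j =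
      a i := by
    rcases ha' with ⟨h0, h1⟩ | ⟨h0, h1⟩
    · refine ⟨0, fun i => ?_⟩
      fin_cases i <;> simp [h0, h1]
    · refine ⟨1, fun i => ?_⟩
      fin_cases i <;> simp [h0, h1]
  -- Modulo `2 + c` the upper right entries vanish, so taking a diagonal entry is multiplicative.
  have key : ∀ z, θ (dihRep S h z) 0 1 = 0 ∧
      θ (dihRep S h z) j j = Ideal.Quotient.mk I (baseLift S ha z) := by
    intro z
    have hz : z ∈ Algebra.adjoin S (Set.range (baseGen (m := m) S)) := by
      rw [adjoin_baseGen]; trivial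
    induction hz using Algebra.adjoin_induction with
    | mem y hy =>
      obtain ⟨i, rfl⟩ := hy
      rw [dihRep_gen, baseLift_gen, ← hj i]
      refine ⟨?_, rfl⟩
      change Ideal.Quotient.mk I (dihMat _ _ i 0 1) = 0
      fin_cases i
      · exact hα
      · simp
    | algebraMap r =>
      rw [AlgHom.commutes, AlgHom.commutes, AlgHom.commutes]
      refine ⟨by simp [Matrix.algebraMap_matrix_apply], ?_⟩
      rw [Matrix.algebraMap_matrix_apply, if_pos rfl]
      rfl
    | add u v _ _ hu hv =>
      rw [map_add, map_add, map_add, map_add, Matrix.add_apply, Matrix.add_apply, hu.1, hu.2, hv.1,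
        hv.2]
      simp
    | mul u v _ _ hu hv =>
      rw [map_mul, map_mul, map_mul, map_mul, Matrix.mul_apply, Matrix.mul_apply, ← hu.2, ← hv.2,
        Fin.sum_univ_two, Fin.sum_univ_two, hu.1, hv.1]
      refine ⟨by simp, ?_⟩
      fin_cases j <;> simp [hu.1, hv.1]
  have h2 := (key f).2
  rw [hf, hf'] at h2
  have h3 : Ideal.Quotient.mk I p = Ideal.Quotient.mk I p' := by
    rw [← h2]
    change _ = Ideal.Quotient.mk I ((p • (1 : Matrix (Fin 2) (Fin 2) S)) j j)
    simp
  exact Ideal.Quotient.eq.1 h3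

end CentralValues

end HeckeFamilies

end

noncomputable section

namespace HeckeFamilies

/-! ### Constancy of central idempotents on the remaining characters -/

section BlockConstancy

variable {m : ℕ} {K : Type*} [Field K] [Algebra A K]

/-- The extension of scalars from `𝒪` to `K`. -/
abbrev extendO (m : ℕ) (K : Type*) [Field K] [Algebra A K] :
    ringO K ⊗[A] HeckeAlgebra (CoxeterMatrix.I m) →ₐ[A] K ⊗[A] HeckeAlgebra (CoxeterMatrix.I m) :=
  Algebra.TensorProduct.map (ringO K).val (AlgHom.id A (HeckeAlgebra (CoxeterMatrix.I m)))

/-- The Hecke algebra is free over `A`, hence flat, so `𝒪 H` embeds in `K H`. -/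
lemma extendO_injective {W : Type*} [Group W] (cs : CoxeterSystem (CoxeterMatrix.I m) W) :
    Function.Injective (extendO m K) := by
  have : Module.Free A (HeckeAlgebra (CoxeterMatrix.I m)) := Module.Free.of_basis (heckeBasis cs)
  exact Module.Flat.rTensor_preserves_injective_linearMap
    (M := HeckeAlgebra (CoxeterMatrix.I m)) (ringO K).val.toLinearMap Subtype.val_injective

lemma extendO_gen (i : Fin 2) : extendO m K (baseGen (ringO K) i) = baseGen K i := by
  rw [extendO, baseGen, Algebra.TensorProduct.map_tmul, map_one]; rfl

lemma extendO_smul (s : ringO K) (z : ringO K ⊗[A] HeckeAlgebra (CoxeterMatrix.I m)) :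
    extendO m K (s • z) = (s : K) • extendO m K z := by
  induction z using TensorProduct.induction_on with
  | zero => simp
  | add a b ha hb => rw [smul_add, map_add, ha, hb, map_add, smul_add]
  | tmul t h =>
    rw [TensorProduct.smul_tmul', extendO, Algebra.TensorProduct.map_tmul,
      Algebra.TensorProduct.map_tmul, TensorProduct.smul_tmul']
    rfl

lemma baseLift_extendO {a : Fin 2 → ringO K} {a' : Fin 2 → K} (ha : IsHecke (m + 2) x a)
    (ha' : IsHecke (m + 2) x a') (h : ∀ i, (a i : K) = a' i)
    (z : ringO K ⊗[A] HeckeAlgebra (CoxeterMatrix.I m)) :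
    baseLift K ha' (extendO m K z) = baseLift (ringO K) ha z :=
  (map_baseLift ha ha' (ringO K).val (ringO K).val (fun _ => rfl) h z).symm

lemma dihRep_extendO {c : ringO K}
    (h : braidSeq (algebraMap A (ringO K) x) (algebraMap A (ringO K) x * (2 + c)) (m + 2) = 0)
    (h' : braidSeq (algebraMap A K x) (algebraMap A K x * (2 + (c : K))) (m + 2) = 0)
    {f : ringO K ⊗[A] HeckeAlgebra (CoxeterMatrix.I m)} {p : ringO K}
    (hf : dihRep (ringO K) h f = p • 1) : dihRep K h' (extendO m K f) = (p : K) • 1 := by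
  have h1 := map_baseLift (dihMat_isHecke h) (dihMat_isHecke h') (ringO K).val
    ((ringO K).val.mapMatrix (m := Fin 2))
    (fun s => by
      ext i j
      fin_cases i <;> fin_cases j <;> simp [Matrix.algebraMap_matrix_apply])
    (fun i => map_dihMat (algebraMap (ringO K) K) _ _ i) f
  refine h1.symm.trans ?_
  have h2 : baseLift (ringO K) (dihMat_isHecke h) f = p • 1 := hf
  rw [h2]
  ext i j
  fin_cases i <;> fin_cases j <;> simp

/-- The values of a central element `f` of `𝒪 H` in the irreducible representations, other than
`T_i ↦ x` and `T_i ↦ -1`, attached to the root of unity `ξ`. -/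
def centralValues (f : ringO K ⊗[A] HeckeAlgebra (CoxeterMatrix.I m)) (ξ : AlgebraicClosure K) :
    Set (ringO K) :=
  {p | (ξ ≠ -1 ∧ ∃ (c : ringO K) (h : braidSeq (algebraMap A (ringO K) x)
      (algebraMap A (ringO K) x * (2 + c)) (m + 2) = 0),
      algebraMap K (AlgebraicClosure K) c = ξ + ξ⁻¹ ∧ dihRep (ringO K) h f = p • 1) ∨
    (ξ = -1 ∧ ∃ (a : Fin 2 → ringO K) (h : IsHecke (m + 2) x a),
      (a 0 = algebraMap A (ringO K) x ∧ a 1 = -1 ∨ a 0 = -1 ∧ a 1 = algebraMap A (ringO K) x) ∧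
      baseLift (ringO K) h f = p)}

variable {f : ringO K ⊗[A] HeckeAlgebra (CoxeterMatrix.I m)}

lemma one_add_x_ne_zero_ringO (hinj : Function.Injective (algebraMap A K)) :
    1 + algebraMap A (ringO K) x ≠ 0 := fun h =>
  one_add_algebraMap_x_ne_zero hinj (congrArg Subtype.val h)

lemma eq_zero_or_one_of_mem_centralValues (hinj : Function.Injective (algebraMap A K))
    (hf : IsCentralIdempotent f) {ξ : AlgebraicClosure K} {p : ringO K}
    (hp : p ∈ centralValues f ξ) : p = 0 ∨ p = 1 := by
  rcases hp with ⟨-, c, h, -, hp⟩ | ⟨-, a, h, -, rfl⟩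
  · obtain ⟨p', hp', h2⟩ := dihRep_central (one_add_x_ne_zero_ringO hinj) h hf
    rw [hp] at h2
    have h3 : p = p' := by simpa using congrFun (congrFun h2 0) 0
    rwa [h3]
  · exact eq_zero_or_one_of_mul_self (hf.map (baseLift (ringO K) h))

lemma braidSeq_ringO {Q : A} {c : ringO K} {n : ℕ}
    (h : braidSeq (algebraMap A K Q) (algebraMap A K Q * (2 + (c : K))) n = 0) :
    braidSeq (algebraMap A (ringO K) Q) (algebraMap A (ringO K) Q * (2 + c)) n = 0 := by
  apply Subtype.val_injective (p := (· ∈ ringO K))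
  exact (map_braidSeq (algebraMap (ringO K) K) _ _ n).trans h

lemma even_of_neg_one_pow {L : Type*} [Field L] [CharZero L] {n : ℕ} (h : (-1 : L) ^ n = 1) :
    Even n := by
  by_contra hn
  rw [Nat.not_even_iff_odd] at hn
  rw [hn.neg_one_pow] at h
  norm_num at h

/-- For `ξ ≠ -1` splitness of `K[W]` puts `ξ + ξ⁻¹` in `K`, where it is integral. If `ξ = -1`, then
`n` is even and the mixed characters exist. -/
lemma centralValues_nonempty {W : Type*} [Group W] (cs : CoxeterSystem (CoxeterMatrix.I m) W)
    (hinj : Function.Injective (algebraMap A K)) (hKW : IsSplitSemisimple K (MonoidAlgebra K W))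
    (hf : IsCentralIdempotent f) {ξ : AlgebraicClosure K} (hξ : ξ ^ (m + 2) = 1) (hξ1 : ξ ≠ 1) :
    (centralValues f ξ).Nonempty := by
  have := charZero_of_A_injective hinj
  have : CharZero (AlgebraicClosure K) :=
    charZero_of_injective_algebraMap (algebraMap K (AlgebraicClosure K)).injective
  by_cases h : ξ = -1
  · subst h
    have ha : IsHecke (m + 2) x ![algebraMap A (ringO K) x, -1] :=
      isHecke_of_even (even_of_neg_one_pow hξ) fun i => by
        fin_cases i
        · exact isQuadratic_self x
        · exact isQuadratic_neg_one x
    exact ⟨_, Or.inr ⟨rfl, _, ha, Or.inl ⟨rfl, rfl⟩, rfl⟩⟩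
  · obtain ⟨c, hc⟩ := exists_eq_add_inv cs hKW hξ
    have hcO : c ∈ ringO K :=
      integralClosure_le_ringO (isIntegral_of_add_inv (Nat.succ_ne_zero _) hξ hc)
    have hbr := braidSeq_ringO (c := ⟨c, hcO⟩) (IsDihedralParam.braidSeq_eq_zero
      (Nat.succ_ne_zero (m + 1)) ⟨ξ, hξ, hξ1, h, hc⟩ (algebraMap_x_ne_zero hinj))
    obtain ⟨p, -, hp⟩ := dihRep_central (one_add_x_ne_zero_ringO hinj) hbr hf
    exact ⟨p, Or.inl ⟨h, _, hbr, hc, hp⟩⟩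

/-- The case where both roots are `-1` is left out because two mixed characters are not compared
with each other directly, only through a two-dimensional representation. -/
lemma eq_of_mem_centralValues (hinj : Function.Injective (algebraMap A K))
    (hf : IsCentralIdempotent f) {ξ η : AlgebraicClosure K} (hξ : ξ ^ (m + 2) = 1)
    (hηn : η ^ (m + 2) = 1) (hη : IsPrimePowRoot η) (hne : ξ ≠ -1 ∨ ξ * η ≠ -1) {p p' : ringO K}
    (hp : p ∈ centralValues f ξ) (hp' : p' ∈ centralValues f (ξ * η)) : p = p' := by
  have hp01 := eq_zero_or_one_of_mem_centralValues hinj hf hp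
  have hp01' := eq_zero_or_one_of_mem_centralValues hinj hf hp'
  have hunit : ∀ {c c' : ringO K}, algebraMap K (AlgebraicClosure K) c = ξ + ξ⁻¹ →
      algebraMap K (AlgebraicClosure K) c' = ξ * η + (ξ * η)⁻¹ → ¬ IsUnit (c - c') := by
    intro c c' hc hc' hu
    obtain ⟨o, ho⟩ := hu.exists_right_inv
    exact sub_mul_ne_one hinj (Nat.succ_ne_zero _) hξ hηn hη hc hc' o.2 (congrArg Subtype.val ho)
  -- Since `-2 = (-1) + (-1)⁻¹`, the mixed characters behave like the parameter `c = -2`, and `2 +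
  -- c` is again a difference of parameters.
  have htwo : algebraMap K (AlgebraicClosure K) ((-2 : ringO K) : K) =
      (-1 : AlgebraicClosure K) + (-1)⁻¹ := by
    have : ((-2 : ringO K) : K) = -2 := rfl
    rw [this, map_neg, map_ofNat, inv_neg, inv_one]
    norm_num
  rcases hp with ⟨h1, c, hc, hcξ, hpc⟩ | ⟨h1, a, ha, haa, hpa⟩ <;>
    rcases hp' with ⟨h2, c', hc', hcξ', hpc'⟩ | ⟨h2, a', ha', haa', hpa'⟩
  · exact dihRep_eq_dihRep (hunit hcξ hcξ') hc hc' hp01 hp01' hpc hpc'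
  · refine dihRep_eq_baseLift (fun hu => ?_) hc ha' haa' hp01 hp01' hpc hpa'
    refine hunit (c' := -2) hcξ (by rw [h2]; exact htwo) ?_
    rwa [sub_neg_eq_add, add_comm]
  · refine (dihRep_eq_baseLift (fun hu => ?_) hc' ha haa hp01' hp01 hpc' hpa).symm
    refine hunit (c := -2) (by rw [h1]; exact htwo) hcξ' ?_
    have h3 : (-2 - c' : ringO K) = -(2 + c') := by ring
    rw [h3]
    exact hu.neg
  · exact absurd h2 (hne.resolve_left (not_not.2 h1))

/-- A central idempotent of `𝒪 H` takes the same value in all the irreducible representations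
other than `T_i ↦ x` and `T_i ↦ -1`. -/
lemma exists_centralValue {W : Type*} [Group W] (cs : CoxeterSystem (CoxeterMatrix.I m) W)
    (hinj : Function.Injective (algebraMap A K)) (hKW : IsSplitSemisimple K (MonoidAlgebra K W))
    (hm : 1 ≤ m) (hf : IsCentralIdempotent f) : ∃ p : ringO K, (p = 0 ∨ p = 1) ∧
      ∀ ξ : AlgebraicClosure K, ξ ^ (m + 2) = 1 → ξ ≠ 1 → ∀ p' ∈ centralValues f ξ, p' = p := by
  have := charZero_of_A_injective hinj
  have : CharZero (AlgebraicClosure K) :=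
    charZero_of_injective_algebraMap (algebraMap K (AlgebraicClosure K)).injective
  -- The whole set of values is the invariant function. At `-1` it might have two elements a priori;
  -- comparison with a root other than `-1` makes it a singleton.
  have hg : ∀ ξ η : AlgebraicClosure K, ξ ^ (m + 2) = 1 → η ^ (m + 2) = 1 → ξ ≠ 1 → ξ * η ≠ 1 →
      IsPrimePowRoot η → centralValues f ξ = centralValues f (ξ * η) := by
    intro ξ η hξ hη hξ1 hξη1 hηp
    by_cases hne : ξ ≠ -1 ∨ ξ * η ≠ -1
    · have hξη : (ξ * η) ^ (m + 2) = 1 := by rw [mul_pow, hξ, hη, one_mul]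
      obtain ⟨p, hp⟩ := centralValues_nonempty cs hinj hKW hf hξ hξ1
      obtain ⟨p', hp'⟩ := centralValues_nonempty cs hinj hKW hf hξη hξη1
      have key := fun {p p'} => eq_of_mem_centralValues (p := p) (p' := p') hinj hf hξ hη hηp hne
      ext r
      exact ⟨fun hr => key hr hp' ▸ hp', fun hr => key hp hr ▸ hp⟩
    · push Not at hne
      have h2 := hne.2
      rw [hne.1] at h2 ⊢
      rw [h2]
  obtain ⟨ζ, hζ⟩ := HasEnoughRootsOfUnity.exists_primitiveRoot (AlgebraicClosure K) (m + 2)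
  have hζ1 : ζ ≠ 1 := hζ.ne_one (by omega)
  -- Here `n ≥ 3` guarantees a root other than `±1`, hence a two-dimensional representation to
  -- anchor the value.
  have hζ2 : ζ ≠ -1 := by
    intro h
    have : ζ ^ 2 = 1 := by rw [h]; norm_num
    have := Nat.le_of_dvd two_pos (hζ.dvd_of_pow_eq_one 2 this)
    omega
  obtain ⟨p, hp⟩ := centralValues_nonempty cs hinj hKW hf hζ.pow_eq_one hζ1
  refine ⟨p, eq_zero_or_one_of_mem_centralValues hinj hf hp, fun ξ hξ hξ1 p' hp' => ?_⟩
  rw [eq_of_invariant (Nat.succ_ne_zero (m + 1)) hg hξ hξ1 hζ.pow_eq_one hζ1] at hp'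
  -- Taking `η = 1`, with exponent `2 ^ 0`, shows that the value at `ζ` is unique.
  refine eq_of_mem_centralValues hinj hf (η := 1) hζ.pow_eq_one (one_pow _)
    ⟨2, 0, Nat.prime_two, one_pow _⟩ (Or.inl hζ2) hp' ?_
  rwa [mul_one]

lemma exists_ringO_lift {a : Fin 2 → K}
    (h : IsHecke (m + 2) x a) (ha : ∀ i, a i = algebraMap A K x ∨ a i = -1) :
    ∃ b : Fin 2 → ringO K, IsHecke (m + 2) x b ∧ (∀ i, (b i : K) = a i) ∧
      ∀ i, b i = algebraMap A (ringO K) x ∨ b i = -1 := by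
  have hb : ∀ i, ∃ b : ringO K, (b : K) = a i ∧ (b = algebraMap A (ringO K) x ∨ b = -1) := by
    intro i
    rcases ha i with h | h
    · exact ⟨algebraMap A (ringO K) x, h.symm, Or.inl rfl⟩
    · exact ⟨-1, by rw [h]; rfl, Or.inr rfl⟩
  choose b hb using hb
  refine ⟨b, ?_, fun i => (hb i).1, fun i => (hb i).2⟩
  refine IsHecke.of_injective (ringO K).val Subtype.val_injective ?_
  have : (fun i => (ringO K).val (b i)) = a := funext fun i => (hb i).1
  rwa [this]

-- Equality of the two generators' images singles out the characters `T_i ↦ x` and `T_i ↦ -1`, on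
-- which `f` vanishes by hypothesis. All other irreducible representations occur in `centralValues`
-- and share one value.
open Classical in
lemma central_action {W : Type*} [Group W] (cs : CoxeterSystem (CoxeterMatrix.I m) W)
    (hinj : Function.Injective (algebraMap A K)) (hKW : IsSplitSemisimple K (MonoidAlgebra K W))
    (hKH : IsSplitSemisimple K (K ⊗[A] HeckeAlgebra (CoxeterMatrix.I m)))
    (hm : 1 ≤ m) (hf : IsCentralIdempotent f) (hf1 : indexChar m (ringO K) f = 0)
    (hf2 : heckeSignChar m (ringO K) f = 0) :
    ∃ p : K, (p = 0 ∨ p = 1) ∧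
      ∀ (d : ℕ) (ρ : K ⊗[A] HeckeAlgebra (CoxeterMatrix.I m) →ₐ[K] Module.End K (Fin d → K)),
        0 < d → (∀ U : Submodule K (Fin d → K), (∀ r, ∀ v ∈ U, ρ r v ∈ U) → U = ⊥ ∨ U = ⊤) →
        ρ (extendO m K f) = if ρ (baseGen K 0) = ρ (baseGen K 1) then 0 else p • (1 : Module.End K (Fin d → K)) := by
  have := charZero_of_A_injective hinj
  have hQ := one_add_algebraMap_x_ne_zero hinj
  obtain ⟨p, hp, hval⟩ := exists_centralValue cs hinj hKW hm hf
  refine ⟨p, hp.imp (fun h => by rw [h]; rfl) (fun h => by rw [h]; rfl), fun d ρ hd hirr => ?_⟩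
  have : Nontrivial (Fin d → K) := by
    have : Nonempty (Fin d) := ⟨⟨0, hd⟩⟩
    infer_instance
  have hH := (isHecke_algebraMap (S := K)).2 (baseGen_isHecke (m := m) K)
  rcases classify_of_split hKH (Nat.succ_ne_zero (m + 1)) (algebraMap_x_ne_zero hinj) hQ hH
    (adjoin_baseGen K) hirr with ⟨a, -, ha⟩ | ⟨c, hc, b, hb⟩
  · have hinjV : Function.Injective (Algebra.ofId K (Module.End K (Fin d → K))) :=
      (algebraMap K (Module.End K (Fin d → K))).injective
    have haK : IsHecke (m + 2) x a := by
      rw [← isHecke_algebraMap (S := K)]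
      refine IsHecke.of_injective (Algebra.ofId K (Module.End K (Fin d → K))) hinjV ?_
      have : (fun i => Algebra.ofId K (Module.End K (Fin d → K)) (a i)) =
          fun i => ρ (baseGen K i) := by
        funext i
        rw [(ha i).1, Algebra.ofId_apply, Algebra.algebraMap_eq_smul_one]
      rw [this]
      exact hH.map ρ
    obtain ⟨b, hbH, hba, hb⟩ := exists_ringO_lift haK fun i => (ha i).2
    have hρ : ρ = (Algebra.ofId K _).comp (baseLift K haK) := baseHom_ext fun i => by
      rw [(ha i).1, AlgHom.comp_apply, baseLift_gen, Algebra.ofId_apply,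
        Algebra.algebraMap_eq_smul_one]
    have hρf : ρ (extendO m K f) = (baseLift (ringO K) hbH f : K) • 1 := by
      rw [hρ, AlgHom.comp_apply, baseLift_extendO hbH haK hba, Algebra.ofId_apply,
        Algebra.algebraMap_eq_smul_one]
    rw [hρf]
    have hconst : ∀ v, b 0 = v → b 1 = v → ∀ hv : IsQuadratic x v,
        baseLift (ringO K) hbH = constChar m (ringO K) hv := fun v h0 h1 hv =>
      baseHom_ext fun i => by
        rw [baseLift_gen, constChar_gen]
        fin_cases i
        · exact h0
        · exact h1
    have hmixed : (b 0 = algebraMap A (ringO K) x ∧ b 1 = -1 ∨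
        b 0 = -1 ∧ b 1 = algebraMap A (ringO K) x) →
        ((baseLift (ringO K) hbH f : ringO K) : K) • (1 : Module.End K (Fin d → K)) =
          if ρ (baseGen K 0) = ρ (baseGen K 1) then 0 else
            (p : K) • (1 : Module.End K (Fin d → K)) := by
      intro h
      have hne : b 0 ≠ b 1 := by
        rcases h with ⟨h0, h1⟩ | ⟨h0, h1⟩
        · rw [h0, h1]
          intro h
          exact one_add_x_ne_zero_ringO hinj (by rw [h]; ring)
        · rw [h0, h1]
          intro h
          exact one_add_x_ne_zero_ringO hinj (by rw [← h]; ring)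
      rw [if_neg]
      · congr 2
        refine hval (-1) ?_ ?_ _ (Or.inr ⟨rfl, b, hbH, h, rfl⟩)
        -- If `(-1) ^ n ≠ 1`, then `n` is odd, and the braid relation would force equal values on
        -- the two generators.
        · by_contra hodd
          apply hne
          refine eq_of_altProd_eq (fun i => ?_) (fun he => hodd he.neg_one_pow) hbH.braid
          rcases hb i with h | h <;> rw [h]
          · intro h0
            exact algebraMap_x_ne_zero hinj (congrArg Subtype.val h0)
          · exact neg_ne_zero.2 one_ne_zero
        · have : CharZero (AlgebraicClosure K) :=
            charZero_of_injective_algebraMap (algebraMap K (AlgebraicClosure K)).injective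
          norm_num
      · rw [(ha 0).1, (ha 1).1]
        intro h
        apply hne
        apply Subtype.val_injective (p := (· ∈ ringO K))
        rw [hba, hba]
        apply hinjV
        rw [Algebra.ofId_apply, Algebra.ofId_apply, Algebra.algebraMap_eq_smul_one,
          Algebra.algebraMap_eq_smul_one, h]
    have hsame : b 0 = b 1 → ρ (baseGen K 0) = ρ (baseGen K 1) := fun h => by
      rw [(ha 0).1, (ha 1).1, ← hba, ← hba, h]
    rcases hb 0 with h0 | h0 <;> rcases hb 1 with h1 | h1
    · rw [if_pos (hsame (h0.trans h1.symm)), hconst _ h0 h1 (isQuadratic_self x)]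
      have : constChar m (ringO K) (isQuadratic_self x) f = 0 := hf1
      rw [this]
      exact zero_smul _ _
    · exact hmixed (Or.inl ⟨h0, h1⟩)
    · exact hmixed (Or.inr ⟨h0, h1⟩)
    · rw [if_pos (hsame (h0.trans h1.symm)), hconst _ h0 h1 (isQuadratic_neg_one x)]
      have : constChar m (ringO K) (isQuadratic_neg_one x) f = 0 := hf2
      rw [this]
      exact zero_smul _ _
  · rw [if_neg]
    · have hbr := hc.braidSeq_eq_zero (Nat.succ_ne_zero _) (algebraMap_x_ne_zero hinj)
      obtain ⟨ξ, hξ, hξ1, hξ2, hcξ⟩ := hc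
      have hcO : c ∈ ringO K :=
        integralClosure_le_ringO (isIntegral_of_add_inv (Nat.succ_ne_zero _) hξ hcξ)
      have hbrO := braidSeq_ringO (c := ⟨c, hcO⟩) hbr
      obtain ⟨p', -, hp'⟩ := dihRep_central (one_add_x_ne_zero_ringO hinj) hbrO hf
      have hpp : p' = p := hval ξ hξ hξ1 p' (Or.inl ⟨hξ2, _, hbrO, hcξ, hp'⟩)
      have h1 := dihRep_extendO hbrO hbr hp'
      have h2 : (LinearMap.toMatrixAlgEquiv b).toAlgHom.comp ρ = dihRep K hbr :=
        baseHom_ext fun i => by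
          rw [AlgHom.comp_apply, dihRep_gen]
          exact hb i
      rw [← h2, AlgHom.comp_apply, hpp] at h1
      apply (LinearMap.toMatrixAlgEquiv b).injective
      rw [map_smul, map_one]
      exact h1
    -- The upper left entries of the two matrices are `x` and `-1`, which differ.
    · intro h
      have h1 := hb 0
      rw [h, hb 1] at h1
      have h2 := congrFun (congrFun h1 0) 0
      simp only [dihMat_zero, dihMat_one, Matrix.of_apply, Matrix.cons_val_zero,
        Matrix.cons_val', Matrix.cons_val_fin_one] at h2
      exact hQ (by rw [← h2]; ring)

open Classical in
/-- Nonzero central idempotents of `𝒪 H` killed by `T_i ↦ x` and `T_i ↦ -1` are equal. -/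
lemma centralIdempotent_unique {W : Type*} [Group W] (cs : CoxeterSystem (CoxeterMatrix.I m) W)
    (hinj : Function.Injective (algebraMap A K)) (hKW : IsSplitSemisimple K (MonoidAlgebra K W))
    (hKH : IsSplitSemisimple K (K ⊗[A] HeckeAlgebra (CoxeterMatrix.I m)))
    (hm : 1 ≤ m) {f f' : ringO K ⊗[A] HeckeAlgebra (CoxeterMatrix.I m)}
    (hf : IsCentralIdempotent f) (hf1 : indexChar m (ringO K) f = 0)
    (hf2 : heckeSignChar m (ringO K) f = 0) (hf0 : f ≠ 0)
    (hf' : IsCentralIdempotent f') (hf1' : indexChar m (ringO K) f' = 0)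
    (hf2' : heckeSignChar m (ringO K) f' = 0) (hf0' : f' ≠ 0) : f = f' := by
  have key : ∀ {f : ringO K ⊗[A] HeckeAlgebra (CoxeterMatrix.I m)}, IsCentralIdempotent f →
      indexChar m (ringO K) f = 0 → heckeSignChar m (ringO K) f = 0 → f ≠ 0 →
      ∀ (d : ℕ) (ρ : K ⊗[A] HeckeAlgebra (CoxeterMatrix.I m) →ₐ[K] Module.End K (Fin d → K)),
        0 < d → (∀ U : Submodule K (Fin d → K), (∀ r, ∀ v ∈ U, ρ r v ∈ U) → U = ⊥ ∨ U = ⊤) →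
        ρ (extendO m K f) = if ρ (baseGen K 0) = ρ (baseGen K 1) then 0 else 1 := by
    intro f hf hf1 hf2 hf0 d ρ hd hirr
    obtain ⟨p, hp | hp, h⟩ := central_action cs hinj hKW hKH hm hf hf1 hf2
    -- With common value `0`, `f` would act as zero in every irreducible representation and hence be
    -- zero.
    · exfalso
      apply hf0
      apply extendO_injective cs
      rw [map_zero]
      refine eq_zero_of_irreducible hKH fun d ρ hd hirr => ?_
      rw [h d ρ hd hirr, hp, zero_smul, ite_self]
    · rw [h d ρ hd hirr, hp, one_smul]
  apply extendO_injective cs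
  rw [← sub_eq_zero]
  refine eq_zero_of_irreducible hKH fun d ρ hd hirr => ?_
  rw [map_sub, key hf hf1 hf2 hf0 d ρ hd hirr, key hf' hf1' hf2' hf0' d ρ hd hirr, sub_self]

end BlockConstancy

end HeckeFamilies

end

noncomputable section

namespace HeckeFamilies

lemma hom_mem_irrGroup {K G : Type*} [Field K] [Group G] (ψ : G →* K) : ⇑ψ ∈ irrGroup K G :=
  ⟨1, linearRep ψ, linearRep_irreducible ψ, funext fun g => (trace_linearRep ψ g).symm⟩

/-! ### Determination of the blocks -/

section Blocks

variable {m : ℕ} {K : Type*} [Field K] [Algebra A K]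

lemma constChar_extendO {v : ringO K} {v' : K} (hv : IsQuadratic x v) (hv' : IsQuadratic x v')
    (h : (v : K) = v') (z : ringO K ⊗[A] HeckeAlgebra (CoxeterMatrix.I m)) :
    constChar m K hv' (extendO m K z) = constChar m (ringO K) hv z :=
  baseLift_extendO _ _ (fun _ => h) z

/-- Every vector in the image of `e` is an eigenvector for the linear character. A nonzero one
identifies the irreducible representation with that character. -/
lemma eq_zero_of_ne_constChar {v : ringO K} {v' : K} (hv : IsQuadratic x v)
    (hv' : IsQuadratic x v') (h : (v : K) = v') {e : ringO K ⊗[A] HeckeAlgebra (CoxeterMatrix.I m)}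
    (he : IsCharIdempotent (constChar m (ringO K) hv) e) {d : ℕ}
    {ρ : K ⊗[A] HeckeAlgebra (CoxeterMatrix.I m) →ₐ[K] Module.End K (Fin d → K)}
    (hirr : ∀ U : Submodule K (Fin d → K), (∀ r, ∀ v ∈ U, ρ r v ∈ U) → U = ⊥ ∨ U = ⊤)
    (hne : LinearMap.trace K (Fin d → K) ∘ₗ ρ.toLinearMap ≠ (constChar m K hv').toLinearMap) :
    ρ (extendO m K e) = 0 := by
  by_contra h0
  obtain ⟨u, hu⟩ : ∃ u, ρ (extendO m K e) u ≠ 0 := by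
    by_contra hcon
    push Not at hcon
    exact h0 (LinearMap.ext hcon)
  apply hne
  obtain ⟨hd, hρ⟩ := eq_smul_of_eigenvector (adjoin_baseGen K) hirr (constChar m K hv') hu
    fun i => by
      have h1 := congrArg (extendO m K) (he.2 (baseGen (ringO K) i)).1
      rw [constChar_gen, map_mul, extendO_gen, extendO_smul, h] at h1
      rw [← Module.End.mul_apply, ← map_mul, h1, map_smul, LinearMap.smul_apply, constChar_gen]
  exact trace_eq_of_smul (by simpa using hd) hρ

variable {W : Type*} [Group W] (cs : CoxeterSystem (CoxeterMatrix.I m) W)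
  {𝔫 : Ideal (integralClosure A K)}

/-- The characters of `W` corresponding to the irreducible characters of `K H` that satisfy `p`. -/
lemma setOf_corresponds_eq (hinj : Function.Injective (algebraMap A K)) [𝔫.IsPrime]
    (h𝔫 : 𝔫.comap (algebraMap A (integralClosure A K)) = Ideal.span {x - 1})
    (hKW : IsSplitSemisimple K (MonoidAlgebra K W))
    {p : ((K ⊗[A] HeckeAlgebra (CoxeterMatrix.I m)) →ₗ[K] K) → Prop} {p' : (W → K) → Prop}
    (h : ∀ χ ∈ irrAlgebra K (K ⊗[A] HeckeAlgebra (CoxeterMatrix.I m)), ∀ φ ∈ irrGroup K W,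
      Corresponds cs 𝔫 χ φ → (p χ ↔ p' φ)) :
    {φ | φ ∈ irrGroup K W ∧ ∃ χ ∈ irrAlgebra K (K ⊗[A] HeckeAlgebra (CoxeterMatrix.I m)),
      Corresponds cs 𝔫 χ φ ∧ p χ} = {φ | φ ∈ irrGroup K W ∧ p' φ} := by
  ext φ
  constructor
  · rintro ⟨hφ, χ, hχ, hc, hp⟩
    exact ⟨hφ, (h χ hχ φ hφ hc).1 hp⟩
  · rintro ⟨hφ, hp⟩
    obtain ⟨χ, hχ, hc⟩ := exists_corresponds cs hinj h𝔫 hKW hφ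
    exact ⟨hφ, χ, hχ, hc, (h χ hχ φ hφ hc).2 hp⟩

/-- There are irreducible characters of degree `2`. -/
lemma exists_irrAlgebra_two (hinj : Function.Injective (algebraMap A K)) (hm : 1 ≤ m)
    (hKW : IsSplitSemisimple K (MonoidAlgebra K W)) (cs : CoxeterSystem (CoxeterMatrix.I m) W) :
    ∃ (ρ : K ⊗[A] HeckeAlgebra (CoxeterMatrix.I m) →ₐ[K] Module.End K (Fin 2 → K)),
      ∀ U : Submodule K (Fin 2 → K), (∀ r, ∀ v ∈ U, ρ r v ∈ U) → U = ⊥ ∨ U = ⊤ := by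
  have := charZero_of_A_injective hinj
  have : CharZero (AlgebraicClosure K) :=
    charZero_of_injective_algebraMap (algebraMap K (AlgebraicClosure K)).injective
  obtain ⟨ζ, hζ⟩ := HasEnoughRootsOfUnity.exists_primitiveRoot (AlgebraicClosure K) (m + 2)
  have hζ2 : ζ ≠ -1 := by
    intro h
    have : ζ ^ 2 = 1 := by rw [h]; norm_num
    have := Nat.le_of_dvd two_pos (hζ.dvd_of_pow_eq_one 2 this)
    omega
  obtain ⟨c, hc⟩ := exists_eq_add_inv cs hKW hζ.pow_eq_one
  have hc' : IsDihedralParam (m + 2) c := ⟨ζ, hζ.pow_eq_one, hζ.ne_one (by omega), hζ2, hc⟩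
  have hbr := hc'.braidSeq_eq_zero (Nat.succ_ne_zero _) (algebraMap_x_ne_zero hinj)
  exact ⟨_, dihRep_irreducible hinj (mul_ne_zero (algebraMap_x_ne_zero hinj)
    (hc'.ne_neg_two (Nat.succ_ne_zero _))) hbr⟩

/-- The blocks of `𝒪 H` for a dihedral group. -/
theorem heckeBlocks_dihedral (hinj : Function.Injective (algebraMap A K)) (hm : 1 ≤ m)
    (hKH : IsSplitSemisimple K (K ⊗[A] HeckeAlgebra (CoxeterMatrix.I m)))
    (hKW : IsSplitSemisimple K (MonoidAlgebra K W)) [𝔫.IsPrime]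
    (h𝔫 : 𝔫.comap (algebraMap A (integralClosure A K)) = Ideal.span {x - 1}) :
    heckeBlocks cs 𝔫 = {{trivialChar K W}, {signChar cs K},
      {φ | φ ∈ irrGroup K W ∧ φ ≠ trivialChar K W ∧ φ ≠ signChar cs K}} := by
  have := charZero_of_A_injective hinj
  obtain ⟨u, hu⟩ := exists_mul_poincare m hinj
  obtain ⟨e₁, he₁, he₁'⟩ := exists_index_idempotent m hu
  obtain ⟨e₂, he₂, he₂'⟩ := exists_sign_idempotent m hu
  have hvan₁ := fun {d ρ} => eq_zero_of_ne_constChar (K := K) (isQuadratic_self x)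
    (isQuadratic_self x) rfl he₁ (d := d) (ρ := ρ)
  have hvan₂ := fun {d ρ} => eq_zero_of_ne_constChar (K := K) (isQuadratic_neg_one x)
    (isQuadratic_neg_one x) rfl he₂ (d := d) (ρ := ρ)
  have h11 : indexChar m K (extendO m K e₁) = 1 :=
    (constChar_extendO (isQuadratic_self x) (isQuadratic_self x) rfl e₁).trans
      (congrArg Subtype.val he₁.1)
  have h12 : indexChar m K (extendO m K e₂) = 0 :=
    (constChar_extendO (isQuadratic_self x) (isQuadratic_self x) rfl e₂).trans
      (congrArg Subtype.val he₂')
  have h21 : heckeSignChar m K (extendO m K e₁) = 0 :=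
    (constChar_extendO (isQuadratic_neg_one x) (isQuadratic_neg_one x) rfl e₁).trans
      (congrArg Subtype.val he₁')
  have h22 : heckeSignChar m K (extendO m K e₂) = 1 :=
    (constChar_extendO (isQuadratic_neg_one x) (isQuadratic_neg_one x) rfl e₂).trans
      (congrArg Subtype.val he₂.1)
  set e₀ := 1 - e₁ - e₂ with he₀
  have hc₀ : IsCentralIdempotent e₀ :=
    he₁.isCentralIdempotent.one_sub_sub he₂.isCentralIdempotent (by rw [(he₂.2 e₁).1, he₁', zero_smul])
  have h01 : indexChar m (ringO K) e₀ = 0 := by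
    rw [he₀, map_sub, map_sub, map_one, he₁.1, he₂', sub_self, sub_zero]
  have h02 : heckeSignChar m (ringO K) e₀ = 0 := by
    rw [he₀, map_sub, map_sub, map_one, he₂.1, he₁', sub_zero, sub_self]
  have hι : extendO m K e₀ = 1 - extendO m K e₁ - extendO m K e₂ := by
    rw [he₀, map_sub, map_sub, map_one]
  have hχ₁ : ∀ χ ∈ irrAlgebra K (K ⊗[A] HeckeAlgebra (CoxeterMatrix.I m)),
      χ (extendO m K e₁) ≠ 0 ↔ χ = (indexChar m K).toLinearMap := by
    rintro _ ⟨d, ρ, hd, hirr, rfl⟩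
    constructor
    · intro h
      by_contra hne
      apply h
      rw [LinearMap.comp_apply, AlgHom.toLinearMap_apply, hvan₁ hirr hne, map_zero]
    · intro h
      rw [h, AlgHom.toLinearMap_apply, h11]
      exact one_ne_zero
  have hχ₂ : ∀ χ ∈ irrAlgebra K (K ⊗[A] HeckeAlgebra (CoxeterMatrix.I m)),
      χ (extendO m K e₂) ≠ 0 ↔ χ = (heckeSignChar m K).toLinearMap := by
    rintro _ ⟨d, ρ, hd, hirr, rfl⟩
    constructor
    · intro h
      by_contra hne
      apply h
      rw [LinearMap.comp_apply, AlgHom.toLinearMap_apply, hvan₂ hirr hne, map_zero]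
    · intro h
      rw [h, AlgHom.toLinearMap_apply, h22]
      exact one_ne_zero
  have hχ₀ : ∀ χ ∈ irrAlgebra K (K ⊗[A] HeckeAlgebra (CoxeterMatrix.I m)),
      χ (extendO m K e₀) ≠ 0 ↔
        χ ≠ (indexChar m K).toLinearMap ∧ χ ≠ (heckeSignChar m K).toLinearMap := by
    rintro _ ⟨d, ρ, hd, hirr, rfl⟩
    rw [hι]
    constructor
    · intro h
      refine ⟨fun h1 => h ?_, fun h1 => h ?_⟩
      · rw [h1, AlgHom.toLinearMap_apply, map_sub, map_sub, map_one, h11, h12, sub_self, sub_zero]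
      · rw [h1, AlgHom.toLinearMap_apply, map_sub, map_sub, map_one, h21, h22, sub_zero, sub_self]
    · rintro ⟨h1, h2⟩
      rw [LinearMap.comp_apply, AlgHom.toLinearMap_apply, map_sub ρ, map_sub ρ, map_one ρ, hvan₁ hirr h1,
        hvan₂ hirr h2, sub_zero, sub_zero, trace_one]
      exact Nat.cast_ne_zero.2 hd.ne'
  -- A representation of degree two differs from both linear characters, and the complementary
  -- idempotent acts on it as the identity.
  have hne₀ : e₀ ≠ 0 := by
    intro h
    obtain ⟨ρ, hirr⟩ := exists_irrAlgebra_two hinj hm hKW cs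
    have hone : ∀ ψ : K ⊗[A] HeckeAlgebra (CoxeterMatrix.I m) →ₐ[K] K,
        LinearMap.trace K (Fin 2 → K) ∘ₗ ρ.toLinearMap ≠ ψ.toLinearMap := by
      intro ψ h
      have h1 := LinearMap.congr_fun h 1
      rw [LinearMap.comp_apply, AlgHom.toLinearMap_apply, AlgHom.toLinearMap_apply, map_one ρ,
        map_one ψ, trace_one] at h1
      norm_num at h1
    refine (hχ₀ _ ⟨2, ρ, two_pos, hirr, rfl⟩).2 ⟨hone _, hone _⟩ ?_
    rw [h, map_zero, map_zero]
  -- A nonzero central idempotent `f = f e₀` is killed by both linear characters, as `e₀` is;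
  -- uniqueness gives `f = e₀`.
  have hB₀ : IsBlockIdempotent e₀ := by
    refine ⟨hc₀, hne₀, fun f hf hfe => or_iff_not_imp_left.2 fun hf0 => ?_⟩
    refine centralIdempotent_unique cs hinj hKW hKH hm hf ?_ ?_ hf0 hc₀ h01 h02 hne₀
    · rw [← hfe, map_mul, h01, mul_zero]
    · rw [← hfe, map_mul, h02, mul_zero]
  have hblocks : ∀ f, IsBlockIdempotent f ↔ f = e₁ ∨ f = e₂ ∨ f = e₀ := by
    intro f
    rw [isBlockIdempotent_iff_of_sum (s := Finset.univ) (e := ![e₁, e₂, e₀])]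
    · simp [Fin.exists_fin_succ]
    · intro i _
      fin_cases i
      · exact he₁.isBlockIdempotent
      · exact he₂.isBlockIdempotent
      · exact hB₀
    · rw [Fin.sum_univ_three]
      simp [he₀]
  have htriv : ∀ χ ∈ irrAlgebra K (K ⊗[A] HeckeAlgebra (CoxeterMatrix.I m)),
      ∀ φ ∈ irrGroup K W, Corresponds cs 𝔫 χ φ →
        (χ = (indexChar m K).toLinearMap ↔ φ = trivialChar K W) := fun χ hχ φ hφ h =>
    corresponds_linear_iff cs hinj h𝔫 hχ hφ h (isQuadratic_self x) 1 (u := 1) (fun _ => rfl)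
      (Or.inl ⟨rfl, rfl⟩)
  have hsignChar : signChar cs K = signHom cs K := funext fun w => (signHom_apply cs K w).symm
  have hsign : ∀ χ ∈ irrAlgebra K (K ⊗[A] HeckeAlgebra (CoxeterMatrix.I m)),
      ∀ φ ∈ irrGroup K W, Corresponds cs 𝔫 χ φ →
        (χ = (heckeSignChar m K).toLinearMap ↔ φ = signChar cs K) := fun χ hχ φ hφ h => by
    rw [hsignChar]
    exact corresponds_linear_iff cs hinj h𝔫 hχ hφ h (isQuadratic_neg_one x) (signHom cs K)
      (signHom_simple cs K) (Or.inr ⟨rfl, rfl⟩)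
  have hF₁ := setOf_corresponds_eq cs hinj h𝔫 hKW fun χ hχ φ hφ h =>
    (hχ₁ χ hχ).trans (htriv χ hχ φ hφ h)
  have hF₂ := setOf_corresponds_eq cs hinj h𝔫 hKW fun χ hχ φ hφ h =>
    (hχ₂ χ hχ).trans (hsign χ hχ φ hφ h)
  have hF₀ := setOf_corresponds_eq cs hinj h𝔫 hKW fun χ hχ φ hφ h =>
    (hχ₀ χ hχ).trans (and_congr (htriv χ hχ φ hφ h).not (hsign χ hχ φ hφ h).not)
  have hs₁ : {φ | φ ∈ irrGroup K W ∧ φ = trivialChar K W} = {trivialChar K W} := by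
    ext φ
    refine ⟨fun h => h.2, fun h => ⟨?_, h⟩⟩
    rw [Set.mem_singleton_iff.1 h]
    exact hom_mem_irrGroup 1
  have hs₂ : {φ | φ ∈ irrGroup K W ∧ φ = signChar cs K} = {signChar cs K} := by
    ext φ
    refine ⟨fun h => h.2, fun h => ⟨?_, h⟩⟩
    rw [Set.mem_singleton_iff.1 h, hsignChar]
    exact hom_mem_irrGroup _
  rw [hs₁] at hF₁
  rw [hs₂] at hF₂
  ext F
  simp only [Set.mem_insert_iff, Set.mem_singleton_iff]
  constructor
  · rintro ⟨e, he, rfl⟩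
    rcases (hblocks e).1 he with rfl | rfl | rfl
    · exact Or.inl hF₁
    · exact Or.inr (Or.inl hF₂)
    · exact Or.inr (Or.inr hF₀)
  · rintro (rfl | rfl | rfl)
    · exact ⟨e₁, he₁.isBlockIdempotent, hF₁.symm⟩
    · exact ⟨e₂, he₂.isBlockIdempotent, hF₂.symm⟩
    · exact ⟨e₀, hB₀, hF₀.symm⟩

end Blocks

end HeckeFamilies

end

theorem mainTheorem7 (n : ℕ) (hn : 3 ≤ n)
    {W : Type*} [Group W] (cs : CoxeterSystem (CoxeterMatrix.I (n - 2)) W)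
    (k : Type*) [Field k] [NumberField k]
    (K : Type*) [Field K] [Algebra (RatFunc k) K] [FiniteDimensional (RatFunc k) K]
    [IsGalois (RatFunc k) K]
    [Algebra HeckeFamilies.A K]
    (hx : algebraMap HeckeFamilies.A K HeckeFamilies.x = algebraMap (RatFunc k) K RatFunc.X)
    (hKH : HeckeFamilies.IsSplitSemisimple K
      (K ⊗[HeckeFamilies.A] HeckeFamilies.HeckeAlgebra (CoxeterMatrix.I (n - 2))))
    (hKW : HeckeFamilies.IsSplitSemisimple K (MonoidAlgebra K W))
    (𝔫 : Ideal (integralClosure HeckeFamilies.A K)) [𝔫.IsPrime]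
    (h𝔫 : 𝔫.comap (algebraMap HeckeFamilies.A (integralClosure HeckeFamilies.A K)) =
      Ideal.span {HeckeFamilies.x - 1}) :
    HeckeFamilies.heckeBlocks cs 𝔫 = HeckeFamilies.lusztigFamilies cs K ∧
    HeckeFamilies.lusztigFamilies cs K =
      {{HeckeFamilies.trivialChar K W}, {HeckeFamilies.signChar cs K},
        {φ | φ ∈ HeckeFamilies.irrGroup K W ∧ φ ≠ HeckeFamilies.trivialChar K W ∧
          φ ≠ HeckeFamilies.signChar cs K}} := by
  have hinj := HeckeFamilies.algebraMap_A_injective hx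
  have hm : 1 ≤ n - 2 := by omega
  have := HeckeFamilies.charZero_of_A_injective hinj
  have h := HeckeFamilies.lusztigFamilies_dihedral cs K hm
  exact ⟨(HeckeFamilies.heckeBlocks_dihedral cs hinj hm hKH hKW h𝔫).trans h.symm, h⟩
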